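/- **Setting.** The colored alphabet consists of the unbarred letters $1,2,\dots$ and the barred letters $\bar1,\bar2,\dots$. The natural order is $\bar1<1<\bar2<2<\cdots$; the small bar order is $\bar1\prec\bar2\prec\cdots\prec1\prec2\prec\cdots$. A semistandard colored tableau for one of these orders is a filling of the Young diagram of a partition by colored letters that is weakly increasing along rows and down columns, such that equal unbarred letters never lie in the same column and equal barred letters never lie in the same row. It has content $(m^t)$ if, for each $1\le s\le t$, the letters $s$ and $\bar s$ together occur exactly $m$ times, and no other letters occur. Its total color is its number of barred letters. **Conversion.** A semistandard colored tableau $T^{\prec}$ for the small bar order is converted to a tableau $(T^{\prec})^<$ for the natural order as follows. Take the barred letters one after the other, larger letters first, and the lower one first among equal letters. Move each such letter $\bar b$ by jeu de taquin: as long as the box directly to the right of $\bar b$ or the box directly below it contains an unbarred letter less than $b$, switch $\bar b$ with the smaller one of these (at most two) letters, and with the one below in case of a tie. A tableau $T^<$ for the natural order is converted to a tableau $(T^<)^{\prec}$ for the small bar order by reversing these steps: take the barred letters one after the other, smaller letters first, and the upper one first among equal letters; as long as there is an unbarred letter directly to the left of or directly above the barred letter, switch it with the larger one of these letters, and with the one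 above in case of a tie. **Yamanouchi tableaux.** For a semistandard colored tableau $T^{\prec}$ for the small bar order let $T^b$ be its subtableau of barred letters, $\eta$ the shape of $T^b$ and $\ell(\eta)$ the number of rows of $\eta$. Let $\mathbb T$ be the skew tableau obtained by placing $T^{\prec}/T^b$ above and to the right of the transpose of $T^b$ and removing the bars. A semistandard colored tableau $T^<$ for the natural order is Yamanouchi if the word obtained by reading the array $\mathbb T$ of $T^{\prec}=(T^<)^{\prec}$ row by row, from top to bottom and each row from right to left, is a lattice permutation (every initial factor contains at least as many letters $s$ as letters $s+1$, for all $s\ge1$). **The maps.** Fix integers $m\ge1$ and $d\ge1$. For $w\ge1$ let $B_w^<$ be the set of Yamanouchi semistandard colored tableaux for the natural order, of any shape, of content $(m^{d+w})$ and total color $d$. Let $w\ge2$. For $T^<\in B_w^<$ and $T^{\prec}=(T^<)^{\prec}$, let $\varphi(T^{\prec})$ be obtained from $T^{\prec}$ by increasing each barred letter by $1$, keeping the unbarred letters of the first $\ell(\eta)+w-1$ rows, inserting below these rows a row of length $m$ in which each letter is $1$ more than the letter directly above it, and increasing each letter of the remaining rows by $1$. Put $\psi(T^<)=\big(\varphi((T^<)^{\prec})\big)^<$.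 **Theorem.** For all integers $m\ge1$, $d\ge1$ and $w\ge2$, the map $\psi$ is a bijection from $B_w^<$ onto $B_{w+1}^<$. Moreover, for every $T^<\in B_w^<$, the letter in the south-west corner (the first box of the last row) of $\psi(T^<)$ is barred if and only if the letter in the south-west corner of $T^<$ is barred. -/

import Mathlib

/-- A letter of the colored alphabet: `⟨s, false⟩` is the ordinary letter `s`, `⟨s, true⟩` is the
barred letter `s̄`. (The letters of the alphabet have `1 ≤ s`; the content condition below excludes
`s = 0`.) -/
@[ext]
structure Letter where
  val : ℕ
  bar : Bool
deriving DecidableEq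

/-- The natural order: `1̄ < 1 < 2̄ < 2 < ⋯`. -/
def NaturalLT (a b : Letter) : Prop :=
  a.val < b.val ∨ (a.val = b.val ∧ a.bar = true ∧ b.bar = false)

/-- An array of letters in left-justified rows, listed from top to bottom. -/
abbrev Filling := List (List Letter)

namespace Filling

/-- The entry of the box in row `i` and column `j` (both counted from `0`), if there is one. -/
def entry (T : Filling) (i j : ℕ) : Option Letter :=
  T[i]?.bind fun row => row[j]?

/-- The rows are nonempty and their lengths form a partition. -/
def HasPartitionShape (T : Filling) : Prop :=
  (∀ row ∈ T, row ≠ []) ∧ (T.map List.length).Pairwise (· ≥ ·)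

/-- Semistandard colored tableau of partition shape for a strict order `lt` on the letters: rows and
columns increase weakly, equal unbarred letters do not share a column, and equal barred letters do
not share a row. -/
def IsSemistandard (lt : Letter → Letter → Prop) (T : Filling) : Prop :=
  T.HasPartitionShape ∧
  (∀ i j a b, T.entry i j = some a → T.entry i (j + 1) = some b →
    lt a b ∨ (a = b ∧ a.bar = false)) ∧
  (∀ i j a b, T.entry i j = some a → T.entry (i + 1) j = some b →
    lt a b ∨ (a = b ∧ a.bar = true))

/-- Content `(m^t)`: for each `1 ≤ s ≤ t` the letters `s` and `s̄` together occur `m` times, and no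
other letters occur. -/
def HasRectContent (m t : ℕ) (T : Filling) : Prop :=
  ∀ s : ℕ, T.flatten.countP (fun x => x.val = s) = if 1 ≤ s ∧ s ≤ t then m else 0

/-- The total color: the number of barred letters. -/
def totalColor (T : Filling) : ℕ := T.flatten.countP fun x => x.bar

/-- The number of boxes. -/
def size (T : Filling) : ℕ := T.flatten.length

/-! ### Jeu-de-taquin conversion between the two orders -/

/-- Overwrite the entry of the box `c`. -/
def setEntry (T : Filling) (c : ℕ × ℕ) (x : Letter) : Filling :=
  T.modify c.1 fun row => row.set c.2 x

/-- Exchange the entries of the boxes `c` and `c'`. -/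
def swap (T : Filling) (c c' : ℕ × ℕ) : Filling :=
  match T.entry c.1 c.2, T.entry c'.1 c'.2 with
  | some a, some b => (T.setEntry c b).setEntry c' a
  | _, _ => T

/-- The boxes with barred letters, listed by increasing letter, boxes with the same barred letter
being listed from top to bottom. -/
def barredBoxes (T : Filling) : List (ℕ × ℕ) :=
  (List.range ((T.flatten.map Letter.val).foldr max 0 + 1)).flatMap fun s =>
    (List.range T.length).flatMap fun i =>
      (List.range (T.getD i []).length).filterMap fun j =>
        if T.entry i j = some ⟨s, true⟩ then some (i, j) else none

/-- One jeu-de-taquin move of a barred letter `b̄` in the box `c` towards the south-east: among the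
boxes directly to the right of and directly below `c`, consider those containing an unbarred
letter smaller than `b`; `b̄` has to be switched with the smaller one of these letters, and with the
one below in the case of a tie. The result is the box that `b̄` moves to; it is `none` if `b̄` is in
its final position. -/
def nextSE (T : Filling) (c : ℕ × ℕ) : Option (ℕ × ℕ) :=
  let b := ((T.entry c.1 c.2).map Letter.val).getD 0
  let right := (T.entry c.1 (c.2 + 1)).filter fun y => !y.bar && decide (y.val < b)
  let below := (T.entry (c.1 + 1) c.2).filter fun y => !y.bar && decide (y.val < b)
  match right, below with
  | none, none => none
  | some _, none => some (c.1, c.2 + 1)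
  | none, some _ => some (c.1 + 1, c.2)
  | some y, some z => if y.val < z.val then some (c.1, c.2 + 1) else some (c.1 + 1, c.2)

/-- The reversed move, towards the north-west: the barred letter in the box `c` is switched with the
larger one of the unbarred letters directly to the left of and directly above it, and with the one
above in the case of a tie. -/
def nextNW (T : Filling) (c : ℕ × ℕ) : Option (ℕ × ℕ) :=
  let left := (if c.2 = 0 then none else T.entry c.1 (c.2 - 1)).filter fun y => !y.bar
  let above := (if c.1 = 0 then none else T.entry (c.1 - 1) c.2).filter fun y => !y.bar
  match left, above with
  | none, none => none
  | some _, none => some (c.1, c.2 - 1)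
  | none, some _ => some (c.1 - 1, c.2)
  | some y, some z => if z.val < y.val then some (c.1, c.2 - 1) else some (c.1 - 1, c.2)

/-- Move the letter in the box `c` as long as `next` tells it to, but at most `n` times. -/
def slide (next : Filling → ℕ × ℕ → Option (ℕ × ℕ)) : ℕ → Filling → ℕ × ℕ → Filling
  | 0, T, _ => T
  | n + 1, T, c =>
    match next T c with
    | none => T
    | some c' => slide next n (T.swap c c') c'

/-- Conversion from the small bar order to the natural order: the barred letters are moved to the
south-east one after the other, larger letters first, and the lower one first among equal letters.
(A letter makes fewer moves than there are boxes.) -/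
def toNatural (T : Filling) : Filling :=
  T.barredBoxes.reverse.foldl (slide nextSE T.size) T

/-- Conversion from the natural order to the small bar order, by the reversed steps: the barred
letters are moved to the north-west, smaller letters first, and the upper one first among equal
letters. -/
def toSmallBar (T : Filling) : Filling :=
  T.barredBoxes.foldl (slide nextNW T.size) T

/-! ### Yamanouchi tableaux -/

/-- The number of rows containing a barred letter. For a semistandard tableau for the small bar
order this is the length `ℓ(η)` of the shape `η` of its subtableau of barred letters. -/
def barredLength (T : Filling) : ℕ := T.countP fun row => row.any Letter.bar

/-- The number of columns of a tableau. -/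
def width (T : Filling) : ℕ := (T.getD 0 []).length

/-- For a semistandard tableau `T` for the small bar order with subtableau `T^b` of barred letters:
the skew array obtained by placing `T / T^b` above and to the right of the transpose of `T^b`, whose
letters lose their bars. -/
def unfolded (T : Filling) (i j : ℕ) : Option ℕ :=
  if i < T.length then
    if T.barredLength ≤ j then
      ((T.entry i (j - T.barredLength)).filter fun x => !x.bar).map Letter.val
    else none
  else ((T.entry j (i - T.length)).filter fun x => x.bar).map Letter.val

/-- The reverse reading word of the unfolded array: rows from top to bottom, each row from right to
left. -/
def reverseReadingWord (T : Filling) : List ℕ :=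
  (List.range (T.length + T.width)).flatMap fun i =>
    (List.range (T.barredLength + T.width)).reverse.filterMap fun j => T.unfolded i j

end Filling

/-- Lattice permutations: every initial factor contains at least as many letters `s` as letters
`s + 1`, for all `s ≥ 1`. -/
def IsLatticePermutation (u : List ℕ) : Prop :=
  ∀ v, v <+: u → ∀ s, 1 ≤ s → v.count (s + 1) ≤ v.count s

namespace Filling

/-- A colored tableau for the natural order is Yamanouchi if, after conversion to the small bar
order, the reverse reading word of the unfolded array is a lattice permutation. -/
def IsYamanouchi (T : Filling) : Prop := IsLatticePermutation T.toSmallBar.reverseReadingWord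

/-- The set `B_w^<` of Yamanouchi semistandard colored tableaux for the natural order, of content
`(m^(d+w))` and total color `d`. -/
def B (m d w : ℕ) : Set Filling :=
  {T | T.IsSemistandard NaturalLT ∧ T.HasRectContent m (d + w) ∧ T.totalColor = d ∧ T.IsYamanouchi}

/-! ### The maps `φ` and `ψ` -/

/-- The letter obtained by adding one. -/
def raise (x : Letter) : Letter := ⟨x.val + 1, x.bar⟩

/-- Add one to the barred letters only. -/
def raiseBarred (x : Letter) : Letter := if x.bar then raise x else x

/-- The map `φ` on tableaux for the small bar order (for `w ≥ 2`). With `r = ℓ(η) + w - 1`: barred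
letters are raised by one (all of them are in the first `r` rows), the unbarred letters of the first
`r` rows are kept, below row `r` a row of length `m` is inserted in which each letter is one more
than the letter directly above it, and all letters of the remaining rows are raised by one. -/
def phi (m w : ℕ) (T : Filling) : Filling :=
  let r := T.barredLength + (w - 1)
  (T.take r).map (List.map raiseBarred) ++
    [((T.getD (r - 1) []).take m).map raise] ++
    (T.drop r).map (List.map raise)

/-- The map `ψ`: convert to the small bar order, apply `φ`, convert back to the natural order. -/
def psi (m w : ℕ) (T : Filling) : Filling := (phi m w T.toSmallBar).toNatural

/-- The letter in the south-west corner, i.e. the first letter of the last row, is barred. -/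
def SWCornerBarred (T : Filling) : Prop := ∃ x, T.entry (T.length - 1) 0 = some x ∧ x.bar = true

end Filling

/-! The proof has three ingredients.

Inverse conversions. The barred letters get labels 0, …, d-1 in increasing order, equal ones from
top to bottom, and letters are replaced by integer keys. Label k has a key below all unbarred
letters before its slide, and a key just below that of the unbarred letter with the same number
after it. The slide of one letter is then the movement of a hole through entries whose keys lie
strictly between these two values. Switching with the smaller neighbour, ties going down, keeps rows
weakly and columns strictly increasing, and the opposite rule leads back (`Hole.step`,
`Hole.condNW`). Paths of successive slides do not cross (`Hole.row_lt`), so equal barred letters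
stay in vertical order and the reverse conversion meets them in exactly the reverse order. Hence
`toNatural` and `toSmallBar` are mutually inverse, and `psi` is `phi` seen through these bijections.

Bijectivity of `phi`. For content (m^N) with N = d + w, the lattice condition splits into a
Littlewood–Richardson condition on the unbarred letters and the condition that each row of barred
letters is an interval ending with N (`IsSemistandard.lattice_iff`). Counting the d barred letters
shows that all of them are at least ℓ(η) + w. So with r = ℓ(η) + w - 1 the letters 1, …, r are never
barred and occur m times each. The m letters r lie in different columns and not above row r, so each
of the rows ℓ(η) + 1, …, r contains at least m unbarred letters. Summing the Littlewood–Richardson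
inequalities of such a row forces equality in all of them. The row has exactly m boxes, and
consecutive rows in this range differ by one. The row inserted by `phi` continues this pattern.
Conversely, for w + 1 the row r + 1 is forced to be one more than row r and can be removed
(`bijOn_phi`).

South-west corner. Slides preserve the Littlewood–Richardson condition (`Mid.isLR_swap`), so after
every complete slide the rows ℓ(η) + 1, …, r are again without bars and differ by one. The barred
letter takes the same path in T and in φ(T) until row r. If it continues below that row in φ(T), it
makes one additional step down there and then follows the same path one row lower. Therefore the
last row of the converted φ(T) is the raised last row of the converted T
(`IsGood.expanded_toNatural`). -/

namespace GridSlide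

/-! ### Slides of a hole in a filling of the integral grid. -/

/-- Exchange the values of `f` at `c` and `c'`. -/
def swapAt (f : ℤ × ℤ → ℤ) (c c' : ℤ × ℤ) : ℤ × ℤ → ℤ :=
  fun e => if e = c then f c' else if e = c' then f c else f e

/-- A semistandard filling of `D` with a hole at `c`: the values to the north-west of the hole are
below `hi` and the values to its south-east are above `lo`. -/
structure Hole (D : Set (ℤ × ℤ)) (f : ℤ × ℤ → ℤ) (c : ℤ × ℤ) (lo hi : ℤ) : Prop where
  mem : c ∈ D
  conv : ∀ i j i' j' k l, (i, j) ∈ D → (i', j') ∈ D → i ≤ k → k ≤ i' → j ≤ l → l ≤ j' → (k, l) ∈ D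
  mono : ∀ i j i' j', (i, j) ∈ D → (i', j') ∈ D → (i, j) ≠ c → (i', j') ≠ c → i ≤ i' → j ≤ j' →
    f (i, j) ≤ f (i', j') ∧ (i < i' → f (i, j) < f (i', j'))
  lt_hi : ∀ i j, (i, j) ∈ D → (i, j) ≠ c → i ≤ c.1 → j ≤ c.2 → f (i, j) < hi
  lo_lt : ∀ i j, (i, j) ∈ D → (i, j) ≠ c → c.1 ≤ i → c.2 ≤ j → lo < f (i, j)

/-- The hole at `c` has to move to `c'`, towards the south-east, through values below `hi`. -/
def CondSE (D : Set (ℤ × ℤ)) (hi : ℤ) (f : ℤ × ℤ → ℤ) (c c' : ℤ × ℤ) : Prop :=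
  (c' = (c.1 + 1, c.2) ∧ c' ∈ D ∧ f c' < hi ∧
    ((c.1, c.2 + 1) ∈ D → f (c.1 + 1, c.2) ≤ f (c.1, c.2 + 1))) ∨
  (c' = (c.1, c.2 + 1) ∧ c' ∈ D ∧ f c' < hi ∧
    ((c.1 + 1, c.2) ∈ D → f (c.1, c.2 + 1) < f (c.1 + 1, c.2)))

/-- The hole at `c` has to move to `c'`, towards the north-west, through values above `lo`. -/
def CondNW (D : Set (ℤ × ℤ)) (lo : ℤ) (f : ℤ × ℤ → ℤ) (c c' : ℤ × ℤ) : Prop :=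
  (c' = (c.1 - 1, c.2) ∧ c' ∈ D ∧ lo < f c' ∧
    ((c.1, c.2 - 1) ∈ D → f (c.1, c.2 - 1) ≤ f (c.1 - 1, c.2))) ∨
  (c' = (c.1, c.2 - 1) ∧ c' ∈ D ∧ lo < f c' ∧
    ((c.1 - 1, c.2) ∈ D → f (c.1 - 1, c.2) < f (c.1, c.2 - 1)))

/-- Slides towards the south-east, recorded together with the positions of the hole. -/
inductive ChainSE (D : Set (ℤ × ℤ)) (hi : ℤ) :
    (ℤ × ℤ → ℤ) → ℤ × ℤ → (ℤ × ℤ → ℤ) → ℤ × ℤ → Prop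
  | refl (f c) : ChainSE D hi f c f c
  | step {f c c' g e} : CondSE D hi f c c' → ChainSE D hi (swapAt f c c') c' g e →
      ChainSE D hi f c g e

/-- Slides towards the north-west. -/
inductive ChainNW (D : Set (ℤ × ℤ)) (lo : ℤ) :
    (ℤ × ℤ → ℤ) → ℤ × ℤ → (ℤ × ℤ → ℤ) → ℤ × ℤ → Prop
  | refl (f c) : ChainNW D lo f c f c
  | step {f c c' g e} : CondNW D lo f c c' → ChainNW D lo (swapAt f c c') c' g e →
      ChainNW D lo f c g e

variable {D : Set (ℤ × ℤ)} {f g : ℤ × ℤ → ℤ} {c c' e : ℤ × ℤ} {lo hi : ℤ}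

theorem swapAt_left : swapAt f c c' c = f c' := by simp [swapAt]

theorem swapAt_right : swapAt f c c' c' = f c := by
  by_cases h : c' = c
  · rw [h]; simp [swapAt]
  · simp [swapAt, h]

theorem swapAt_of_ne (h : e ≠ c) (h' : e ≠ c') : swapAt f c c' e = f e := by simp [swapAt, h, h']

theorem swapAt_swapAt : swapAt (swapAt f c c') c' c = f := by
  funext e
  by_cases h : e = c
  · subst h; rw [swapAt_right, swapAt_right]
  by_cases h' : e = c'
  · subst h'; rw [swapAt_left, swapAt_left]
  rw [swapAt_of_ne h' h, swapAt_of_ne h h']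

/-- The value that moves is the smallest one to the south-east of the hole, by monotonicity from the
two neighbours. Sending ties downwards makes it strictly smaller than everything in lower rows, so
columns stay strict. -/
theorem Hole.step (H : Hole D f c lo hi) (h : CondSE D hi f c c') :
    Hole D (swapAt f c c') c' lo hi := by
  obtain ⟨ci, cj⟩ := c
  obtain ⟨mem, conv, mono, lt_hi, lo_lt⟩ := H
  simp only [CondSE] at *
  rcases h with ⟨rfl, hD, hlt, hr⟩ | ⟨rfl, hD, hlt, hb⟩
  · have key : ∀ i j, (i, j) ∈ D → (i, j) ≠ (ci, cj) → (i, j) ≠ (ci + 1, cj) → ci ≤ i → cj ≤ j →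
        f (ci + 1, cj) ≤ f (i, j) ∧ (ci < i → f (ci + 1, cj) < f (i, j)) := by
      intro i j h1 h2 h3 h4 h5
      simp only [ne_eq, Prod.mk.injEq, not_and] at h2 h3
      by_cases hj : j = cj
      · have := mono (ci + 1) cj i j hD h1 (by simp) (by simp; omega) (by omega) (by omega)
        exact ⟨this.1, fun _ => this.2 (by omega)⟩
      · have hR : (ci, cj + 1) ∈ D := conv _ _ _ _ _ _ mem h1 le_rfl h4 (by omega) (by omega)
        have h6 := hr hR
        have := mono ci (cj + 1) i j hR h1 (by simp) (by simp; omega) (by omega) (by omega)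
        exact ⟨by omega, fun h => by have := this.2 h; omega⟩
    have key' : ∀ i j, (i, j) ∈ D → (i, j) ≠ (ci, cj) → i ≤ ci → j ≤ cj →
        f (i, j) < f (ci + 1, cj) := by
      intro i j h1 h2 h3 h4
      exact (mono i j (ci + 1) cj h1 hD h2 (by simp) (by omega) h4).2 (by omega)
    refine ⟨hD, conv, ?_, ?_, ?_⟩
    · intro i j i' j' h1 h2 h3 h4 hi hj
      by_cases e1 : (i, j) = (ci, cj)
      · by_cases e2 : (i', j') = (ci, cj)
        · rw [e1, e2]; refine ⟨le_rfl, fun h => ?_⟩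
          simp only [Prod.mk.injEq] at e1 e2; omega
        · rw [e1, swapAt_left, swapAt_of_ne e2 h4]
          simp only [Prod.mk.injEq] at e1
          have := key i' j' h2 e2 h4 (by omega) (by omega)
          exact ⟨this.1, fun h => this.2 (by omega)⟩
      · by_cases e2 : (i', j') = (ci, cj)
        · rw [e2, swapAt_left, swapAt_of_ne e1 h3]
          simp only [Prod.mk.injEq] at e2
          have := key' i j h1 e1 (by omega) (by omega)
          exact ⟨this.le, fun _ => this⟩
        · rw [swapAt_of_ne e1 h3, swapAt_of_ne e2 h4]
          exact mono i j i' j' h1 h2 e1 e2 hi hj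
    · intro i j h1 h2 h3 h4
      simp only at h3 h4
      by_cases e1 : (i, j) = (ci, cj)
      · rw [e1, swapAt_left]; exact hlt
      · rw [swapAt_of_ne e1 h2]
        exact ((mono i j _ _ h1 hD e1 (by simp) h3 h4).1).trans_lt hlt
    · intro i j h1 h2 h3 h4
      simp only at h3 h4
      have e1 : (i, j) ≠ (ci, cj) := by simp only [ne_eq, Prod.mk.injEq]; omega
      rw [swapAt_of_ne e1 h2]
      exact lo_lt i j h1 e1 (by omega) h4
  · have key : ∀ i j, (i, j) ∈ D → (i, j) ≠ (ci, cj) → (i, j) ≠ (ci, cj + 1) → ci ≤ i → cj ≤ j →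
        f (ci, cj + 1) ≤ f (i, j) ∧ (ci < i → f (ci, cj + 1) < f (i, j)) := by
      intro i j h1 h2 h3 h4 h5
      simp only [ne_eq, Prod.mk.injEq, not_and] at h2 h3
      by_cases hj : i = ci
      · have := mono ci (cj + 1) i j hD h1 (by simp) (by simp; omega) (by omega) (by omega)
        exact ⟨this.1, fun _ => this.2 (by omega)⟩
      · have hR : (ci + 1, cj) ∈ D := conv _ _ _ _ _ _ mem h1 (by omega) (by omega) (by omega) (by omega)
        have h6 := hb hR
        have := mono (ci + 1) cj i j hR h1 (by simp) (by simp; omega) (by omega) (by omega)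
        exact ⟨by omega, fun h => by omega⟩
    have key' : ∀ i j, (i, j) ∈ D → (i, j) ≠ (ci, cj) → i ≤ ci → j ≤ cj →
        f (i, j) ≤ f (ci, cj + 1) ∧ (i < ci → f (i, j) < f (ci, cj + 1)) := by
      intro i j h1 h2 h3 h4
      exact mono i j ci (cj + 1) h1 hD h2 (by simp) (by omega) (by omega)
    refine ⟨hD, conv, ?_, ?_, ?_⟩
    · intro i j i' j' h1 h2 h3 h4 hi hj
      by_cases e1 : (i, j) = (ci, cj)
      · by_cases e2 : (i', j') = (ci, cj)
        · rw [e1, e2]; refine ⟨le_rfl, fun h => ?_⟩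
          simp only [Prod.mk.injEq] at e1 e2; omega
        · rw [e1, swapAt_left, swapAt_of_ne e2 h4]
          simp only [Prod.mk.injEq] at e1
          have := key i' j' h2 e2 h4 (by omega) (by omega)
          exact ⟨this.1, fun h => this.2 (by omega)⟩
      · by_cases e2 : (i', j') = (ci, cj)
        · rw [e2, swapAt_left, swapAt_of_ne e1 h3]
          simp only [Prod.mk.injEq] at e2
          have := key' i j h1 e1 (by omega) (by omega)
          exact ⟨this.1, fun h => this.2 (by omega)⟩
        · rw [swapAt_of_ne e1 h3, swapAt_of_ne e2 h4]
          exact mono i j i' j' h1 h2 e1 e2 hi hj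
    · intro i j h1 h2 h3 h4
      simp only at h3 h4
      by_cases e1 : (i, j) = (ci, cj)
      · rw [e1, swapAt_left]; exact hlt
      · rw [swapAt_of_ne e1 h2]
        exact ((mono i j _ _ h1 hD e1 (by simp) h3 h4).1).trans_lt hlt
    · intro i j h1 h2 h3 h4
      simp only at h3 h4
      have e1 : (i, j) ≠ (ci, cj) := by simp only [ne_eq, Prod.mk.injEq]; omega
      rw [swapAt_of_ne e1 h2]
      exact lo_lt i j h1 e1 h3 (by omega)

/-- After a step down, the left neighbour of the new hole is at most the moved value, and the tie
rule prefers the box above. After a step to the right, the box above the new hole is strictly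
smaller than the moved value, by strictness of columns. -/
theorem Hole.condNW (H : Hole D f c lo hi) (h : CondSE D hi f c c') :
    CondNW D lo (swapAt f c c') c' c := by
  obtain ⟨ci, cj⟩ := c
  obtain ⟨mem, conv, mono, lt_hi, lo_lt⟩ := H
  simp only [CondSE] at *
  rcases h with ⟨rfl, hD, hlt, hr⟩ | ⟨rfl, hD, hlt, hb⟩
  · refine Or.inl ⟨by simp, mem, ?_, ?_⟩
    · rw [swapAt_left]; exact lo_lt _ _ hD (by simp) (by simp) le_rfl
    · intro h
      simp only [add_sub_cancel_right] at h ⊢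
      rw [swapAt_left, swapAt_of_ne (by simp) (by simp)]
      exact (mono _ _ _ _ h hD (by simp) (by simp) le_rfl (by omega)).1
  · refine Or.inr ⟨by simp, mem, ?_, ?_⟩
    · rw [swapAt_left]; exact lo_lt _ _ hD (by simp) le_rfl (by simp)
    · intro h
      simp only [add_sub_cancel_right] at h ⊢
      rw [swapAt_left, swapAt_of_ne (by simp) (by simp)]
      exact (mono _ _ _ _ h hD (by simp) (by simp) (by omega) le_rfl).2 (by omega)

/-! ### Rotation by 180 degrees -/

/-- The rotated filling, with the order of the values reversed. -/
def rot (f : ℤ × ℤ → ℤ) : ℤ × ℤ → ℤ := fun e => -f (-e)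

/-- The rotated domain. -/
def rotSet (D : Set (ℤ × ℤ)) : Set (ℤ × ℤ) := {e | -e ∈ D}

theorem rot_rot : rot (rot f) = f := by funext e; simp [rot]

theorem rotSet_rotSet : rotSet (rotSet D) = D := by ext e; simp [rotSet]

theorem rot_swapAt : rot (swapAt f c c') = swapAt (rot f) (-c) (-c') := by
  funext e
  simp only [rot, swapAt, neg_neg, neg_eq_iff_eq_neg]
  split_ifs <;> simp

theorem Hole.rotate (H : Hole D f c lo hi) : Hole (rotSet D) (rot f) (-c) (-hi) (-lo) := by
  obtain ⟨ci, cj⟩ := c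
  obtain ⟨mem, conv, mono, lt_hi, lo_lt⟩ := H
  refine ⟨by simpa [rotSet] using mem, ?_, ?_, ?_, ?_⟩
  · intro i j i' j' k l h h' h1 h2 h3 h4
    exact conv (-i') (-j') (-i) (-j) (-k) (-l) h' h (by omega) (by omega) (by omega) (by omega)
  · intro i j i' j' h h' h1 h2 h3 h4
    simp only [Prod.neg_mk, ne_eq, Prod.mk.injEq] at h1 h2
    have := mono (-i') (-j') (-i) (-j) h' h (by simp; omega) (by simp; omega) (by omega) (by omega)
    simp only [rot, Prod.neg_mk]
    exact ⟨by omega, fun h => by have := this.2 (by omega); omega⟩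
  · intro i j h h1 h2 h3
    simp only [Prod.neg_mk, ne_eq, Prod.mk.injEq] at h1 h2 h3
    have := lo_lt (-i) (-j) h (by simp; omega) (by simp; omega) (by simp; omega)
    simp only [rot, Prod.neg_mk]; omega
  · intro i j h h1 h2 h3
    simp only [Prod.neg_mk, ne_eq, Prod.mk.injEq] at h1 h2 h3
    have := lt_hi (-i) (-j) h (by simp; omega) (by simp; omega) (by simp; omega)
    simp only [rot, Prod.neg_mk]; omega

/-- The tie rules correspond as well, since "below" turns into "above". So facts about north-west
slides follow from those about south-east slides by rotation. -/
theorem condSE_rot_iff : CondSE (rotSet D) (-lo) (rot f) (-c) (-c') ↔ CondNW D lo f c c' := by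
  obtain ⟨ci, cj⟩ := c
  obtain ⟨i, j⟩ := c'
  have e1 : -(-ci + 1) = ci - 1 := by ring
  have e2 : -(-cj + 1) = cj - 1 := by ring
  have e3 : ∀ a b : ℤ, -a = -b + 1 ↔ a = b - 1 := by intros; omega
  simp only [CondSE, CondNW, rot, rotSet, Prod.neg_mk, Set.mem_ofPred_eq, neg_neg, Prod.mk.injEq,
    neg_inj, neg_lt_neg_iff, neg_le_neg_iff, e1, e2, e3]

theorem condNW_rot_iff : CondNW (rotSet D) (-hi) (rot f) (-c) (-c') ↔ CondSE D hi f c c' := by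
  rw [← condSE_rot_iff]; simp [rot_rot, rotSet_rotSet]

theorem Hole.stepNW (H : Hole D f c lo hi) (h : CondNW D lo f c c') :
    Hole D (swapAt f c c') c' lo hi := by
  have := (H.rotate.step (condSE_rot_iff.2 h)).rotate
  simpa [rot_swapAt, rot_rot, rotSet_rotSet] using this

theorem Hole.condSE (H : Hole D f c lo hi) (h : CondNW D lo f c c') :
    CondSE D hi (swapAt f c c') c' c := by
  have := H.rotate.condNW (condSE_rot_iff.2 h)
  rw [← rot_swapAt] at this
  exact condNW_rot_iff.1 this

theorem ChainNW.rot (h : ChainNW D lo f c g e) :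
    ChainSE (rotSet D) (-lo) (rot f) (-c) (rot g) (-e) := by
  induction h with
  | refl f c => exact .refl _ _
  | step h _ ih => exact .step (condSE_rot_iff.2 h) (by rw [← rot_swapAt]; exact ih)

theorem ChainNW.snoc (h : ChainNW D lo f c g e) (h' : CondNW D lo g e c') :
    ChainNW D lo f c (swapAt g e c') c' := by
  induction h with
  | refl f c => exact .step h' (.refl _ _)
  | step h _ ih => exact .step h (ih h')

theorem ChainSE.snoc (h : ChainSE D hi f c g e) (h' : CondSE D hi g e c') :
    ChainSE D hi f c (swapAt g e c') c' := by
  induction h with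
  | refl f c => exact .step h' (.refl _ _)
  | step h _ ih => exact .step h (ih h')

/-- Each step is undone by the opposite rule, and exchanging the same two boxes twice is the
identity. -/
theorem Hole.reverseSE (H : Hole D f c lo hi) (h : ChainSE D hi f c g e) :
    ChainNW D lo g e f c := by
  induction h with
  | refl f c => exact .refl _ _
  | @step f c c' g e h _ ih =>
    have := (ih (H.step h)).snoc (H.condNW h)
    rwa [swapAt_swapAt] at this

theorem Hole.reverseNW (H : Hole D f c lo hi) (h : ChainNW D lo f c g e) :
    ChainSE D hi g e f c := by
  induction h with
  | refl f c => exact .refl _ _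
  | @step f c c' g e h _ ih =>
    have := (ih (H.stepNW h)).snoc (H.condSE h)
    rwa [swapAt_swapAt] at this

/-- The value carried by the hole and the values outside the south-east quadrant of the hole do not
change. -/
theorem ChainSE.apply_of_not_le (h : ChainSE D hi f c g e) {x : ℤ × ℤ} (hx : x.1 < c.1 ∨ x.2 < c.2) :
    g x = f x := by
  induction h with
  | refl f c => rfl
  | @step f c c' g e h _ ih =>
    have h1 : c.1 ≤ c'.1 ∧ c.2 ≤ c'.2 := by
      rcases h with ⟨rfl, _⟩ | ⟨rfl, _⟩ <;> simp
    rw [ih (by omega), swapAt_of_ne]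
    · rintro rfl; omega
    · rintro rfl; omega

theorem ChainSE.le (h : ChainSE D hi f c g e) : c.1 ≤ e.1 ∧ c.2 ≤ e.2 := by
  induction h with
  | refl f c => simp
  | @step f c c' g e h _ ih =>
    have h1 : c.1 ≤ c'.1 ∧ c.2 ≤ c'.2 := by
      rcases h with ⟨rfl, _⟩ | ⟨rfl, _⟩ <;> simp
    omega

/-! ### Successive slides do not cross -/

/-- A boundary that slides starting above it do not cross: whenever such a slide reaches a box
directly above the boundary, it cannot go down. -/
structure Barrier (D : Set (ℤ × ℤ)) (hi : ℤ) (f : ℤ × ℤ → ℤ) (j₀ : ℤ) (b : ℤ → ℤ) : Prop where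
  mono : ∀ j, j₀ ≤ j → b j ≤ b (j + 1)
  turn : ∀ j, j₀ ≤ j → (b j - 1, j) ∈ D → (b j, j) ∈ D →
    hi ≤ f (b j, j) ∨ ((b j - 1, j + 1) ∈ D ∧ f (b j - 1, j + 1) < f (b j, j))

/-- All values directly to the right of and below the hole are at least `hi`. -/
def StuckSE (D : Set (ℤ × ℤ)) (hi : ℤ) (f : ℤ × ℤ → ℤ) (c : ℤ × ℤ) : Prop :=
  ((c.1 + 1, c.2) ∈ D → hi ≤ f (c.1 + 1, c.2)) ∧ ((c.1, c.2 + 1) ∈ D → hi ≤ f (c.1, c.2 + 1))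

/-- All values directly to the left of and above the hole are at most `lo`. -/
def StuckNW (D : Set (ℤ × ℤ)) (lo : ℤ) (f : ℤ × ℤ → ℤ) (c : ℤ × ℤ) : Prop :=
  ((c.1 - 1, c.2) ∈ D → f (c.1 - 1, c.2) ≤ lo) ∧ ((c.1, c.2 - 1) ∈ D → f (c.1, c.2 - 1) ≤ lo)

theorem StuckNW.rot (h : StuckNW D lo f c) : StuckSE (rotSet D) (-lo) (rot f) (-c) := by
  obtain ⟨ci, cj⟩ := c
  have e1 : -(-ci + 1) = ci - 1 := by ring
  have e2 : -(-cj + 1) = cj - 1 := by ring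
  simpa only [StuckSE, StuckNW, GridSlide.rot, rotSet, Prod.neg_mk, Set.mem_ofPred_eq, neg_neg,
    neg_le_neg_iff, e1, e2] using h

theorem StuckSE.not_condSE (h : StuckSE D hi f c) (c' : ℤ × ℤ) : ¬ CondSE D hi f c c' := by
  rintro (⟨rfl, h1, h2, -⟩ | ⟨rfl, h1, h2, -⟩)
  · have := h.1 h1; omega
  · have := h.2 h1; omega

theorem StuckNW.not_condNW (h : StuckNW D lo f c) (c' : ℤ × ℤ) : ¬ CondNW D lo f c c' := by
  rintro (⟨rfl, h1, h2, -⟩ | ⟨rfl, h1, h2, -⟩)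
  · have := h.1 h1; omega
  · have := h.2 h1; omega

theorem Hole.hi_le_of_stuck (H : Hole D f c lo hi) (hs : StuckSE D hi f c) {i j : ℤ}
    (h : (i, j) ∈ D) (hne : (i, j) ≠ c) (hi' : c.1 ≤ i) (hj : c.2 ≤ j) : hi ≤ f (i, j) := by
  obtain ⟨ci, cj⟩ := c
  simp only [ne_eq, Prod.mk.injEq, not_and] at hne hi' hj
  by_cases h1 : ci < i
  · have hD : (ci + 1, cj) ∈ D := H.conv _ _ _ _ _ _ H.mem h (by omega) (by omega) le_rfl (by omega)
    have := H.mono (ci + 1) cj i j hD h (by simp) (by simp; omega) (by omega) hj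
    have := hs.1 hD
    simp only at this; omega
  · have hD : (ci, cj + 1) ∈ D :=
      H.conv _ _ _ _ _ _ H.mem h (by omega) (by omega) (by omega) (by omega)
    have := H.mono ci (cj + 1) i j hD h (by simp) (by simp; omega) (by omega) (by omega)
    have := hs.2 hD
    simp only at this; omega

/-- The barrier is the row in which the path leaves column `j`, continued by the final row in the
columns from the end of the path on. In these last columns the row contains only values at least
`hi`, the end box having been filled with `hi`. -/
theorem Hole.exists_barrier (H : Hole D f c lo hi) (h : ChainSE D hi f c g e)
    (hs : StuckSE D hi g e) :
    ∃ b : ℤ → ℤ, Barrier D hi (Function.update g e hi) c.2 b ∧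
      ∀ j, c.2 ≤ j → c.1 ≤ b j ∧ b j ≤ e.1 := by
  induction h with
  | refl f c =>
    refine ⟨fun _ => c.1, ⟨fun _ _ => le_rfl, fun j hj _ h2 => Or.inl ?_⟩, fun j _ => ⟨le_rfl, le_rfl⟩⟩
    by_cases h : (c.1, j) = c
    · rw [h, Function.update_self]
    · rw [Function.update_of_ne h]
      exact H.hi_le_of_stuck hs h2 h le_rfl hj
  | @step f c c' g e h hc ih =>
    obtain ⟨b, hb, hbd⟩ := ih (H.step h) hs
    obtain ⟨ci, cj⟩ := c
    have hle := hc.le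
    rcases h with ⟨rfl, hD, hlt, hr⟩ | ⟨rfl, hD, hlt, hb'⟩
    · exact ⟨b, hb, fun j hj => ⟨by have := (hbd j hj).1; simp only at this ⊢; omega, (hbd j hj).2⟩⟩
    · refine ⟨fun j => if j = cj then ci else b j, ⟨?_, ?_⟩, ?_⟩
      · intro j hj
        simp only at hj
        have := (hbd (j + 1) (by simp; omega)).1
        by_cases h1 : j = cj
        · subst h1; simpa using this
        · have h2 : j + 1 ≠ cj := by omega
          simp only [h1, h2, if_false]
          exact hb.mono j (by simp; omega)
      · intro j hj h1 h2
        simp only at hj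
        by_cases h3 : j = cj
        · subst h3
          simp only [if_true] at h1 h2 ⊢
          -- The value now in `(ci, j)` came from `(ci, j + 1)`, and the box above its old place is
          -- smaller because columns are strict. A later slide directly above therefore turns right.
          right
          have hD' : (ci - 1, j + 1) ∈ D :=
            H.conv _ _ _ _ _ _ h1 hD (by omega) (by simp) (by omega) (by simp)
          refine ⟨hD', ?_⟩
          simp only at hle
          have ne1 : (ci - 1, j + 1) ≠ e := by rintro rfl; simp at hle
          have ne2 : (ci, j) ≠ e := by rintro rfl; simp at hle
          rw [Function.update_of_ne ne1, Function.update_of_ne ne2, hc.apply_of_not_le (by simp),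
            hc.apply_of_not_le (by simp), swapAt_left, swapAt_of_ne (by simp) (by simp)]
          exact (H.mono _ _ _ _ hD' hD (by simp) (by simp) (by simp) le_rfl).2 (by simp)
        · simp only [h3, if_false] at h1 h2 ⊢
          have h4 : j + 1 ≠ cj := by omega
          exact hb.turn j (by simp; omega) h1 h2
      · intro j hj
        simp only at hj hle ⊢
        split_ifs with h3
        · exact ⟨le_rfl, by omega⟩
        · exact hbd j (by simp; omega)

/-- A slide starting above a barrier stays above it. -/
theorem Barrier.above {F : ℤ × ℤ → ℤ} {j₀ : ℤ} {b : ℤ → ℤ} {hi' : ℤ} (hb : Barrier D hi F j₀ b)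
    (hlt : hi' ≤ hi) (h : ChainSE D hi' f c g e) (hc : c ∈ D)
    (hF : ∀ x ∈ D, x ≠ c → c.1 ≤ x.1 → c.2 ≤ x.2 → f x = F x)
    (hj : j₀ ≤ c.2) (hi : c.1 < b c.2) : e.1 < b e.2 ∧ j₀ ≤ e.2 := by
  induction h with
  | refl f c => exact ⟨hi, hj⟩
  | @step f c c' g e h _ ih =>
    obtain ⟨ci, cj⟩ := c
    simp only at hi hj hF
    have hc' : c' ∈ D := by
      rcases h with ⟨_, h, _⟩ | ⟨_, h, _⟩ <;> exact h
    have hcc : ci ≤ c'.1 ∧ cj ≤ c'.2 ∧ c' ≠ (ci, cj) := by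
      rcases h with ⟨rfl, _⟩ | ⟨rfl, _⟩ <;> simp
    apply ih hc'
    · intro x hx hne h1 h2
      have : x ≠ (ci, cj) := by
        rintro rfl
        simp only at h1 h2
        exact hne (Prod.ext (by simp; omega) (by simp; omega))
      rw [swapAt_of_ne this hne]
      exact hF x hx this (by omega) (by omega)
    · omega
    · rcases h with ⟨rfl, hD, hlt', hr⟩ | ⟨rfl, hD, hlt', hb'⟩
      · simp only at hr hlt' ⊢
        -- A step down reaches the barrier only from the box directly above it. There the value
        -- below is either not below the bound or larger than the one to the right, so the rule
        -- forbids that step.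
        by_contra hcon
        have e1 : b cj = ci + 1 := by omega
        have := hb.turn cj hj (by rw [e1]; simpa using hc) (by rw [e1]; exact hD)
        rw [e1] at this
        simp only [add_sub_cancel_right] at this
        rw [hF _ hD (by simp) (by simp) (by simp)] at hlt' hr
        simp only at hlt'
        rcases this with h1 | ⟨h1, h2⟩
        · omega
        · have := hr h1
          rw [hF _ h1 (by simp) (by simp) (by simp)] at this
          simp only at this
          omega
      · simp only
        have := hb.mono cj hj
        omega

/-- Slides in succession, the second one starting to the north-east of the first one, end in this
relative position. -/
theorem Hole.row_lt {f₂ g₂ : ℤ × ℤ → ℤ} {c₂ e₂ : ℤ × ℤ} {hi₂ : ℤ} (H : Hole D f c lo hi)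
    (h : ChainSE D hi f c g e) (hs : StuckSE D hi g e)
    (h₂ : ChainSE D hi₂ f₂ c₂ g₂ e₂) (hlt : hi₂ ≤ hi) (hc₂ : c₂ ∈ D)
    (hf₂ : ∀ x, x ≠ c₂ → f₂ x = Function.update g e hi x)
    (hrow : c₂.1 < c.1) (hcol : c.2 ≤ c₂.2) : e₂.1 < e.1 := by
  obtain ⟨b, hb, hbd⟩ := H.exists_barrier h hs
  have := hb.above hlt h₂ hc₂ (fun x _ hx _ _ => hf₂ x hx) hcol (by
    have := (hbd c₂.2 hcol).1; omega)
  have h3 := (hbd e₂.2 this.2).2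
  omega

/-- The mirror image of `Hole.row_lt` for slides towards the north-west. -/
theorem Hole.row_lt_NW {f₂ g₂ : ℤ × ℤ → ℤ} {c₂ e₂ : ℤ × ℤ} {lo₂ : ℤ} (H : Hole D f c lo hi)
    (h : ChainNW D lo f c g e) (hs : StuckNW D lo g e)
    (h₂ : ChainNW D lo₂ f₂ c₂ g₂ e₂) (hlt : lo ≤ lo₂) (hc₂ : c₂ ∈ D)
    (hf₂ : ∀ x, x ≠ c₂ → f₂ x = Function.update g e lo x)
    (hrow : c.1 < c₂.1) (hcol : c₂.2 ≤ c.2) : e.1 < e₂.1 := by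
  have := H.rotate.row_lt h.rot hs.rot h₂.rot (neg_le_neg hlt) (by simpa [rotSet] using hc₂) (by
    intro x hx
    have hx' : -x ≠ c₂ := by rintro rfl; simp at hx
    simp only [GridSlide.rot, hf₂ _ hx', Function.update_apply, neg_eq_iff_eq_neg]
    split_ifs <;> simp) (by simpa using hrow) (by simpa using hcol)
  simpa using this

end GridSlide

namespace GridSlide

/-! ### Standardised states of the conversion -/

/-- The place of the `l`-th of `d` barred letters before all unbarred letters. -/
def lowKey (d l : ℕ) : ℤ := l - 2 * (d + 1)

/-- The place of the `l`-th of `d` barred letters directly before the unbarred letters `v l`. -/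
def highKey (d : ℕ) (v : ℕ → ℕ) (l : ℕ) : ℤ := v l * (d + 1) - (d - l)

/-- The place of the unbarred letter `s`. -/
def plainKey (d s : ℕ) : ℤ := s * (d + 1)

variable {d : ℕ} {v : ℕ → ℕ}

theorem lowKey_lt_lowKey {l l' : ℕ} (h : l < l') : lowKey d l < lowKey d l' := by
  unfold lowKey; omega

theorem lowKey_lt_plainKey {l s : ℕ} (h : l < d) : lowKey d l < plainKey d s := by
  have : (0 : ℤ) ≤ s * (d + 1) := by positivity
  unfold lowKey plainKey; omega

theorem lowKey_lt_highKey {l l' : ℕ} (h : l < d) : lowKey d l < highKey d v l' := by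
  have : (0 : ℤ) ≤ v l' * (d + 1) := by positivity
  unfold lowKey highKey; omega

theorem plainKey_lt_plainKey {s t : ℕ} : plainKey d s < plainKey d t ↔ s < t := by
  unfold plainKey
  rw [mul_lt_mul_iff_left₀ (by positivity)]; exact Nat.cast_lt

theorem plainKey_le_plainKey {s t : ℕ} : plainKey d s ≤ plainKey d t ↔ s ≤ t := by
  rw [← not_lt, ← not_lt, plainKey_lt_plainKey]

/-- Multiples of `d + 1` are reserved for unbarred letters. The `d` integers before such a multiple
make room for all the labels, since `1 ≤ d - l ≤ d`. -/
theorem highKey_lt_plainKey {l s : ℕ} (h : l < d) : highKey d v l < plainKey d s ↔ v l ≤ s := by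
  unfold plainKey highKey
  constructor
  · intro h1
    by_contra h2
    have : ((s : ℤ) + 1) * (d + 1) ≤ v l * (d + 1) := by gcongr; omega
    rw [add_mul] at this; omega
  · intro h1
    have : (v l : ℤ) * (d + 1) ≤ s * (d + 1) := by gcongr
    omega

theorem plainKey_lt_highKey {l s : ℕ} (h : l < d) : plainKey d s < highKey d v l ↔ s < v l := by
  rw [← not_le, ← not_le, not_iff_not, ← highKey_lt_plainKey h]
  refine ⟨fun h1 => lt_of_le_of_ne h1 fun h2 => ?_, le_of_lt⟩
  unfold plainKey highKey at h2
  have h3 : ((v l : ℤ) - s) * (d + 1) = d - l := by linarith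
  by_cases h4 : (v l : ℤ) - s ≤ 0
  · have : ((v l : ℤ) - s) * (d + 1) ≤ 0 := mul_nonpos_of_nonpos_of_nonneg h4 (by positivity)
    omega
  · have : 1 * ((d : ℤ) + 1) ≤ ((v l : ℤ) - s) * (d + 1) := by gcongr; omega
    omega

theorem highKey_lt_highKey (hv : Monotone v) {l l' : ℕ} (h : l < l') :
    highKey d v l < highKey d v l' := by
  have : (v l : ℤ) * (d + 1) ≤ v l' * (d + 1) := by gcongr; exact hv h.le
  unfold highKey; omega

/-- The letter at a place. -/
def decode (d : ℕ) (v : ℕ → ℕ) (e : ℤ) : Letter :=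
  if e < -(d + 1) then ⟨v (e + 2 * (d + 1)).toNat, true⟩
  else if e % (d + 1) = 0 then ⟨(e / (d + 1)).toNat, false⟩ else ⟨(e / (d + 1) + 1).toNat, true⟩

theorem decode_lowKey {l : ℕ} (h : l < d) : decode d v (lowKey d l) = ⟨v l, true⟩ := by
  unfold decode lowKey
  rw [if_pos (by omega)]
  congr 2
  omega

theorem decode_plainKey (s : ℕ) : decode d v (plainKey d s) = ⟨s, false⟩ := by
  have : (0 : ℤ) ≤ s * (d + 1) := by positivity
  unfold decode plainKey
  rw [if_neg (by omega), if_pos (Int.mul_emod_left _ _), Int.mul_ediv_cancel _ (by omega)]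
  simp

theorem decode_highKey {l : ℕ} (h : l < d) : decode d v (highKey d v l) = ⟨v l, true⟩ := by
  have h0 : (0 : ℤ) ≤ v l * (d + 1) := by positivity
  -- This form shows the remainder `l + 1`, which is not zero modulo `d + 1`, and the quotient `v l
  -- - 1`. It is also correct for `v l = 0`, where the quotient is `-1`.
  have e : highKey d v l = (l + 1) + (v l - 1) * (d + 1) := by unfold highKey; ring
  unfold decode
  have h1 : ¬ highKey d v l < -(d + 1) := by unfold highKey; omega
  rw [if_neg h1, e, Int.add_mul_emod_self_right, Int.add_mul_ediv_right _ _ (by omega),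
    Int.emod_eq_of_lt (by omega) (by omega), Int.ediv_eq_zero_of_lt (by omega) (by omega),
    if_neg (by omega)]
  congr 1
  omega

/-- The place of the `l`-th barred letter when the barred letters with labels at least `k` have
been converted to the natural order. -/
def keyAt (d : ℕ) (v : ℕ → ℕ) (k l : ℕ) : ℤ := if l < k then lowKey d l else highKey d v l

theorem decode_keyAt {k l : ℕ} (h : l < d) : decode d v (keyAt d v k l) = ⟨v l, true⟩ := by
  unfold keyAt; split_ifs
  · exact decode_lowKey h
  · exact decode_highKey h

/-- The box with natural coordinates, as a point of the integral grid. -/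
def toGrid (c : ℕ × ℕ) : ℤ × ℤ := (c.1, c.2)

theorem toGrid_inj {c c' : ℕ × ℕ} : toGrid c = toGrid c' ↔ c = c' := by
  simp [toGrid, Prod.ext_iff]

/-- A semistandard state in which the barred letters with labels at least `k` have been converted to
the natural order, the letter with label `l` being in the box `pos l`. -/
structure State (D : Set (ℤ × ℤ)) (d : ℕ) (v : ℕ → ℕ) (k : ℕ) (pos : ℕ → ℕ × ℕ)
    (f : ℤ × ℤ → ℤ) : Prop where
  conv : ∀ i j i' j' k l, (i, j) ∈ D → (i', j') ∈ D → i ≤ k → k ≤ i' → j ≤ l → l ≤ j' → (k, l) ∈ D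
  mono : ∀ i j i' j', (i, j) ∈ D → (i', j') ∈ D → i ≤ i' → j ≤ j' →
    f (i, j) ≤ f (i', j') ∧ (i < i' → f (i, j) < f (i', j'))
  mem : ∀ l < d, toGrid (pos l) ∈ D
  apply_pos : ∀ l < d, f (toGrid (pos l)) = keyAt d v k l
  other : ∀ e ∈ D, (∃ s, f e = plainKey d s) ∨ ∃ l < d, e = toGrid (pos l)

/-- A state during the slide of the letter with label `k`. -/
structure Mid (D : Set (ℤ × ℤ)) (d : ℕ) (v : ℕ → ℕ) (k : ℕ) (pos : ℕ → ℕ × ℕ)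
    (f : ℤ × ℤ → ℤ) (c : ℤ × ℤ) : Prop where
  lt : k < d
  hole : Hole D f c (lowKey d k) (highKey d v k)
  mem : ∀ l < d, l ≠ k → toGrid (pos l) ∈ D
  ne : ∀ l < d, l ≠ k → toGrid (pos l) ≠ c
  apply_pos : ∀ l < d, l ≠ k → f (toGrid (pos l)) = keyAt d v k l
  other : ∀ e ∈ D, e ≠ c → (∃ s, f e = plainKey d s) ∨ ∃ l < d, l ≠ k ∧ e = toGrid (pos l)
  apply_hole : f c = lowKey d k ∨ f c = highKey d v k

variable {D : Set (ℤ × ℤ)} {f g : ℤ × ℤ → ℤ} {c c' e : ℤ × ℤ} {k : ℕ} {pos : ℕ → ℕ × ℕ}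

theorem keyAt_injOn (hv : Monotone v) {l l' : ℕ} (h : l < d) (h' : l' < d)
    (e : keyAt d v k l = keyAt d v k l') : l = l' := by
  unfold keyAt at e
  rcases lt_trichotomy l l' with h1 | h1 | h1
  · split_ifs at e
    · have := lowKey_lt_lowKey (d := d) h1; omega
    · have := lowKey_lt_highKey (v := v) (l' := l') h; omega
    · omega
    · have := highKey_lt_highKey (d := d) hv h1; omega
  · exact h1
  · split_ifs at e
    · have := lowKey_lt_lowKey (d := d) h1; omega
    · omega
    · have := lowKey_lt_highKey (v := v) (l' := l) h'; omega
    · have := highKey_lt_highKey (d := d) hv h1; omega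

/-- Smaller labels have keys below the window and larger labels have keys above it. So the slide of
label `k` only meets unbarred letters. -/
theorem Mid.active (hv : Monotone v) (M : Mid D d v k pos f c) (he : e ∈ D) (hne : e ≠ c)
    (h1 : lowKey d k < f e) (h2 : f e < highKey d v k) : ∃ s, f e = plainKey d s := by
  rcases M.other e he hne with h | ⟨l, hl, hlk, rfl⟩
  · exact h
  · rw [M.apply_pos l hl hlk] at h1 h2
    unfold keyAt at h1 h2
    split_ifs at h1 h2 with h
    · have := lowKey_lt_lowKey (d := d) h; omega
    · have := highKey_lt_highKey (d := d) hv (show k < l by omega); omega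

theorem Mid.swap (M : Mid D d v k pos f c) (hH : Hole D (swapAt f c c') c' (lowKey d k) (highKey d v k))
    (hs : ∃ s, f c' = plainKey d s) : Mid D d v k pos (swapAt f c c') c' := by
  have hc : ∀ l < d, toGrid (pos l) ∈ D → l ≠ k → toGrid (pos l) ≠ c' := by
    rintro l hl - hlk rfl
    obtain ⟨s, hs⟩ := hs
    have := M.apply_pos l hl hlk
    have h1 := decode_plainKey (d := d) (v := v) s
    rw [← hs, this, decode_keyAt hl] at h1
    simp at h1
  refine ⟨M.lt, hH, M.mem, fun l hl hlk => hc l hl (M.mem l hl hlk) hlk, ?_, ?_, ?_⟩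
  · intro l hl hlk
    rw [swapAt_of_ne (M.ne l hl hlk) (hc l hl (M.mem l hl hlk) hlk)]
    exact M.apply_pos l hl hlk
  · intro e he hne
    by_cases h : e = c
    · subst h; rw [swapAt_left]; exact Or.inl hs
    · rw [swapAt_of_ne h hne]; exact M.other e he h
  · rw [swapAt_right]; exact M.apply_hole

theorem CondSE.ne {hi : ℤ} (h : CondSE D hi f c c') : c' ≠ c := by
  rcases h with ⟨rfl, _⟩ | ⟨rfl, _⟩ <;> simp [Prod.ext_iff]

theorem CondNW.ne {lo : ℤ} (h : CondNW D lo f c c') : c' ≠ c := by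
  rcases h with ⟨rfl, _⟩ | ⟨rfl, _⟩ <;> simp [Prod.ext_iff]

theorem Mid.stepSE (hv : Monotone v) (M : Mid D d v k pos f c) (h : CondSE D (highKey d v k) f c c') :
    Mid D d v k pos (swapAt f c c') c' := by
  have h' : c' ∈ D ∧ f c' < highKey d v k ∧ c.1 ≤ c'.1 ∧ c.2 ≤ c'.2 := by
    rcases h with ⟨rfl, h1, h2, _⟩ | ⟨rfl, h1, h2, _⟩ <;> exact ⟨h1, h2, by simp, by simp⟩
  exact M.swap (M.hole.step h)
    (M.active hv h'.1 h.ne (M.hole.lo_lt _ _ h'.1 h.ne h'.2.2.1 h'.2.2.2) h'.2.1)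

theorem Mid.stepNW (hv : Monotone v) (M : Mid D d v k pos f c) (h : CondNW D (lowKey d k) f c c') :
    Mid D d v k pos (swapAt f c c') c' := by
  have h' : c' ∈ D ∧ lowKey d k < f c' ∧ c'.1 ≤ c.1 ∧ c'.2 ≤ c.2 := by
    rcases h with ⟨rfl, h1, h2, _⟩ | ⟨rfl, h1, h2, _⟩ <;> exact ⟨h1, h2, by simp, by simp⟩
  exact M.swap (M.hole.stepNW h)
    (M.active hv h'.1 h.ne h'.2.1 (M.hole.lt_hi _ _ h'.1 h.ne h'.2.2.1 h'.2.2.2))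

theorem Mid.chainSE (hv : Monotone v) (M : Mid D d v k pos f c)
    (h : ChainSE D (highKey d v k) f c g e) : Mid D d v k pos g e := by
  induction h with
  | refl f c => exact M
  | step h _ ih => exact ih (M.stepSE hv h)

theorem Mid.chainNW (hv : Monotone v) (M : Mid D d v k pos f c)
    (h : ChainNW D (lowKey d k) f c g e) : Mid D d v k pos g e := by
  induction h with
  | refl f c => exact M
  | step h _ ih => exact ih (M.stepNW hv h)

/-- Seen as a hole, the box of label `k` looks the same before and after its slide. One of the two
bounds comes from the key stored there and is strict because keys of different barred letters
differ; the other one follows from `lowKey < highKey`. -/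
theorem State.hole (hv : Monotone v) (S : State D d v (k + 1) pos f ∨ State D d v k pos f)
    (hk : k < d) : Hole D f (toGrid (pos k)) (lowKey d k) (highKey d v k) := by
  have h1 : lowKey d k < highKey d v k := lowKey_lt_highKey hk
  rcases S with S | S
  · have e := S.apply_pos k hk
    rw [keyAt, if_pos (by omega)] at e
    refine ⟨S.mem k hk, S.conv, fun i j i' j' h h' _ _ => S.mono i j i' j' h h', ?_, ?_⟩
    · intro i j h _ h2 h3
      have := (S.mono i j _ _ h (S.mem k hk) h2 h3).1
      rw [← toGrid, e] at this; omega
    · intro i j h hne h2 h3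
      have h4 := (S.mono _ _ i j (S.mem k hk) h h2 h3).1
      rw [← toGrid, e] at h4
      refine lt_of_le_of_ne h4 fun h5 => ?_
      rcases S.other _ h with ⟨s, hs⟩ | ⟨l, hl, hl'⟩
      · have := lowKey_lt_plainKey (s := s) hk; omega
      · rw [hl', S.apply_pos l hl] at h5
        have : keyAt d v (k + 1) k = keyAt d v (k + 1) l := by rw [← h5, keyAt, if_pos (by omega)]
        have := keyAt_injOn hv hk hl this
        subst this; exact hne hl'
  · have e := S.apply_pos k hk
    rw [keyAt, if_neg (by omega)] at e
    refine ⟨S.mem k hk, S.conv, fun i j i' j' h h' _ _ => S.mono i j i' j' h h', ?_, ?_⟩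
    · intro i j h hne h2 h3
      have h4 := (S.mono i j _ _ h (S.mem k hk) h2 h3).1
      rw [← toGrid, e] at h4
      refine lt_of_le_of_ne h4 fun h5 => ?_
      rcases S.other _ h with ⟨s, hs⟩ | ⟨l, hl, hl'⟩
      · rw [hs] at h5
        have h6 := @highKey_lt_plainKey d v k s hk
        have h7 := @plainKey_lt_highKey d v k s hk
        omega
      · rw [hl', S.apply_pos l hl] at h5
        have : keyAt d v k k = keyAt d v k l := by rw [h5, keyAt, if_neg (by omega)]
        have := keyAt_injOn hv hk hl this
        subst this; exact hne hl'
    · intro i j h _ h2 h3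
      have := (S.mono _ _ i j (S.mem k hk) h h2 h3).1
      rw [← toGrid, e] at this; omega

theorem State.mid (hv : Monotone v) (S : State D d v (k + 1) pos f ∨ State D d v k pos f)
    (hk : k < d) : Mid D d v k pos f (toGrid (pos k)) := by
  have H := State.hole hv S hk
  have hkey : ∀ l < d, l ≠ k → f (toGrid (pos l)) = keyAt d v k l := by
    intro l hl hlk
    rcases S with S | S
    · rw [S.apply_pos l hl]; unfold keyAt; split_ifs <;> first | rfl | omega
    · exact S.apply_pos l hl
  have hfk : f (toGrid (pos k)) = lowKey d k ∨ f (toGrid (pos k)) = highKey d v k := by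
    rcases S with S | S
    · left; rw [S.apply_pos k hk, keyAt, if_pos (by omega)]
    · right; rw [S.apply_pos k hk, keyAt, if_neg (by omega)]
  refine ⟨hk, H, ?_, ?_, hkey, ?_, hfk⟩
  · rcases S with S | S <;> exact fun l hl _ => S.mem l hl
  · intro l hl hlk e
    rcases S with S | S <;>
    · have h1 := S.apply_pos l hl
      rw [e, S.apply_pos k hk] at h1
      exact hlk (keyAt_injOn hv hk hl h1).symm
  · intro e he hne
    have : (∃ s, f e = plainKey d s) ∨ ∃ l < d, e = toGrid (pos l) := by
      rcases S with S | S <;> exact S.other e he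
    rcases this with h | ⟨l, hl, rfl⟩
    · exact Or.inl h
    · exact Or.inr ⟨l, hl, fun h => hne (by rw [h]), rfl⟩

theorem Hole.mono_update {lo hi x : ℤ} (H : Hole D f c lo hi)
    (h1 : ∀ i j, (i, j) ∈ D → (i, j) ≠ c → i ≤ c.1 → j ≤ c.2 → f (i, j) < x)
    (h2 : ∀ i j, (i, j) ∈ D → (i, j) ≠ c → c.1 ≤ i → c.2 ≤ j → x < f (i, j)) :
    ∀ i j i' j', (i, j) ∈ D → (i', j') ∈ D → i ≤ i' → j ≤ j' →
      Function.update f c x (i, j) ≤ Function.update f c x (i', j') ∧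
      (i < i' → Function.update f c x (i, j) < Function.update f c x (i', j')) := by
  intro i j i' j' h h' hi hj
  by_cases e1 : (i, j) = c <;> by_cases e2 : (i', j') = c
  · rw [e1, e2]; refine ⟨le_rfl, fun h => ?_⟩
    rw [← e2, Prod.mk.injEq] at e1; omega
  · rw [e1, Function.update_self, Function.update_of_ne e2]
    subst e1
    have := h2 i' j' h' e2 hi hj
    exact ⟨this.le, fun _ => this⟩
  · rw [e2, Function.update_self, Function.update_of_ne e1]
    subst e2
    have := h1 i j h e1 hi hj
    exact ⟨this.le, fun _ => this⟩
  · rw [Function.update_of_ne e1, Function.update_of_ne e2]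
    exact H.mono i j i' j' h h' e1 e2 hi hj

theorem Mid.state {k' : ℕ} {b : ℕ × ℕ} {x : ℤ} (M : Mid D d v k pos f (toGrid b))
    (hk' : k' = k ∨ k' = k + 1) (hx : x = keyAt d v k' k)
    (h1 : ∀ i j, (i, j) ∈ D → (i, j) ≠ toGrid b → i ≤ (toGrid b).1 → j ≤ (toGrid b).2 → f (i, j) < x)
    (h2 : ∀ i j, (i, j) ∈ D → (i, j) ≠ toGrid b → (toGrid b).1 ≤ i → (toGrid b).2 ≤ j → x < f (i, j)) :
    State D d v k' (Function.update pos k b) (Function.update f (toGrid b) x) := by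
  refine ⟨M.hole.conv, M.hole.mono_update h1 h2, ?_, ?_, ?_⟩
  · intro l hl
    by_cases h : l = k
    · subst h; rw [Function.update_self]; exact M.hole.mem
    · rw [Function.update_of_ne h]; exact M.mem l hl h
  · intro l hl
    by_cases h : l = k
    · subst h; rw [Function.update_self, Function.update_self, hx]
    · rw [Function.update_of_ne h, Function.update_of_ne (M.ne l hl h), M.apply_pos l hl h]
      unfold keyAt; split_ifs <;> first | rfl | omega
  · intro e he
    by_cases h : e = toGrid b
    · exact Or.inr ⟨k, M.lt, by rw [Function.update_self, h]⟩
    · rw [Function.update_of_ne h]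
      rcases M.other e he h with h | ⟨l, hl, hlk, h⟩
      · exact Or.inl h
      · exact Or.inr ⟨l, hl, by rw [Function.update_of_ne hlk, h]⟩

/-- When the hole is stuck, everything to its south-east is at least the new key. Equality is
excluded, since no unbarred letter and no other label has that key. -/
theorem Mid.stateSE {b : ℕ × ℕ} (hv : Monotone v) (M : Mid D d v k pos f (toGrid b))
    (hs : StuckSE D (highKey d v k) f (toGrid b)) :
    State D d v k (Function.update pos k b) (Function.update f (toGrid b) (highKey d v k)) := by
  refine M.state (Or.inl rfl) (by rw [keyAt, if_neg (by omega)]) M.hole.lt_hi ?_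
  intro i j h hne hi hj
  refine lt_of_le_of_ne (M.hole.hi_le_of_stuck hs h hne hi hj) fun h1 => ?_
  rcases M.other _ h hne with ⟨s, h2⟩ | ⟨l, hl, hlk, h2⟩
  · have h6 := @highKey_lt_plainKey d v k s M.lt
    have h7 := @plainKey_lt_highKey d v k s M.lt
    omega
  · rw [h2, M.apply_pos l hl hlk] at h1
    exact hlk (keyAt_injOn hv M.lt hl (by rw [← h1, keyAt, if_neg (by omega)] : keyAt d v k k = _)).symm

theorem Hole.le_lo_of_stuck {lo hi : ℤ} (H : Hole D f c lo hi) (hs : StuckNW D lo f c) {i j : ℤ}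
    (h : (i, j) ∈ D) (hne : (i, j) ≠ c) (hi' : i ≤ c.1) (hj : j ≤ c.2) : f (i, j) ≤ lo := by
  have := H.rotate.hi_le_of_stuck hs.rot (i := -i) (j := -j) (by simpa [rotSet] using h)
    (by rwa [← Prod.neg_mk, Ne, neg_inj]) (by simpa using hi') (by simpa using hj)
  simpa [rot] using this

theorem Mid.stateNW {b : ℕ × ℕ} (hv : Monotone v) (M : Mid D d v k pos f (toGrid b))
    (hs : StuckNW D (lowKey d k) f (toGrid b)) :
    State D d v (k + 1) (Function.update pos k b) (Function.update f (toGrid b) (lowKey d k)) := by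
  refine M.state (Or.inr rfl) (by rw [keyAt, if_pos (by omega)]) ?_ M.hole.lo_lt
  intro i j h hne hi hj
  refine lt_of_le_of_ne (M.hole.le_lo_of_stuck hs h hne hi hj) fun h1 => ?_
  rcases M.other _ h hne with ⟨s, h2⟩ | ⟨l, hl, hlk, h2⟩
  · have := lowKey_lt_plainKey (s := s) M.lt; omega
  · rw [h2, M.apply_pos l hl hlk] at h1
    have h3 : keyAt d v (k + 1) l = keyAt d v k l := by
      unfold keyAt; split_ifs <;> first | rfl | omega
    have h4 : keyAt d v (k + 1) k = lowKey d k := by rw [keyAt, if_pos (by omega)]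
    exact hlk (keyAt_injOn hv M.lt hl (by rw [h3, h4, h1] : keyAt d v (k + 1) k = _)).symm

/-- Otherwise the box in the column of label `l` and the row of label `l + 1` would have a value
larger than the key of `l` and at most that of `l + 1`. The keys being consecutive, it would equal
the latter, which occurs only in the box of `l + 1`. -/
theorem State.col_le (hv : Monotone v) (S : State D d v k pos f) {l : ℕ} (hl : l + 1 < d)
    (he : keyAt d v k (l + 1) = keyAt d v k l + 1) (hrow : (pos l).1 < (pos (l + 1)).1) :
    (pos (l + 1)).2 ≤ (pos l).2 := by
  by_contra hcon
  have m1 := S.mem l (by omega)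
  have m2 := S.mem (l + 1) hl
  have hD : (((pos (l + 1)).1 : ℤ), ((pos l).2 : ℤ)) ∈ D :=
    S.conv _ _ _ _ _ _ m1 m2 (by omega) le_rfl le_rfl (by omega)
  have h1 := (S.mono _ _ _ _ m1 hD (by omega) le_rfl).2 (by omega)
  have h2 := (S.mono _ _ _ _ hD m2 le_rfl (by omega)).1
  rw [← toGrid, S.apply_pos l (by omega)] at h1
  rw [← toGrid, S.apply_pos (l + 1) hl] at h2
  have h3 : f (((pos (l + 1)).1 : ℤ), ((pos l).2 : ℤ)) = keyAt d v k (l + 1) := by omega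
  rcases S.other _ hD with ⟨s, hs⟩ | ⟨l', hl', h4⟩
  · have h5 := decode_plainKey (d := d) (v := v) s
    rw [← hs, h3, decode_keyAt hl] at h5
    simp at h5
  · rw [h4, S.apply_pos l' hl'] at h3
    have := keyAt_injOn hv hl' hl h3
    subst this
    rw [toGrid, Prod.mk.injEq] at h4
    omega

theorem CondSE.unique {hi : ℤ} (h : CondSE D hi f c c') {c'' : ℤ × ℤ} (h' : CondSE D hi f c c'') :
    c' = c'' := by
  rcases h with ⟨rfl, h1, h2, h3⟩ | ⟨rfl, h1, h2, h3⟩ <;>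
    rcases h' with ⟨rfl, h4, h5, h6⟩ | ⟨rfl, h4, h5, h6⟩
  · rfl
  · have := h3 h4; have := h6 h1; omega
  · have := h3 h4; have := h6 h1; omega
  · rfl

theorem CondNW.unique {lo : ℤ} (h : CondNW D lo f c c') {c'' : ℤ × ℤ} (h' : CondNW D lo f c c'') :
    c' = c'' := by
  rcases h with ⟨rfl, h1, h2, h3⟩ | ⟨rfl, h1, h2, h3⟩ <;>
    rcases h' with ⟨rfl, h4, h5, h6⟩ | ⟨rfl, h4, h5, h6⟩
  · rfl
  · have := h3 h4; have := h6 h1; omega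
  · have := h3 h4; have := h6 h1; omega
  · rfl

theorem ChainSE.unique {hi : ℤ} (h : ChainSE D hi f c g e) (hs : StuckSE D hi g e)
    {g' : ℤ × ℤ → ℤ} {e' : ℤ × ℤ} (h' : ChainSE D hi f c g' e') (hs' : StuckSE D hi g' e') :
    g = g' ∧ e = e' := by
  induction h with
  | refl f c =>
    cases h' with
    | refl => exact ⟨rfl, rfl⟩
    | step h _ => exact (hs.not_condSE _ h).elim
  | step h _ ih =>
    cases h' with
    | refl => exact (hs'.not_condSE _ h).elim
    | step h1 h2 => obtain rfl := h.unique h1; exact ih hs h2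

theorem ChainNW.unique {lo : ℤ} (h : ChainNW D lo f c g e) (hs : StuckNW D lo g e)
    {g' : ℤ × ℤ → ℤ} {e' : ℤ × ℤ} (h' : ChainNW D lo f c g' e') (hs' : StuckNW D lo g' e') :
    g = g' ∧ e = e' := by
  induction h with
  | refl f c =>
    cases h' with
    | refl => exact ⟨rfl, rfl⟩
    | step h _ => exact (hs.not_condNW _ h).elim
  | step h _ ih =>
    cases h' with
    | refl => exact (hs'.not_condNW _ h).elim
    | step h1 h2 => obtain rfl := h.unique h1; exact ih hs h2

theorem State.stuckSE (S : State D d v k pos f) (hk : k < d) :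
    StuckSE D (highKey d v k) f (toGrid (pos k)) := by
  have e := S.apply_pos k hk
  rw [keyAt, if_neg (by omega)] at e
  constructor
  · intro h
    rw [← e]; exact (S.mono _ _ _ _ (S.mem k hk) h (by simp [toGrid]) le_rfl).1
  · intro h
    rw [← e]; exact (S.mono _ _ _ _ (S.mem k hk) h le_rfl (by simp [toGrid])).1

theorem State.stuckNW (S : State D d v (k + 1) pos f) (hk : k < d) :
    StuckNW D (lowKey d k) f (toGrid (pos k)) := by
  have e := S.apply_pos k hk
  rw [keyAt, if_pos (by omega)] at e
  constructor
  · intro h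
    rw [← e]; exact (S.mono _ _ _ _ h (S.mem k hk) (by simp [toGrid]) le_rfl).1
  · intro h
    rw [← e]; exact (S.mono _ _ _ _ h (S.mem k hk) le_rfl (by simp [toGrid])).1

end GridSlide

namespace Filling

/-! ### Entries of fillings -/

theorem entry_setEntry (T : Filling) (c : ℕ × ℕ) (x : Letter) (i j : ℕ) :
    (T.setEntry c x).entry i j =
      if (i, j) = c then (T.entry i j).map fun _ => x else T.entry i j := by
  obtain ⟨a, b⟩ := c
  unfold setEntry entry
  rw [List.getElem?_modify]
  simp only [Prod.mk.injEq]
  by_cases h : a = i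
  · subst h
    simp only [if_true, true_and]
    cases T[a]? with
    | none => simp
    | some row =>
      simp only [Option.bind_some]
      by_cases hb : b = j
      · subst hb
        by_cases hl : b < row.length <;> simp [hl]
      · have hb' : ¬ j = b := fun h => hb h.symm
        simp [hb, hb']
  · have h' : ¬ i = a := fun e => h e.symm
    simp [h, h']

theorem entry_swap {T : Filling} {c c' : ℕ × ℕ} {a b : Letter} (ha : T.entry c.1 c.2 = some a)
    (hb : T.entry c'.1 c'.2 = some b) (i j : ℕ) :
    (T.swap c c').entry i j =
      if (i, j) = c' then some a else if (i, j) = c then some b else T.entry i j := by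
  unfold swap
  rw [ha, hb]
  simp only
  rw [entry_setEntry, entry_setEntry]
  by_cases h1 : (i, j) = c'
  · subst h1
    by_cases h2 : (i, j) = c <;> simp [h2, hb]
  · by_cases h2 : (i, j) = c
    · subst h2; simp [h1, ha]
    · simp [h1, h2]

theorem map_length_setEntry (T : Filling) (c : ℕ × ℕ) (x : Letter) :
    (T.setEntry c x).map List.length = T.map List.length := by
  apply List.ext_getElem?
  intro n
  unfold setEntry
  simp only [List.getElem?_map, List.getElem?_modify]
  cases T[n]? with
  | none => rfl
  | some row => by_cases h : c.1 = n <;> simp [h]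

theorem map_length_swap (T : Filling) (c c' : ℕ × ℕ) :
    (T.swap c c').map List.length = T.map List.length := by
  unfold swap
  split
  · rw [map_length_setEntry, map_length_setEntry]
  · rfl

theorem _root_.List.cons_set_perm {α : Type*} {l : List α} {j : ℕ} {a : α} (b : α)
    (h : l[j]? = some a) : (a :: l.set j b).Perm (b :: l) := by
  induction l generalizing j with
  | nil => simp at h
  | cons x l ih =>
    cases j with
    | zero => simp at h; subst h; simpa using List.Perm.swap _ _ _
    | succ j =>
      simp only [List.getElem?_cons_succ] at h
      simp only [List.set_cons_succ]
      exact (List.Perm.swap _ _ _).trans (((ih h).cons x).trans (List.Perm.swap _ _ _))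

theorem cons_setEntry_perm {T : Filling} {c : ℕ × ℕ} {a : Letter} (b : Letter)
    (h : T.entry c.1 c.2 = some a) : (a :: (T.setEntry c b).flatten).Perm (b :: T.flatten) := by
  obtain ⟨i, j⟩ := c
  unfold setEntry
  induction T generalizing i with
  | nil => simp [entry] at h
  | cons row T ih =>
    cases i with
    | zero =>
      simp only [entry, List.getElem?_cons_zero, Option.bind_some] at h
      simp only [List.modify_zero_cons, List.flatten_cons, ← List.cons_append]
      exact (List.cons_set_perm b h).append_right _
    | succ i =>
      simp only [entry, List.getElem?_cons_succ] at h
      have := ih i h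
      simp only [List.modify_succ_cons, List.flatten_cons]
      refine List.perm_middle.symm.trans ?_
      refine (this.append_left row).trans List.perm_middle

theorem flatten_swap_perm (T : Filling) (c c' : ℕ × ℕ) : (T.swap c c').flatten.Perm T.flatten := by
  unfold swap
  split
  · rename_i a b ha hb
    have h1 := cons_setEntry_perm b ha
    have h2 : (T.setEntry c b).entry c'.1 c'.2 = some b := by
      rw [entry_setEntry, hb]; split_ifs <;> rfl
    exact (List.perm_cons b).1 ((cons_setEntry_perm a h2).trans h1)
  · exact .refl _

theorem map_length_slide (next : Filling → ℕ × ℕ → Option (ℕ × ℕ)) (n : ℕ) (T : Filling)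
    (c : ℕ × ℕ) : (slide next n T c).map List.length = T.map List.length := by
  induction n generalizing T c with
  | zero => rfl
  | succ n ih =>
    unfold slide
    split
    · rfl
    · rw [ih, map_length_swap]

theorem flatten_slide_perm (next : Filling → ℕ × ℕ → Option (ℕ × ℕ)) (n : ℕ) (T : Filling)
    (c : ℕ × ℕ) : (slide next n T c).flatten.Perm T.flatten := by
  induction n generalizing T c with
  | zero => exact .refl _
  | succ n ih =>
    unfold slide
    split
    · exact .refl _
    · exact (ih _ _).trans (flatten_swap_perm _ _ _)

theorem map_length_foldl_slide (next : Filling → ℕ × ℕ → Option (ℕ × ℕ)) (n : ℕ) (L : List (ℕ × ℕ))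
    (T : Filling) : (L.foldl (slide next n) T).map List.length = T.map List.length := by
  induction L generalizing T with
  | nil => rfl
  | cons c L ih => rw [List.foldl_cons, ih, map_length_slide]

theorem flatten_foldl_slide_perm (next : Filling → ℕ × ℕ → Option (ℕ × ℕ)) (n : ℕ)
    (L : List (ℕ × ℕ)) (T : Filling) : (L.foldl (slide next n) T).flatten.Perm T.flatten := by
  induction L generalizing T with
  | nil => exact .refl _
  | cons c L ih => exact (ih _).trans (flatten_slide_perm _ _ _ _)

theorem size_foldl_slide (next : Filling → ℕ × ℕ → Option (ℕ × ℕ)) (n : ℕ)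
    (L : List (ℕ × ℕ)) (T : Filling) : (L.foldl (slide next n) T).size = T.size :=
  (flatten_foldl_slide_perm next n L T).length_eq

theorem length_eq_of_map_length {T T' : Filling} (h : T.map List.length = T'.map List.length) :
    T.length = T'.length := by
  simpa using congrArg List.length h

theorem hasPartitionShape_congr {T T' : Filling} (h : T.map List.length = T'.map List.length) :
    T.HasPartitionShape ↔ T'.HasPartitionShape := by
  have key : ∀ U : Filling, (∀ row ∈ U, row ≠ []) ↔ ∀ n ∈ U.map List.length, n ≠ 0 := by
    intro U; simp
  unfold HasPartitionShape
  rw [key, key, h]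

theorem ext_entry {T T' : Filling} (hl : T.length = T'.length)
    (h : ∀ i j, T.entry i j = T'.entry i j) : T = T' := by
  apply List.ext_getElem hl
  intro i h1 h2
  apply List.ext_getElem?
  intro j
  have := h i j
  simpa [entry, h1, h2] using this

theorem entry_eq_some_iff {T : Filling} {i j : ℕ} {x : Letter} :
    T.entry i j = some x ↔ ∃ row, T[i]? = some row ∧ row[j]? = some x := by
  unfold entry; rw [Option.bind_eq_some_iff]

theorem entry_isSome_iff {T : Filling} {i j : ℕ} :
    (T.entry i j).isSome ↔ ∃ n, (T.map List.length)[i]? = some n ∧ j < n := by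
  unfold entry
  rw [List.getElem?_map]
  cases T[i]? with
  | none => simp
  | some row => simp

theorem entry_isSome_congr {T T' : Filling} (h : T.map List.length = T'.map List.length) (i j : ℕ) :
    (T.entry i j).isSome = (T'.entry i j).isSome := by
  rw [Bool.eq_iff_iff, entry_isSome_iff, entry_isSome_iff, h]

theorem HasPartitionShape.isSome_of_le {T : Filling} (hT : T.HasPartitionShape) {i j i' j' : ℕ}
    (h : (T.entry i j).isSome) (hi : i' ≤ i) (hj : j' ≤ j) : (T.entry i' j').isSome := by
  rw [entry_isSome_iff] at h ⊢
  obtain ⟨n, h1, h2⟩ := h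
  rcases hi.eq_or_lt with rfl | hi
  · exact ⟨n, h1, by omega⟩
  · obtain ⟨h3, h4⟩ := List.getElem?_eq_some_iff.1 h1
    have := List.pairwise_iff_getElem.1 hT.2 i' i (by omega) h3 hi
    exact ⟨_, List.getElem?_eq_getElem (by omega), by omega⟩

theorem add_lt_size {T : Filling} (hT : ∀ row ∈ T, row ≠ []) {i j : ℕ} (h : (T.entry i j).isSome) :
    i + j < T.size := by
  unfold size
  induction T generalizing i with
  | nil => simp [entry] at h
  | cons row T ih =>
    have h0 : 0 < row.length := List.length_pos_of_ne_nil (hT row (by simp))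
    rw [List.flatten_cons, List.length_append]
    cases i with
    | zero =>
      simp [entry] at h
      omega
    | succ i =>
      have := ih (fun r hr => hT r (by simp [hr])) (i := i) (by simpa [entry] using h)
      omega

end Filling

namespace GridSlide

/-- The filling `T` of `D`, with letters represented by the places `f`. -/
structure Rep (D : Set (ℤ × ℤ)) (d : ℕ) (v : ℕ → ℕ) (T : Filling) (f : ℤ × ℤ → ℤ) : Prop where
  some : ∀ i j, toGrid (i, j) ∈ D → T.entry i j = some (decode d v (f (toGrid (i, j))))
  none : ∀ i j, toGrid (i, j) ∉ D → T.entry i j = none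
  nonneg : ∀ e ∈ D, 0 ≤ e.1 ∧ 0 ≤ e.2

variable {D : Set (ℤ × ℤ)} {d : ℕ} {v : ℕ → ℕ} {f g : ℤ × ℤ → ℤ} {k : ℕ} {pos : ℕ → ℕ × ℕ}
  {T T' : Filling} {c c' : ℕ × ℕ}

theorem Rep.mem_of_some (R : Rep D d v T f) {i j : ℕ} {x : Letter} (h : T.entry i j = .some x) :
    toGrid (i, j) ∈ D := by
  by_contra hc
  rw [R.none i j hc] at h; cases h

theorem Rep.ext (R : Rep D d v T f) (R' : Rep D d v T' g)
    (h : ∀ e ∈ D, decode d v (f e) = decode d v (g e)) (hl : T.length = T'.length) : T = T' := by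
  apply Filling.ext_entry hl
  intro i j
  by_cases hD : toGrid (i, j) ∈ D
  · rw [R.some i j hD, R'.some i j hD, h _ hD]
  · rw [R.none i j hD, R'.none i j hD]

theorem Rep.congr (R : Rep D d v T f) (h : ∀ e ∈ D, decode d v (g e) = decode d v (f e)) :
    Rep D d v T g :=
  ⟨fun i j hD => by rw [R.some i j hD, h _ hD], R.none, R.nonneg⟩

theorem Rep.swap (R : Rep D d v T f) (hc : toGrid c ∈ D) (hc' : toGrid c' ∈ D) (hne : c' ≠ c) :
    Rep D d v (T.swap c c') (swapAt f (toGrid c) (toGrid c')) := by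
  have key := Filling.entry_swap (R.some c.1 c.2 hc) (R.some c'.1 c'.2 hc')
  refine ⟨fun i j hD => ?_, fun i j hD => ?_, R.nonneg⟩
  · rw [key]
    by_cases h1 : (i, j) = c'
    · rw [if_pos h1, h1, swapAt_right]
    · rw [if_neg h1]
      by_cases h2 : (i, j) = c
      · rw [if_pos h2, h2, swapAt_left]
      · rw [if_neg h2, swapAt_of_ne (by rwa [Ne, toGrid_inj]) (by rwa [Ne, toGrid_inj]), R.some i j hD]
  · rw [key, if_neg (by rintro rfl; exact hD hc'), if_neg (by rintro rfl; exact hD hc), R.none i j hD]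

theorem Mid.decode_hole (M : Mid D d v k pos f (toGrid c)) :
    decode d v (f (toGrid c)) = ⟨v k, true⟩ := by
  rcases M.apply_hole with h | h
  · rw [h, decode_lowKey M.lt]
  · rw [h, decode_highKey M.lt]

/-- The test on letters agrees with comparing the key to the upper bound of the window. In
particular, a barred letter to the south-east of the hole must have a larger label, hence a key
beyond the window, and it blocks the slide in both descriptions. -/
theorem Mid.filter_SE (hv : Monotone v) (M : Mid D d v k pos f (toGrid c)) (R : Rep D d v T f)
    {i j : ℕ} (hi : c.1 ≤ i) (hj : c.2 ≤ j) (hne : (i, j) ≠ c) :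
    (∃ s, (T.entry i j).filter (fun y => !y.bar && decide (y.val < v k)) = .some ⟨s, false⟩ ∧
      toGrid (i, j) ∈ D ∧ f (toGrid (i, j)) = plainKey d s ∧ f (toGrid (i, j)) < highKey d v k) ∨
    ((T.entry i j).filter (fun y => !y.bar && decide (y.val < v k)) = .none ∧
      (toGrid (i, j) ∈ D → highKey d v k ≤ f (toGrid (i, j)))) := by
  by_cases hD : toGrid (i, j) ∈ D
  · have hne' : toGrid (i, j) ≠ toGrid c := by rwa [Ne, toGrid_inj]
    rw [R.some i j hD]
    rcases M.other _ hD hne' with ⟨s, hs⟩ | ⟨l, hl, hlk, he⟩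
    · rw [hs, decode_plainKey, plainKey_lt_highKey M.lt]
      by_cases h : s < v k
      · left; exact ⟨s, by simp [h], hD, rfl, h⟩
      · right; refine ⟨by simp; omega, fun _ => ?_⟩
        rw [← not_lt, plainKey_lt_highKey M.lt]; exact h
    · right
      have h1 := M.apply_pos l hl hlk
      rw [he, h1, decode_keyAt hl]
      refine ⟨by simp, fun _ => ?_⟩
      have h2 := M.hole.lo_lt _ _ hD hne' (by simp [toGrid]; omega) (by simp [toGrid]; omega)
      rw [← toGrid, he, h1] at h2
      unfold keyAt at h2 ⊢
      split_ifs at h2 ⊢ with h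
      · have := lowKey_lt_lowKey (d := d) h; omega
      · exact (highKey_lt_highKey hv (by omega)).le
  · right; rw [R.none i j hD]; exact ⟨rfl, fun h => (hD h).elim⟩

theorem Mid.nextSE (hv : Monotone v) (M : Mid D d v k pos f (toGrid c)) (R : Rep D d v T f) :
    (∃ c', Filling.nextSE T c = .some c' ∧ CondSE D (highKey d v k) f (toGrid c) (toGrid c')) ∨
    (Filling.nextSE T c = .none ∧ StuckSE D (highKey d v k) f (toGrid c)) := by
  obtain ⟨i, j⟩ := c
  have hc : T.entry i j = .some ⟨v k, true⟩ := by rw [R.some i j M.hole.mem, M.decode_hole]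
  have er : toGrid (i, j + 1) = ((toGrid (i, j)).1, (toGrid (i, j)).2 + 1) := by simp [toGrid]
  have eb : toGrid (i + 1, j) = ((toGrid (i, j)).1 + 1, (toGrid (i, j)).2) := by simp [toGrid]
  have hr := M.filter_SE hv R (i := i) (j := j + 1) le_rfl (by simp) (by simp)
  have hb := M.filter_SE hv R (i := i + 1) (j := j) (by simp) le_rfl (by simp)
  unfold Filling.nextSE
  simp only [hc, Option.map_some, Option.getD_some]
  rcases hr with ⟨s, r1, r2, r3, r4⟩ | ⟨r1, r2⟩ <;> rcases hb with ⟨t, b1, b2, b3, b4⟩ | ⟨b1, b2⟩ <;>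
    rw [r1, b1] <;> simp only
  · left
    by_cases h : s < t
    · refine ⟨(i, j + 1), by rw [if_pos h], Or.inr ⟨er, r2, r4, fun _ => ?_⟩⟩
      rw [← er, ← eb, r3, b3, plainKey_lt_plainKey]; exact h
    · refine ⟨(i + 1, j), by rw [if_neg h], Or.inl ⟨eb, b2, b4, fun _ => ?_⟩⟩
      rw [← er, ← eb, r3, b3, plainKey_le_plainKey]; omega
  · left
    refine ⟨(i, j + 1), rfl, Or.inr ⟨er, r2, r4, fun h => ?_⟩⟩
    rw [← er, ← eb]
    exact r4.trans_le (b2 (by rw [eb]; exact h))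
  · left
    refine ⟨(i + 1, j), rfl, Or.inl ⟨eb, b2, b4, fun h => ?_⟩⟩
    rw [← er, ← eb]
    exact b4.le.trans (r2 (by rw [er]; exact h))
  · right
    refine ⟨trivial, ?_⟩
    unfold StuckSE
    rw [← er, ← eb]; exact ⟨b2, r2⟩

theorem Mid.filter_NW (hv : Monotone v) (M : Mid D d v k pos f (toGrid c)) (R : Rep D d v T f)
    {i j : ℕ} (hi : i ≤ c.1) (hj : j ≤ c.2) (hne : (i, j) ≠ c) :
    (∃ s, (T.entry i j).filter (fun y => !y.bar) = .some ⟨s, false⟩ ∧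
      toGrid (i, j) ∈ D ∧ f (toGrid (i, j)) = plainKey d s ∧ lowKey d k < f (toGrid (i, j))) ∨
    ((T.entry i j).filter (fun y => !y.bar) = .none ∧
      (toGrid (i, j) ∈ D → f (toGrid (i, j)) ≤ lowKey d k)) := by
  by_cases hD : toGrid (i, j) ∈ D
  · have hne' : toGrid (i, j) ≠ toGrid c := by rwa [Ne, toGrid_inj]
    rw [R.some i j hD]
    rcases M.other _ hD hne' with ⟨s, hs⟩ | ⟨l, hl, hlk, he⟩
    · rw [hs, decode_plainKey]
      left; exact ⟨s, by simp, hD, rfl, lowKey_lt_plainKey M.lt⟩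
    · right
      have h1 := M.apply_pos l hl hlk
      rw [he, h1, decode_keyAt hl]
      refine ⟨by simp, fun _ => ?_⟩
      have h2 := M.hole.lt_hi _ _ hD hne' (by simp [toGrid]; omega) (by simp [toGrid]; omega)
      rw [← toGrid, he, h1] at h2
      unfold keyAt at h2 ⊢
      split_ifs at h2 ⊢ with h
      · exact (lowKey_lt_lowKey h).le
      · have := highKey_lt_highKey (d := d) hv (show k < l by omega); omega
  · right; rw [R.none i j hD]; exact ⟨rfl, fun h => (hD h).elim⟩

theorem Mid.nextNW (hv : Monotone v) (M : Mid D d v k pos f (toGrid c)) (R : Rep D d v T f) :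
    (∃ c', Filling.nextNW T c = .some c' ∧ CondNW D (lowKey d k) f (toGrid c) (toGrid c')) ∨
    (Filling.nextNW T c = .none ∧ StuckNW D (lowKey d k) f (toGrid c)) := by
  obtain ⟨i, j⟩ := c
  have hl : (∃ s, (if j = 0 then none else T.entry i (j - 1)).filter (fun y => !y.bar)
        = .some ⟨s, false⟩ ∧ j ≠ 0 ∧ toGrid (i, j - 1) ∈ D ∧ f (toGrid (i, j - 1)) = plainKey d s ∧
        lowKey d k < f (toGrid (i, j - 1))) ∨
      ((if j = 0 then none else T.entry i (j - 1)).filter (fun y => !y.bar) = .none ∧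
        (((i : ℤ), (j : ℤ) - 1) ∈ D → f ((i : ℤ), (j : ℤ) - 1) ≤ lowKey d k)) := by
    by_cases h : j = 0
    · subst h; right
      refine ⟨by simp, fun h => ?_⟩
      have := R.nonneg _ h; simp at this
    · have e : toGrid (i, j - 1) = ((i : ℤ), (j : ℤ) - 1) := by simp [toGrid]; omega
      rw [if_neg h, ← e]
      rcases M.filter_NW hv R (i := i) (j := j - 1) le_rfl (by simp) (by simp; omega) with
        ⟨s, h1, h2⟩ | h1
      · exact Or.inl ⟨s, h1, h, h2⟩
      · exact Or.inr h1
  have ha : (∃ s, (if i = 0 then none else T.entry (i - 1) j).filter (fun y => !y.bar)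
        = .some ⟨s, false⟩ ∧ i ≠ 0 ∧ toGrid (i - 1, j) ∈ D ∧ f (toGrid (i - 1, j)) = plainKey d s ∧
        lowKey d k < f (toGrid (i - 1, j))) ∨
      ((if i = 0 then none else T.entry (i - 1) j).filter (fun y => !y.bar) = .none ∧
        (((i : ℤ) - 1, (j : ℤ)) ∈ D → f ((i : ℤ) - 1, (j : ℤ)) ≤ lowKey d k)) := by
    by_cases h : i = 0
    · subst h; right
      refine ⟨by simp, fun h => ?_⟩
      have := R.nonneg _ h; simp at this
    · have e : toGrid (i - 1, j) = ((i : ℤ) - 1, (j : ℤ)) := by simp [toGrid]; omega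
      rw [if_neg h, ← e]
      rcases M.filter_NW hv R (i := i - 1) (j := j) (by simp) le_rfl (by simp; omega) with
        ⟨s, h1, h2⟩ | h1
      · exact Or.inl ⟨s, h1, h, h2⟩
      · exact Or.inr h1
  have el : j ≠ 0 → toGrid (i, j - 1) = ((i : ℤ), (j : ℤ) - 1) := by
    intro h; simp [toGrid]; omega
  have ea : i ≠ 0 → toGrid (i - 1, j) = ((i : ℤ) - 1, (j : ℤ)) := by
    intro h; simp [toGrid]; omega
  have e0 : toGrid (i, j) = ((i : ℤ), (j : ℤ)) := rfl
  unfold Filling.nextNW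
  simp only
  rcases hl with ⟨s, r1, r0, r2, r3, r4⟩ | ⟨r1, r2⟩ <;>
    rcases ha with ⟨t, b1, b0, b2, b3, b4⟩ | ⟨b1, b2⟩ <;> rw [r1, b1] <;> simp only
  · left
    by_cases h : t < s
    · refine ⟨(i, j - 1), by rw [if_pos h], Or.inr ⟨by rw [el r0, e0], r2, r4, fun _ => ?_⟩⟩
      rw [e0]; simp only
      rw [← el r0, ← ea b0, r3, b3, plainKey_lt_plainKey]; exact h
    · refine ⟨(i - 1, j), by rw [if_neg h], Or.inl ⟨by rw [ea b0, e0], b2, b4, fun _ => ?_⟩⟩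
      rw [e0]; simp only
      rw [← el r0, ← ea b0, r3, b3, plainKey_le_plainKey]; omega
  · left
    refine ⟨(i, j - 1), rfl, Or.inr ⟨by rw [el r0, e0], r2, r4, fun h => ?_⟩⟩
    rw [e0] at h ⊢; simp only at h ⊢
    rw [← el r0]; exact (b2 h).trans_lt r4
  · left
    refine ⟨(i - 1, j), rfl, Or.inl ⟨by rw [ea b0, e0], b2, b4, fun h => ?_⟩⟩
    rw [e0] at h ⊢; simp only at h ⊢
    rw [← ea b0]; exact (r2 h).trans b4.le
  · right
    exact ⟨trivial, b2, r2⟩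

/-- Every move increases the sum of the coordinates by one, and this sum stays below `N`. So the
allowed number of moves is never exhausted before the hole is stuck. -/
theorem Mid.runSE (hv : Monotone v) {N : ℕ} (hN : ∀ e ∈ D, e.1 + e.2 < N) (n : ℕ)
    (M : Mid D d v k pos f (toGrid c)) (R : Rep D d v T f) (hn : N ≤ n + (c.1 + c.2)) :
    ∃ g c', ChainSE D (highKey d v k) f (toGrid c) g (toGrid c') ∧
      StuckSE D (highKey d v k) g (toGrid c') ∧ Rep D d v (Filling.slide Filling.nextSE n T c) g := by
  induction n generalizing T f c with
  | zero =>
    have := hN _ M.hole.mem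
    simp only [toGrid] at this; omega
  | succ n ih =>
    unfold Filling.slide
    rcases M.nextSE hv R with ⟨c', h1, h2⟩ | ⟨h1, h2⟩
    · rw [h1]
      have hc' : toGrid c' ∈ D ∧ c.1 + c.2 + 1 = c'.1 + c'.2 := by
        rcases h2 with ⟨h, h', _⟩ | ⟨h, h', _⟩ <;> refine ⟨h', ?_⟩ <;>
          simp only [toGrid, Prod.mk.injEq] at h <;> omega
      obtain ⟨g, e, a1, a2, a3⟩ := ih (M.stepSE hv h2)
        (R.swap M.hole.mem hc'.1 (by rw [Ne, ← toGrid_inj]; exact h2.ne)) (by omega)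
      exact ⟨g, e, .step h2 a1, a2, a3⟩
    · rw [h1]
      exact ⟨f, c, .refl _ _, h2, R⟩

theorem Mid.runNW (hv : Monotone v) (n : ℕ)
    (M : Mid D d v k pos f (toGrid c)) (R : Rep D d v T f) (hn : c.1 + c.2 ≤ n) :
    ∃ g c', ChainNW D (lowKey d k) f (toGrid c) g (toGrid c') ∧
      StuckNW D (lowKey d k) g (toGrid c') ∧ Rep D d v (Filling.slide Filling.nextNW n T c) g := by
  induction n generalizing T f c with
  | zero =>
    refine ⟨f, c, .refl _ _, ⟨fun h => ?_, fun h => ?_⟩, R⟩ <;>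
    · have := R.nonneg _ h
      simp only [toGrid] at this; omega
  | succ n ih =>
    unfold Filling.slide
    rcases M.nextNW hv R with ⟨c', h1, h2⟩ | ⟨h1, h2⟩
    · rw [h1]
      have hc' : toGrid c' ∈ D ∧ c'.1 + c'.2 + 1 = c.1 + c.2 := by
        rcases h2 with ⟨h, h', _⟩ | ⟨h, h', _⟩ <;> refine ⟨h', ?_⟩ <;>
          simp only [toGrid, Prod.mk.injEq] at h <;> omega
      obtain ⟨g, e, a1, a2, a3⟩ := ih (M.stepNW hv h2)
        (R.swap M.hole.mem hc'.1 (by rw [Ne, ← toGrid_inj]; exact h2.ne)) (by omega)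
      exact ⟨g, e, .step h2 a1, a2, a3⟩
    · rw [h1]
      exact ⟨f, c, .refl _ _, h2, R⟩

end GridSlide

namespace GridSlide

variable {D : Set (ℤ × ℤ)} {d : ℕ} {v : ℕ → ℕ} {f : ℤ × ℤ → ℤ} {k : ℕ} {pos : ℕ → ℕ × ℕ}
  {T : Filling}

theorem length_slide (next : Filling → ℕ × ℕ → Option (ℕ × ℕ)) (n : ℕ) (T : Filling)
    (c : ℕ × ℕ) : (Filling.slide next n T c).length = T.length :=
  Filling.length_eq_of_map_length (Filling.map_length_slide _ _ _ _)

theorem Rep.update (R : Rep D d v T f) {c : ℤ × ℤ} {x : ℤ}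
    (h : decode d v x = decode d v (f c)) : Rep D d v T (Function.update f c x) :=
  R.congr fun e _ => by
    by_cases he : e = c
    · rw [he, Function.update_self, h]
    · rw [Function.update_of_ne he]

/-- The last clause says that the slide in the other direction from the final box restores the
filling. -/
theorem State.slideSE (hv : Monotone v) (S : State D d v (k + 1) pos f) (hk : k < d)
    (R : Rep D d v T f) {n : ℕ} (hn : ∀ e ∈ D, e.1 + e.2 < n) :
    ∃ g c', ChainSE D (highKey d v k) f (toGrid (pos k)) g (toGrid c') ∧
      StuckSE D (highKey d v k) g (toGrid c') ∧
      State D d v k (Function.update pos k c') (Function.update g (toGrid c') (highKey d v k)) ∧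
      Rep D d v (Filling.slide Filling.nextSE n T (pos k))
        (Function.update g (toGrid c') (highKey d v k)) ∧
      Filling.slide Filling.nextNW n (Filling.slide Filling.nextSE n T (pos k)) c' = T := by
  have M := State.mid hv (Or.inl S) hk
  obtain ⟨g, c', h1, h2, h3⟩ := M.runSE hv hn n R (by omega)
  have M' := M.chainSE hv h1
  refine ⟨g, c', h1, h2, M'.stateSE hv h2,
    h3.update (by rw [M'.decode_hole, decode_highKey hk]), ?_⟩
  have hc' : c'.1 + c'.2 ≤ n := by
    have := hn _ M'.hole.mem
    simp only [toGrid] at this; omega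
  obtain ⟨g₂, c₂, h4, h5, h6⟩ := M'.runNW hv n h3 hc'
  -- The reversed path and the path found by the opposite rule both start at the end box and both
  -- end stuck, so they coincide by determinism.
  obtain ⟨rfl, _⟩ := h4.unique h5 (M.hole.reverseSE h1) (S.stuckNW hk)
  exact h6.ext R (fun _ _ => rfl) (by rw [length_slide, length_slide])

theorem State.slideNW (hv : Monotone v) (S : State D d v k pos f) (hk : k < d)
    (R : Rep D d v T f) {n : ℕ} (hn : ∀ e ∈ D, e.1 + e.2 < n) :
    ∃ g c', ChainNW D (lowKey d k) f (toGrid (pos k)) g (toGrid c') ∧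
      StuckNW D (lowKey d k) g (toGrid c') ∧
      State D d v (k + 1) (Function.update pos k c') (Function.update g (toGrid c') (lowKey d k)) ∧
      Rep D d v (Filling.slide Filling.nextNW n T (pos k))
        (Function.update g (toGrid c') (lowKey d k)) ∧
      Filling.slide Filling.nextSE n (Filling.slide Filling.nextNW n T (pos k)) c' = T := by
  have M := State.mid hv (Or.inr S) hk
  have hc : (pos k).1 + (pos k).2 ≤ n := by
    have := hn _ M.hole.mem
    simp only [toGrid] at this; omega
  obtain ⟨g, c', h1, h2, h3⟩ := M.runNW hv n R hc
  have M' := M.chainNW hv h1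
  refine ⟨g, c', h1, h2, M'.stateNW hv h2,
    h3.update (by rw [M'.decode_hole, decode_lowKey hk]), ?_⟩
  obtain ⟨g₂, c₂, h4, h5, h6⟩ := M'.runSE hv hn n h3 (by omega)
  obtain ⟨rfl, _⟩ := h4.unique h5 (M.hole.reverseNW h1) (S.stuckSE hk)
  exact h6.ext R (fun _ _ => rfl) (by rw [length_slide, length_slide])

/-- The label `k + 1` has just moved along a path from `a`. The label `k` starts above `a` and not
to the left of it, so its path stays above the barrier left by the previous one. -/
theorem State.lt_of_row_lt (hv : Monotone v) (S : State D d v (k + 1) pos f) (hk : k + 1 < d)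
    {a : ℕ × ℕ} {f₁ g₁ : ℤ × ℤ → ℤ}
    (H : Hole D f₁ (toGrid a) (lowKey d (k + 1)) (highKey d v (k + 1)))
    (h₁ : ChainSE D (highKey d v (k + 1)) f₁ (toGrid a) g₁ (toGrid (pos (k + 1))))
    (hs : StuckSE D (highKey d v (k + 1)) g₁ (toGrid (pos (k + 1))))
    (hf : f = Function.update g₁ (toGrid (pos (k + 1))) (highKey d v (k + 1)))
    (hrow : (pos k).1 < a.1) (hcol : a.2 ≤ (pos k).2) {g : ℤ × ℤ → ℤ} {c' : ℕ × ℕ}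
    (h₂ : ChainSE D (highKey d v k) f (toGrid (pos k)) g (toGrid c')) :
    c'.1 < (pos (k + 1)).1 := by
  have := H.row_lt h₁ hs h₂ (highKey_lt_highKey hv (Nat.lt_succ_self k)).le (S.mem k (by omega))
    (fun x _ => by rw [hf]) (by simpa [toGrid] using hrow) (by simpa [toGrid] using hcol)
  simpa [toGrid] using this

theorem State.lt_of_row_lt_NW (S : State D d v k pos f) (hk : k < d)
    {k' : ℕ} (hkk : k' + 1 = k) {a : ℕ × ℕ} {f₁ g₁ : ℤ × ℤ → ℤ}
    (H : Hole D f₁ (toGrid a) (lowKey d k') (highKey d v k'))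
    (h₁ : ChainNW D (lowKey d k') f₁ (toGrid a) g₁ (toGrid (pos k')))
    (hs : StuckNW D (lowKey d k') g₁ (toGrid (pos k')))
    (hf : f = Function.update g₁ (toGrid (pos k')) (lowKey d k'))
    (hrow : a.1 < (pos k).1) (hcol : (pos k).2 ≤ a.2) {g : ℤ × ℤ → ℤ} {c' : ℕ × ℕ}
    (h₂ : ChainNW D (lowKey d k) f (toGrid (pos k)) g (toGrid c')) :
    (pos k').1 < c'.1 := by
  have := H.row_lt_NW h₁ hs h₂ (lowKey_lt_lowKey (by omega)).le (S.mem k hk)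
    (fun x _ => by rw [hf]) (by simpa [toGrid] using hrow) (by simpa [toGrid] using hcol)
  simpa [toGrid] using this

/-- Labels of equal letters increase from top to bottom. -/
def RowsOrdered (d : ℕ) (v : ℕ → ℕ) (k k' : ℕ) (pos : ℕ → ℕ × ℕ) : Prop :=
  ∀ l, k ≤ l → l + 1 < k' → l + 1 < d → v l = v (l + 1) → (pos l).1 < (pos (l + 1)).1

theorem foldl_range'_congr {a b : ℕ → ℕ × ℕ} {k n : ℕ} (h : ∀ l, k ≤ l → l < k + n → a l = b l) :
    (List.range' k n).map a = (List.range' k n).map b :=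
  List.map_congr_left fun l hl => by
    rw [List.mem_range'_1] at hl; exact h l hl.1 hl.2

/-- Induction on the number `j` of moved letters. The invariant contains the vertical order of equal
letters and the fact that undoing the moves restores the filling. The last clause remembers the path
of the most recent slide, which is the barrier needed for the next one. -/
theorem State.toNatural_aux (hv : Monotone v) {a : ℕ → ℕ × ℕ} (S : State D d v d a f)
    (R : Rep D d v T f) {n : ℕ} (hn : ∀ e ∈ D, e.1 + e.2 < n) (ho : RowsOrdered d v 0 d a)
    (j : ℕ) (hj : j ≤ d) : ∃ p g,
      State D d v (d - j) p g ∧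
      Rep D d v (((List.range' (d - j) j).map a).reverse.foldl (Filling.slide Filling.nextSE n) T) g ∧
      (∀ l < d - j, p l = a l) ∧ RowsOrdered d v (d - j) d p ∧
      ((List.range' (d - j) j).map p).foldl (Filling.slide Filling.nextNW n)
        (((List.range' (d - j) j).map a).reverse.foldl (Filling.slide Filling.nextSE n) T) = T ∧
      (0 < j → ∃ f₁ g₁, Hole D f₁ (toGrid (a (d - j))) (lowKey d (d - j)) (highKey d v (d - j)) ∧
        ChainSE D (highKey d v (d - j)) f₁ (toGrid (a (d - j))) g₁ (toGrid (p (d - j))) ∧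
        StuckSE D (highKey d v (d - j)) g₁ (toGrid (p (d - j))) ∧
        g = Function.update g₁ (toGrid (p (d - j))) (highKey d v (d - j))) := by
  induction j with
  | zero =>
    exact ⟨a, f, S, R, fun _ _ => rfl, fun l _ _ => by omega, rfl, fun h => by omega⟩
  | succ j ih =>
    obtain ⟨p, g, S', R', hp, hro, hback, hlast⟩ := ih (by omega)
    obtain ⟨k, hk⟩ : ∃ k, k = d - (j + 1) := ⟨_, rfl⟩
    have hk' : d - j = k + 1 := by omega
    rw [hk'] at S' R' hp hro hback hlast
    rw [← hk]
    obtain ⟨g', c', h1, h2, h3, h4, h5⟩ := S'.slideSE hv (by omega) R' hn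
    have hpk : p k = a k := hp k (by omega)
    have e1 : ((List.range' k (j + 1)).map a).reverse.foldl (Filling.slide Filling.nextSE n) T =
        Filling.slide Filling.nextSE n
          (((List.range' (k + 1) j).map a).reverse.foldl (Filling.slide Filling.nextSE n) T) (p k) := by
      rw [List.range'_succ, List.map_cons, List.reverse_cons, List.foldl_append, hpk]
      rfl
    refine ⟨Function.update p k c', _, h3, by rw [e1]; exact h4, ?_, ?_, ?_, fun _ => ?_⟩
    · intro l hl
      rw [Function.update_of_ne (by omega)]; exact hp l (by omega)
    · intro l hl hl' hl'' hvl
      rcases hl.eq_or_lt with rfl | hl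
      · rw [Function.update_self, Function.update_of_ne (by omega)]
        obtain ⟨f₁, g₁, q1, q2, q3, q4⟩ := hlast (by omega)
        have hr := ho k (by omega) hl' hl'' hvl
        -- Neither letter has moved in the state `S`, so both keys are low keys, which are
        -- consecutive for consecutive labels.
        have hc := S.col_le hv hl'' (by
          rw [keyAt, keyAt, if_pos hl'', if_pos (by omega)]; unfold lowKey; push_cast; ring) hr
        exact S'.lt_of_row_lt hv hl'' q1 q2 q3 q4 (by rw [hpk]; exact hr)
          (by rw [hpk]; exact hc) h1
      · rw [Function.update_of_ne (by omega), Function.update_of_ne (by omega)]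
        exact hro l hl hl' hl'' hvl
    · rw [e1, List.range'_succ, List.map_cons, List.foldl_cons, Function.update_self, h5]
      rw [foldl_range'_congr (a := Function.update p k c') (b := p) fun l hl _ => Function.update_of_ne (show l ≠ k by omega) _ _]
      exact hback
    · rw [Function.update_self]
      exact ⟨g, g', by rw [← hpk]; exact (State.hole hv (Or.inl S') (by omega)),
        by rw [← hpk]; exact h1, h2, rfl⟩

theorem State.toSmallBar_aux (hv : Monotone v) {a : ℕ → ℕ × ℕ} (S : State D d v 0 a f)
    (R : Rep D d v T f) {n : ℕ} (hn : ∀ e ∈ D, e.1 + e.2 < n) (ho : RowsOrdered d v 0 d a)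
    (j : ℕ) (hj : j ≤ d) : ∃ p g,
      State D d v j p g ∧
      Rep D d v (((List.range j).map a).foldl (Filling.slide Filling.nextNW n) T) g ∧
      (∀ l, j ≤ l → p l = a l) ∧ RowsOrdered d v 0 j p ∧
      ((List.range j).map p).reverse.foldl (Filling.slide Filling.nextSE n)
        (((List.range j).map a).foldl (Filling.slide Filling.nextNW n) T) = T ∧
      (∀ k, k + 1 = j → ∃ f₁ g₁, Hole D f₁ (toGrid (a k)) (lowKey d k) (highKey d v k) ∧
        ChainNW D (lowKey d k) f₁ (toGrid (a k)) g₁ (toGrid (p k)) ∧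
        StuckNW D (lowKey d k) g₁ (toGrid (p k)) ∧
        g = Function.update g₁ (toGrid (p k)) (lowKey d k)) := by
  induction j with
  | zero =>
    exact ⟨a, f, S, R, fun _ _ => rfl, fun l _ _ => by omega, rfl, fun k h => by omega⟩
  | succ k ih =>
    obtain ⟨p, g, S', R', hp, hro, hback, hlast⟩ := ih (by omega)
    obtain ⟨g', c', h1, h2, h3, h4, h5⟩ := S'.slideNW hv (by omega) R' hn
    have hpk : p k = a k := hp k le_rfl
    have e1 : ((List.range (k + 1)).map a).foldl (Filling.slide Filling.nextNW n) T =
        Filling.slide Filling.nextNW n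
          (((List.range k).map a).foldl (Filling.slide Filling.nextNW n) T) (p k) := by
      rw [List.range_succ, List.map_append, List.foldl_append, hpk]
      rfl
    refine ⟨Function.update p k c', _, h3, by rw [e1]; exact h4, ?_, ?_, ?_, ?_⟩
    · intro l hl
      rw [Function.update_of_ne (by omega)]; exact hp l (by omega)
    · intro l hl hl' hl'' hvl
      by_cases hlk : l + 1 = k
      · subst hlk
        rw [Function.update_self, Function.update_of_ne (by omega)]
        obtain ⟨f₁, g₁, q1, q2, q3, q4⟩ := hlast l rfl
        have hr := ho l (by omega) hl'' hl'' hvl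
        -- In the initial state for the natural order all keys are high keys. Those of consecutive
        -- labels are consecutive only for equal letters, which is where `hvl` enters.
        have hc := S.col_le hv hl'' (by
          rw [keyAt, keyAt, if_neg (by omega), if_neg (by omega)]; unfold highKey; rw [hvl]
          push_cast; ring) hr
        exact S'.lt_of_row_lt_NW hl'' rfl q1 q2 q3 q4 (by rw [hpk]; exact hr)
          (by rw [hpk]; exact hc) h1
      · rw [Function.update_of_ne (by omega), Function.update_of_ne (by omega)]
        exact hro l hl (by omega) hl'' hvl
    · rw [e1, List.range_succ, List.map_append, List.reverse_append, List.foldl_append]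
      simp only [List.map_cons, List.map_nil, List.reverse_cons, List.reverse_nil, List.nil_append,
        List.foldl_cons, List.foldl_nil, Function.update_self, h5]
      rw [List.map_congr_left (f := Function.update p k c') (g := p) fun l hl => Function.update_of_ne
        (show l ≠ k by rw [List.mem_range] at hl; omega) _ _]
      exact hback
    · intro k' hk'
      obtain rfl : k' = k := by omega
      rw [Function.update_self]
      exact ⟨g, g', by rw [← hpk]; exact (State.hole hv (Or.inr S') (by omega)),
        by rw [← hpk]; exact h1, h2, rfl⟩

end GridSlide

/-! ### Labels of the barred letters; the two conversions are inverse to each other. -/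

/-- The small bar order `1̄ ≺ 2̄ ≺ ⋯ ≺ 1 ≺ 2 ≺ ⋯`. -/
def SmallBarLT (a b : Letter) : Prop :=
  (a.bar = true ∧ b.bar = false) ∨ (a.bar = b.bar ∧ a.val < b.val)

namespace Filling

/-- The number of the letter in a box, or `0`. -/
def valAt (T : Filling) (c : ℕ × ℕ) : ℕ := ((T.entry c.1 c.2).map Letter.val).getD 0

/-- The order in which `barredBoxes` lists the boxes. -/
def BoxLT (T : Filling) (c c' : ℕ × ℕ) : Prop :=
  T.valAt c < T.valAt c' ∨ (T.valAt c = T.valAt c' ∧ (c.1 < c'.1 ∨ (c.1 = c'.1 ∧ c.2 < c'.2)))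

instance (T : Filling) : Std.Irrefl T.BoxLT := ⟨fun c h => by unfold BoxLT at h; omega⟩

instance (T : Filling) : Std.Antisymm T.BoxLT :=
  ⟨fun c c' h h' => by unfold BoxLT at h h'; omega⟩

theorem valAt_of_entry {T : Filling} {c : ℕ × ℕ} {x : Letter} (h : T.entry c.1 c.2 = some x) :
    T.valAt c = x.val := by
  simp [valAt, h]

theorem entry_mem_flatten {T : Filling} {i j : ℕ} {x : Letter} (h : T.entry i j = some x) :
    x ∈ T.flatten := by
  obtain ⟨row, h1, h2⟩ := entry_eq_some_iff.1 h
  exact List.mem_flatten.2 ⟨row, List.mem_of_getElem? h1, List.mem_of_getElem? h2⟩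

theorem _root_.List.le_foldr_max {l : List ℕ} {x : ℕ} (h : x ∈ l) : x ≤ l.foldr max 0 := by
  induction l with
  | nil => simp at h
  | cons a l ih =>
    rw [List.foldr_cons]
    rcases List.mem_cons.1 h with rfl | h
    · exact le_max_left _ _
    · exact (ih h).trans (le_max_right _ _)

theorem mem_barredBoxes {T : Filling} {c : ℕ × ℕ} :
    c ∈ T.barredBoxes ↔ ∃ s, T.entry c.1 c.2 = some ⟨s, true⟩ := by
  obtain ⟨i, j⟩ := c
  unfold barredBoxes
  simp only [List.mem_flatMap, List.mem_range, List.mem_filterMap, Option.ite_none_right_eq_some,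
    Option.some.injEq, Prod.mk.injEq]
  constructor
  · rintro ⟨s, -, i', -, j', -, h, rfl, rfl⟩; exact ⟨s, h⟩
  · rintro ⟨s, h⟩
    refine ⟨s, ?_, i, ?_, j, ?_, h, rfl, rfl⟩
    · have : s ∈ T.flatten.map Letter.val := List.mem_map.2 ⟨_, entry_mem_flatten h, rfl⟩
      exact Nat.lt_succ_of_le (List.le_foldr_max this)
    · obtain ⟨row, h1, -⟩ := entry_eq_some_iff.1 h
      exact (List.getElem?_eq_some_iff.1 h1).1
    · obtain ⟨row, h1, h2⟩ := entry_eq_some_iff.1 h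
      rw [List.getD_eq_getElem?_getD, h1]
      exact (List.getElem?_eq_some_iff.1 h2).1

theorem pairwise_barredBoxes (T : Filling) : T.barredBoxes.Pairwise T.BoxLT := by
  have key : ∀ s i c, c ∈ ((List.range (T.getD i []).length).filterMap fun j =>
      if T.entry i j = some ⟨s, true⟩ then some (i, j) else none) → c.1 = i ∧ T.valAt c = s := by
    intro s i c hc
    simp only [List.mem_filterMap, Option.ite_none_right_eq_some, Option.some.injEq] at hc
    obtain ⟨j, -, h, rfl⟩ := hc
    exact ⟨rfl, by rw [valAt_of_entry (c := (i, j)) h]⟩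
  unfold barredBoxes
  rw [List.pairwise_flatMap]
  constructor
  · intro s _
    rw [List.pairwise_flatMap]
    constructor
    · intro i _
      rw [List.pairwise_filterMap]
      refine List.pairwise_lt_range.imp ?_
      intro j j' hjj c hc c' hc'
      simp only [Option.ite_none_right_eq_some, Option.some.injEq] at hc hc'
      obtain ⟨h, rfl⟩ := hc
      obtain ⟨h', rfl⟩ := hc'
      exact Or.inr ⟨by rw [valAt_of_entry (c := (i, j)) h, valAt_of_entry (c := (i, j')) h'],
        Or.inr ⟨rfl, hjj⟩⟩
    · refine List.pairwise_lt_range.imp ?_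
      intro i i' hii c hc c' hc'
      have h := key _ _ _ hc
      have h' := key _ _ _ hc'
      exact Or.inr ⟨h.2.trans h'.2.symm, Or.inl (by omega)⟩
  · refine List.pairwise_lt_range.imp ?_
    intro s s' hss c hc c' hc'
    obtain ⟨i, -, hc⟩ := List.mem_flatMap.1 hc
    obtain ⟨i', -, hc'⟩ := List.mem_flatMap.1 hc'
    have h := key _ _ _ hc
    have h' := key _ _ _ hc'
    exact Or.inl (by omega)

theorem nodup_barredBoxes (T : Filling) : T.barredBoxes.Nodup :=
  (pairwise_barredBoxes T).imp fun h e => by subst e; exact (irrefl_of T.BoxLT _ h)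

/-- The `l`-th box of `barredBoxes` (the last one if there are fewer). -/
def barredBox (T : Filling) (l : ℕ) : ℕ × ℕ :=
  T.barredBoxes.getD (min l (T.barredBoxes.length - 1)) (0, 0)

/-- The number of the letter in the `l`-th box of `barredBoxes`. -/
def barredVal (T : Filling) (l : ℕ) : ℕ := T.valAt (T.barredBox l)

theorem barredBox_eq {T : Filling} {l : ℕ} (h : l < T.barredBoxes.length) :
    T.barredBox l = T.barredBoxes[l] := by
  unfold barredBox
  rw [min_eq_left (by omega), List.getD_eq_getElem]

theorem map_barredBox (T : Filling) :
    (List.range T.barredBoxes.length).map T.barredBox = T.barredBoxes := by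
  apply List.ext_getElem (by simp)
  intro n h1 h2
  rw [List.getElem_map, List.getElem_range, barredBox_eq h2]

theorem boxLT_barredBox {T : Filling} {l l' : ℕ} (h : l < l') (h' : l' < T.barredBoxes.length) :
    T.BoxLT (T.barredBox l) (T.barredBox l') := by
  rw [barredBox_eq h', barredBox_eq (h.trans h')]
  exact List.pairwise_iff_getElem.1 T.pairwise_barredBoxes _ _ _ _ h

theorem barredVal_mono (T : Filling) : Monotone T.barredVal := by
  have key : ∀ l l', l < l' → l' < T.barredBoxes.length → T.barredVal l ≤ T.barredVal l' := by
    intro l l' h h'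
    have := boxLT_barredBox h h'
    unfold BoxLT at this
    unfold barredVal; omega
  -- Labels beyond the last barred letter repeat the last box, so monotonicity holds on all of ℕ, as
  -- the states require.
  have e : ∀ l, T.barredVal l = T.barredVal (min l (T.barredBoxes.length - 1)) := by
    intro l; unfold barredVal barredBox; rw [min_assoc, min_self]
  intro l l' h
  rw [e l, e l']
  rcases Nat.eq_zero_or_pos T.barredBoxes.length with h0 | h0
  · rw [h0]; simp
  · rcases (show min l (T.barredBoxes.length - 1) ≤ min l' (T.barredBoxes.length - 1) by
      gcongr).eq_or_lt with h1 | h1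
    · rw [h1]
    · exact key _ _ h1 (by omega)

theorem entry_barredBox {T : Filling} {l : ℕ} (h : l < T.barredBoxes.length) :
    T.entry (T.barredBox l).1 (T.barredBox l).2 = some ⟨T.barredVal l, true⟩ := by
  have h1 : T.barredBox l ∈ T.barredBoxes := by rw [barredBox_eq h]; exact List.getElem_mem h
  obtain ⟨s, hs⟩ := mem_barredBoxes.1 h1
  rw [hs, barredVal, valAt_of_entry hs]

theorem exists_barredBox {T : Filling} {c : ℕ × ℕ} {s : ℕ} (h : T.entry c.1 c.2 = some ⟨s, true⟩) :
    ∃ l < T.barredBoxes.length, T.barredBox l = c := by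
  obtain ⟨l, hl, h⟩ := List.getElem_of_mem (mem_barredBoxes.2 ⟨s, h⟩)
  exact ⟨l, hl, by rw [barredBox_eq hl, h]⟩

/-- The boxes of a filling as points of the integral grid. -/
def domain (T : Filling) : Set (ℤ × ℤ) :=
  {e | 0 ≤ e.1 ∧ 0 ≤ e.2 ∧ (T.entry e.1.toNat e.2.toNat).isSome}

open GridSlide in
theorem toGrid_mem_domain {T : Filling} {i j : ℕ} :
    toGrid (i, j) ∈ T.domain ↔ (T.entry i j).isSome := by
  simp [toGrid, domain]

open GridSlide in
theorem exists_of_mem_domain {T : Filling} {e : ℤ × ℤ} (h : e ∈ T.domain) :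
    ∃ c : ℕ × ℕ, e = toGrid c ∧ ∃ x, T.entry c.1 c.2 = some x := by
  obtain ⟨h1, h2, h3⟩ := h
  exact ⟨(e.1.toNat, e.2.toNat), by simp [toGrid, h1, h2], Option.isSome_iff_exists.1 h3⟩

theorem domain_bound {T : Filling} (hT : T.HasPartitionShape) : ∀ e ∈ T.domain, e.1 + e.2 < T.size := by
  rintro e ⟨h1, h2, h3⟩
  have := add_lt_size hT.1 h3
  omega

theorem domain_conv {T : Filling} (hT : T.HasPartitionShape) (i j i' j' k l : ℤ)
    (h : (i, j) ∈ T.domain) (h' : (i', j') ∈ T.domain) (h1 : i ≤ k) (h2 : k ≤ i') (h3 : j ≤ l)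
    (h4 : l ≤ j') : (k, l) ∈ T.domain := by
  obtain ⟨a1, a2, a3⟩ := h
  obtain ⟨b1, b2, b3⟩ := h'
  simp only at a1 a2 b1 b2
  exact ⟨by simp only; omega, by simp only; omega,
    hT.isSome_of_le b3 (by simp only; omega) (by simp only; omega)⟩

open GridSlide

/-- The places of the letters of a filling, with the barred letters with labels at least `k`
placed according to the natural order and the other barred letters in front. -/
noncomputable def places (T : Filling) (k : ℕ) (e : ℤ × ℤ) : ℤ :=
  match T.entry e.1.toNat e.2.toNat with
  | none => 0
  | some ⟨s, false⟩ => plainKey T.barredBoxes.length s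
  | some ⟨_, true⟩ =>
    keyAt T.barredBoxes.length T.barredVal k (T.barredBoxes.idxOf (e.1.toNat, e.2.toNat))

theorem places_of_plain {T : Filling} {k : ℕ} {c : ℕ × ℕ} {s : ℕ}
    (h : T.entry c.1 c.2 = some ⟨s, false⟩) :
    T.places k (toGrid c) = plainKey T.barredBoxes.length s := by
  simp [places, toGrid, h]

theorem places_barredBox {T : Filling} {k l : ℕ} (hl : l < T.barredBoxes.length) :
    T.places k (toGrid (T.barredBox l)) = keyAt T.barredBoxes.length T.barredVal k l := by
  have h := entry_barredBox hl
  unfold places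
  simp only [toGrid, Int.toNat_natCast, h]
  congr 1
  rw [barredBox_eq hl]
  exact T.nodup_barredBoxes.idxOf_getElem l hl

theorem rep_places {T : Filling} (k : ℕ) :
    Rep T.domain T.barredBoxes.length T.barredVal T (T.places k) := by
  refine ⟨fun i j h => ?_, fun i j h => ?_, fun e h => ⟨h.1, h.2.1⟩⟩
  · obtain ⟨⟨s, b⟩, hx⟩ := Option.isSome_iff_exists.1 (toGrid_mem_domain.1 h)
    cases b with
    | false => rw [places_of_plain (c := (i, j)) hx, decode_plainKey, hx]
    | true =>
      obtain ⟨l, hl, e⟩ := exists_barredBox (c := (i, j)) hx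
      rw [← e, places_barredBox hl, decode_keyAt hl, ← entry_barredBox hl, e]
  · rw [toGrid_mem_domain] at h; simpa using h

theorem _root_.GridSlide.mono_of_adjacent {D : Set (ℤ × ℤ)} {f : ℤ × ℤ → ℤ}
    (conv : ∀ i j i' j' k l, (i, j) ∈ D → (i', j') ∈ D → i ≤ k → k ≤ i' → j ≤ l → l ≤ j' → (k, l) ∈ D)
    (hrow : ∀ i j, (i, j) ∈ D → (i, j + 1) ∈ D → f (i, j) ≤ f (i, j + 1))
    (hcol : ∀ i j, (i, j) ∈ D → (i + 1, j) ∈ D → f (i, j) < f (i + 1, j)) :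
    ∀ i j i' j', (i, j) ∈ D → (i', j') ∈ D → i ≤ i' → j ≤ j' →
      f (i, j) ≤ f (i', j') ∧ (i < i' → f (i, j) < f (i', j')) := by
  have hr : ∀ (n : ℕ) i j, (i, j) ∈ D → (i, j + n) ∈ D → f (i, j) ≤ f (i, j + n) := by
    intro n i j h
    induction n with
    | zero => simp
    | succ n ih =>
      intro h'
      push_cast at h' ⊢
      have hm : (i, j + (n : ℤ)) ∈ D := conv _ _ _ _ _ _ h h' le_rfl le_rfl (by omega) (by omega)
      refine (ih hm).trans ?_
      rw [← add_assoc] at h' ⊢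
      exact hrow _ _ hm h'
  have hc : ∀ (n : ℕ) i j, (i, j) ∈ D → (i + n, j) ∈ D →
      f (i, j) ≤ f (i + n, j) ∧ (0 < n → f (i, j) < f (i + n, j)) := by
    intro n i j h
    induction n with
    | zero => simp
    | succ n ih =>
      intro h'
      push_cast at h' ⊢
      have hm : (i + (n : ℤ), j) ∈ D := conv _ _ _ _ _ _ h h' (by omega) (by omega) le_rfl le_rfl
      rw [← add_assoc] at h' ⊢
      have h1 := (ih hm).1
      have h2 := hcol _ _ hm h'
      exact ⟨by omega, fun _ => by omega⟩
  intro i j i' j' h h' hi hj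
  have hm : (i, j') ∈ D := conv _ _ _ _ _ _ h h' le_rfl hi hj le_rfl
  obtain ⟨n, hn⟩ := Int.le.dest hi
  obtain ⟨n', hn'⟩ := Int.le.dest hj
  subst hn hn'
  have h1 := hr n' i j h hm
  have h2 := hc n i _ hm h'
  exact ⟨by omega, fun h3 => by have := h2.2 (by omega); omega⟩

theorem keyAt_lt_keyAt {d k l l' : ℕ} {v : ℕ → ℕ} (hv : Monotone v) (hl : l' < d) (h : l < l') :
    keyAt d v k l < keyAt d v k l' := by
  unfold keyAt
  split_ifs
  · exact lowKey_lt_lowKey h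
  · exact lowKey_lt_highKey (h.trans hl)
  · omega
  · exact highKey_lt_highKey hv h

theorem keyAt_lt_keyAt_iff {d k l l' : ℕ} {v : ℕ → ℕ} (hv : Monotone v) (hl : l < d) (hl' : l' < d) :
    keyAt d v k l < keyAt d v k l' ↔ l < l' := by
  refine ⟨fun h => ?_, keyAt_lt_keyAt hv hl'⟩
  by_contra h1
  rcases (not_lt.1 h1).eq_or_lt with rfl | h2
  · omega
  · have := keyAt_lt_keyAt (k := k) hv hl h2; omega

theorem lt_of_boxLT {T : Filling} {l l' : ℕ} (hl : l < T.barredBoxes.length)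
    (h : T.BoxLT (T.barredBox l) (T.barredBox l')) : l < l' := by
  by_contra hc
  rcases (not_lt.1 hc).eq_or_lt with rfl | h2
  · exact irrefl_of T.BoxLT _ h
  · have := boxLT_barredBox h2 hl
    unfold BoxLT at h this; omega

/-- With `k` the number of barred letters all keys are low and the order is the small bar order;
with `k = 0` all are high and it is the natural order. Equal barred letters are separated by their
labels, which increase downwards. -/
theorem places_lt {T : Filling} {lt : Letter → Letter → Prop} {k : ℕ}
    (hk : (k = T.barredBoxes.length ∧ lt = SmallBarLT) ∨ (k = 0 ∧ lt = NaturalLT))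
    {c c' : ℕ × ℕ} {x y : Letter} (hx : T.entry c.1 c.2 = some x) (hy : T.entry c'.1 c'.2 = some y)
    (h : lt x y ∨ (x = y ∧ x.bar = true ∧ c.1 < c'.1)) :
    T.places k (toGrid c) < T.places k (toGrid c') := by
  obtain ⟨s, b⟩ := x
  obtain ⟨t, b'⟩ := y
  cases b with
  | false =>
    rw [places_of_plain hx]
    simp only [Bool.false_eq_true, false_and, and_false, or_false] at h
    cases b' with
    | false =>
      rw [places_of_plain hy, plainKey_lt_plainKey]
      rcases hk with ⟨-, rfl⟩ | ⟨-, rfl⟩ <;> simpa [SmallBarLT, NaturalLT] using h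
    | true =>
      obtain ⟨l, hl, rfl⟩ := exists_barredBox hy
      rw [places_barredBox hl]
      rcases hk with ⟨-, rfl⟩ | ⟨rfl, rfl⟩
      · simp [SmallBarLT] at h
      · rw [keyAt, if_neg (by omega), plainKey_lt_highKey hl]
        rw [entry_barredBox hl] at hy
        simp only [Option.some.injEq, Letter.mk.injEq, and_true] at hy
        simpa [NaturalLT, hy] using h
  | true =>
    obtain ⟨l, hl, rfl⟩ := exists_barredBox hx
    rw [places_barredBox hl]
    cases b' with
    | false =>
      rw [places_of_plain hy]
      rcases hk with ⟨rfl, rfl⟩ | ⟨rfl, rfl⟩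
      · rw [keyAt, if_pos hl]; exact lowKey_lt_plainKey hl
      · rw [keyAt, if_neg (by omega), highKey_lt_plainKey hl]
        rw [entry_barredBox hl] at hx
        simp only [Option.some.injEq, Letter.mk.injEq, and_true] at hx
        simp only [NaturalLT, Letter.mk.injEq, Bool.true_eq_false, and_false, false_and, or_false,
          and_true] at h
        omega
    | true =>
      obtain ⟨l', hl', rfl⟩ := exists_barredBox hy
      rw [places_barredBox hl']
      apply keyAt_lt_keyAt T.barredVal_mono hl'
      apply lt_of_boxLT hl
      unfold BoxLT
      rw [valAt_of_entry hx, valAt_of_entry hy]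
      rcases hk with ⟨-, rfl⟩ | ⟨-, rfl⟩ <;>
      · simp only [SmallBarLT, NaturalLT, Letter.mk.injEq, and_true, Bool.true_eq_false, and_false,
          false_or, true_and, or_false] at h
        simp only
        omega

theorem IsSemistandard.state {T : Filling} {lt : Letter → Letter → Prop} {k : ℕ}
    (hT : T.IsSemistandard lt)
    (hk : (k = T.barredBoxes.length ∧ lt = SmallBarLT) ∨ (k = 0 ∧ lt = NaturalLT)) :
    State T.domain T.barredBoxes.length T.barredVal k T.barredBox (T.places k) := by
  obtain ⟨hs, hrow, hcol⟩ := hT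
  refine ⟨domain_conv hs, mono_of_adjacent (domain_conv hs) ?_ ?_, ?_, ?_, ?_⟩
  · intro i j h h'
    obtain ⟨c, hc, x, hx⟩ := exists_of_mem_domain h
    obtain ⟨c', hc', y, hy⟩ := exists_of_mem_domain h'
    have e : c' = (c.1, c.2 + 1) := by
      simp only [toGrid, Prod.mk.injEq] at hc hc'
      ext <;> simp <;> omega
    rw [hc, hc']
    rw [e] at hy
    rcases hrow _ _ x y hx hy with h1 | ⟨h1, h2⟩
    · subst e; exact (places_lt hk hx hy (Or.inl h1)).le
    · subst e h1
      obtain ⟨s, b⟩ := x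
      simp only at h2; subst h2
      rw [places_of_plain hx, places_of_plain (c := (c.1, c.2 + 1)) hy]
  · intro i j h h'
    obtain ⟨c, hc, x, hx⟩ := exists_of_mem_domain h
    obtain ⟨c', hc', y, hy⟩ := exists_of_mem_domain h'
    have e : c' = (c.1 + 1, c.2) := by
      simp only [toGrid, Prod.mk.injEq] at hc hc'
      ext <;> simp <;> omega
    rw [hc, hc']
    rw [e] at hy
    subst e
    refine places_lt hk hx hy ?_
    rcases hcol _ _ x y hx hy with h1 | ⟨h1, h2⟩
    · exact Or.inl h1
    · exact Or.inr ⟨h1, h2, by simp⟩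
  · intro l hl
    rw [toGrid_mem_domain, entry_barredBox hl]; rfl
  · intro l hl; exact places_barredBox hl
  · intro e he
    obtain ⟨c, rfl, ⟨s, b⟩, hx⟩ := exists_of_mem_domain he
    cases b with
    | false => exact Or.inl ⟨s, places_of_plain hx⟩
    | true =>
      obtain ⟨l, hl, rfl⟩ := exists_barredBox hx
      exact Or.inr ⟨l, hl, rfl⟩

/-- The listing order leaves only the possibility that two equal barred letters share a row. This is
excluded by monotonicity of the keys, because the letter next to the first of them is already
strictly larger. -/
theorem row_lt_of_semistandard {T : Filling} {lt : Letter → Letter → Prop} {k : ℕ}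
    (hT : T.IsSemistandard lt)
    (hk : (k = T.barredBoxes.length ∧ lt = SmallBarLT) ∨ (k = 0 ∧ lt = NaturalLT)) :
    RowsOrdered T.barredBoxes.length T.barredVal 0 T.barredBoxes.length T.barredBox := by
  intro l _ _ hl hvl
  have S := hT.state hk
  have h1 := boxLT_barredBox (show l < l + 1 by omega) hl
  unfold BoxLT at h1
  change T.barredVal l < T.barredVal (l + 1) ∨ (T.barredVal l = T.barredVal (l + 1) ∧ _) at h1
  simp only [hvl, lt_irrefl, false_or, true_and] at h1
  rcases h1 with h1 | ⟨h1, h2⟩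
  · exact h1
  exfalso
  have e1 := entry_barredBox (T := T) (l := l) (by omega)
  have e2 := entry_barredBox hl
  have h3 := hT.1.isSome_of_le (i' := (T.barredBox l).1) (j' := (T.barredBox l).2 + 1)
    (by rw [e2]; rfl) h1.le (by omega)
  obtain ⟨y, hy⟩ := Option.isSome_iff_exists.1 h3
  have h4 := hT.2.1 _ _ _ y e1 hy
  have m1 := S.mem l (by omega)
  have m2 := S.mem (l + 1) hl
  have hlt : T.places k (toGrid (T.barredBox l)) <
      T.places k (toGrid ((T.barredBox l).1, (T.barredBox l).2 + 1)) := by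
    refine places_lt hk e1 hy ?_
    rcases h4 with h4 | ⟨_, h4⟩
    · exact Or.inl h4
    · simp at h4
  have hle : T.places k (toGrid ((T.barredBox l).1, (T.barredBox l).2 + 1)) ≤
      T.places k (toGrid (T.barredBox (l + 1))) :=
    (S.mono _ _ _ _ (toGrid_mem_domain.2 h3) m2 (by simp; omega) (by simp; omega)).1
  -- The letter next to the first box is strictly larger than the equal letter further right.
  rcases Nat.lt_or_ge ((T.barredBox l).2 + 1) (T.barredBox (l + 1)).2 with h5 | h5
  · obtain ⟨t, b⟩ := y
    cases b with
    | false =>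
      rw [places_of_plain (c := ((T.barredBox l).1, (T.barredBox l).2 + 1)) hy,
        places_barredBox hl] at hle
      rw [places_of_plain (c := ((T.barredBox l).1, (T.barredBox l).2 + 1)) hy,
        places_barredBox (by omega)] at hlt
      rcases hk with ⟨rfl, rfl⟩ | ⟨rfl, rfl⟩
      · rw [keyAt, if_pos hl] at hle
        have := lowKey_lt_plainKey (s := t) hl; omega
      · rw [keyAt, if_neg (by omega), ] at hle hlt
        have h6 := (highKey_lt_plainKey (by omega)).1 hlt
        have h7 : plainKey T.barredBoxes.length t < highKey T.barredBoxes.length T.barredVal (l + 1) := by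
          refine lt_of_le_of_ne hle fun h8 => ?_
          have h9 := decode_plainKey (d := T.barredBoxes.length) (v := T.barredVal) t
          rw [h8, decode_highKey hl] at h9; simp at h9
        rw [plainKey_lt_highKey hl] at h7
        omega
    | true =>
      obtain ⟨l', hl', e⟩ := exists_barredBox (c := ((T.barredBox l).1, (T.barredBox l).2 + 1)) hy
      rw [← e, places_barredBox hl', places_barredBox hl] at hle
      rw [← e, places_barredBox hl', places_barredBox (by omega)] at hlt
      rw [keyAt_lt_keyAt_iff T.barredVal_mono (by omega) hl'] at hlt
      rcases hle.eq_or_lt with h6 | h6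
      · have := keyAt_injOn T.barredVal_mono hl' hl h6
        subst this
        rw [e] at h5; simp at h5
      · rw [keyAt_lt_keyAt_iff T.barredVal_mono hl' hl] at h6; omega
  · have e3 : T.barredBox (l + 1) = ((T.barredBox l).1, (T.barredBox l).2 + 1) := by
      ext <;> simp <;> omega
    rw [e3] at e2
    simp only at e2
    rw [hy, Option.some.injEq] at e2
    subst e2
    rcases hk with ⟨-, rfl⟩ | ⟨-, rfl⟩ <;> simp [SmallBarLT, NaturalLT, hvl] at h4

theorem _root_.GridSlide.RowsOrdered.row_lt {d : ℕ} {v : ℕ → ℕ} (hv : Monotone v) {p : ℕ → ℕ × ℕ}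
    (h : RowsOrdered d v 0 d p) {l l' : ℕ} (hl : l < l') (hl' : l' < d) (he : v l = v l') :
    (p l).1 < (p l').1 := by
  induction l', hl using Nat.le_induction with
  | base => exact h l (by omega) hl' hl' he
  | succ n hn ih =>
    have h1 : v l ≤ v n := hv (by omega)
    have h2 : v n ≤ v (n + 1) := hv (by omega)
    have := ih (by omega) (by omega)
    have := h n (by omega) hl' hl' (by omega)
    omega

/-- Monotonicity of the keys gives the order relations between letters. For equal barred letters it
only gives increasing labels, and the ordering of rows turns this into a lower row, so they never
share a row. -/
theorem _root_.GridSlide.State.semistandard {T : Filling} {lt : Letter → Letter → Prop} {k d : ℕ}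
    {v : ℕ → ℕ} {D : Set (ℤ × ℤ)} {p : ℕ → ℕ × ℕ} {f : ℤ × ℤ → ℤ} (hv : Monotone v)
    (S : State D d v k p f) (R : Rep D d v T f) (hshape : T.HasPartitionShape)
    (ho : RowsOrdered d v 0 d p) (hk : (k = d ∧ lt = SmallBarLT) ∨ (k = 0 ∧ lt = NaturalLT)) :
    T.IsSemistandard lt := by
  have key : ∀ c c' : ℕ × ℕ, ∀ x y, T.entry c.1 c.2 = some x → T.entry c'.1 c'.2 = some y →
      f (toGrid c) ≤ f (toGrid c') → c ≠ c' →
      lt x y ∨ (x = y ∧ ((x.bar = false ∧ f (toGrid c) = f (toGrid c')) ∨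
        x.bar = true ∧ c.1 < c'.1)) := by
    intro c c' x y hx hy hle hne
    have m := R.mem_of_some hx
    have m' := R.mem_of_some hy
    have ex := R.some _ _ m
    have ey := R.some _ _ m'
    rw [hx, Option.some.injEq] at ex
    rw [hy, Option.some.injEq] at ey
    simp only [Prod.mk.eta] at m m' ex ey
    rcases S.other _ m with ⟨s, hs⟩ | ⟨l, hl, e⟩ <;> rcases S.other _ m' with ⟨t, ht⟩ | ⟨l', hl', e'⟩
    · rw [hs, decode_plainKey] at ex
      rw [ht, decode_plainKey] at ey
      rw [hs, ht, plainKey_le_plainKey] at hle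
      subst ex ey
      rcases hle.eq_or_lt with rfl | h
      · exact Or.inr ⟨rfl, Or.inl ⟨rfl, by rw [hs, ht]⟩⟩
      · left; rcases hk with ⟨-, rfl⟩ | ⟨-, rfl⟩ <;> simp [SmallBarLT, NaturalLT, h]
    · rw [hs, decode_plainKey] at ex
      rw [e', S.apply_pos l' hl', decode_keyAt hl'] at ey
      rw [hs, e', S.apply_pos l' hl'] at hle
      subst ex ey
      rcases hk with ⟨rfl, rfl⟩ | ⟨rfl, rfl⟩
      · rw [keyAt, if_pos hl'] at hle
        have := lowKey_lt_plainKey (s := s) hl'; omega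
      · rw [keyAt, if_neg (by omega)] at hle
        left; left
        rw [← plainKey_lt_highKey hl']
        refine lt_of_le_of_ne hle fun h8 => ?_
        have h9 := decode_plainKey (d := d) (v := v) s
        rw [h8, decode_highKey hl'] at h9; simp at h9
    · rw [ht, decode_plainKey] at ey
      rw [e, S.apply_pos l hl, decode_keyAt hl] at ex
      rw [ht, e, S.apply_pos l hl] at hle
      subst ex ey
      rcases hk with ⟨rfl, rfl⟩ | ⟨rfl, rfl⟩
      · left; left; exact ⟨rfl, rfl⟩
      · rw [keyAt, if_neg (by omega)] at hle
        left
        have h7 : highKey d v l < plainKey d t := by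
          refine lt_of_le_of_ne hle fun h8 => ?_
          have h9 := decode_plainKey (d := d) (v := v) t
          rw [← h8, decode_highKey hl] at h9; simp at h9
        rw [highKey_lt_plainKey hl] at h7
        simp only [NaturalLT, and_self, and_true]
        omega
    · rw [e, S.apply_pos l hl, decode_keyAt hl] at ex
      rw [e', S.apply_pos l' hl', decode_keyAt hl'] at ey
      rw [e, e', S.apply_pos l hl, S.apply_pos l' hl'] at hle
      rw [toGrid_inj] at e e'
      have hll : l < l' := by
        rcases hle.eq_or_lt with h | h
        · exact (hne (by rw [e, e', keyAt_injOn hv hl hl' h])).elim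
        · rwa [keyAt_lt_keyAt_iff hv hl hl'] at h
      subst ex ey
      rcases (hv hll.le).eq_or_lt with h | h
      · right
        refine ⟨by rw [h], Or.inr ⟨rfl, ?_⟩⟩
        rw [e, e']
        exact ho.row_lt hv hll hl' h
      · left; rcases hk with ⟨-, rfl⟩ | ⟨-, rfl⟩ <;> simp [SmallBarLT, NaturalLT, h]
  refine ⟨hshape, fun i j x y hx hy => ?_, fun i j x y hx hy => ?_⟩
  · have := (S.mono _ _ _ _ (R.mem_of_some hx) (R.mem_of_some hy) le_rfl (by simp)).1
    rcases key (i, j) (i, j + 1) x y hx hy this (by simp) with h | ⟨h, h' | h'⟩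
    · exact Or.inl h
    · exact Or.inr ⟨h, h'.1⟩
    · simp at h'
  · have := (S.mono _ _ _ _ (R.mem_of_some hx) (R.mem_of_some hy) (by simp) le_rfl).2 (by simp)
    rcases key (i, j) (i + 1, j) x y hx hy this.le (by simp) with h | ⟨h, h' | h'⟩
    · exact Or.inl h
    · rw [← toGrid, ← toGrid] at this; omega
    · exact Or.inr ⟨h, h'.1⟩

/-- Since equal letters have kept their vertical order, scanning the converted filling lists the
letters in the order of the original labels. So the reverse conversion undoes the slides one after
the other. -/
theorem _root_.GridSlide.State.barredBoxes {T : Filling} {k d : ℕ}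
    {v : ℕ → ℕ} {D : Set (ℤ × ℤ)} {p : ℕ → ℕ × ℕ} {f : ℤ × ℤ → ℤ} (hv : Monotone v)
    (S : State D d v k p f) (R : Rep D d v T f) (ho : RowsOrdered d v 0 d p) :
    T.barredBoxes = (List.range d).map p := by
  have hp : ∀ l < d, T.entry (p l).1 (p l).2 = some ⟨v l, true⟩ := by
    intro l hl
    rw [R.some _ _ (S.mem l hl)]
    simp only [Prod.mk.eta]
    rw [S.apply_pos l hl, decode_keyAt hl]
  apply (pairwise_barredBoxes T).eq_of_mem_iff
  · rw [List.pairwise_map]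
    have := (List.pairwise_lt_range (n := d))
    rw [List.pairwise_iff_forall_sublist] at this ⊢
    intro l l' hs
    have hlt := this hs
    have hl : l' < d := by
      have := hs.subset (show l' ∈ [l, l'] by simp)
      simpa using this
    unfold BoxLT
    rw [valAt_of_entry (hp l (by omega)), valAt_of_entry (hp l' hl)]
    rcases (hv hlt.le).eq_or_lt with h | h
    · exact Or.inr ⟨h, Or.inl (ho.row_lt hv hlt hl h)⟩
    · exact Or.inl h
  · intro c
    rw [mem_barredBoxes, List.mem_map]
    constructor
    · rintro ⟨s, hs⟩
      have m := R.mem_of_some hs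
      have e := R.some _ _ m
      simp only [Prod.mk.eta] at m e
      rcases S.other _ m with ⟨t, ht⟩ | ⟨l, hl, hl'⟩
      · rw [hs, ht, decode_plainKey] at e; simp at e
      · exact ⟨l, by simpa using hl, (toGrid_inj.1 hl').symm⟩
    · rintro ⟨l, hl, rfl⟩
      exact ⟨_, hp l (by simpa using hl)⟩

/-- Conversion of a tableau for the small bar order gives a tableau for the natural order, and is
undone by the reverse conversion. -/
theorem IsSemistandard.toNatural {T : Filling} (hT : T.IsSemistandard SmallBarLT) :
    T.toNatural.IsSemistandard NaturalLT ∧ T.toNatural.toSmallBar = T := by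
  have hk : (T.barredBoxes.length = T.barredBoxes.length ∧ SmallBarLT = SmallBarLT) ∨
    (T.barredBoxes.length = 0 ∧ SmallBarLT = NaturalLT) := Or.inl ⟨rfl, rfl⟩
  obtain ⟨p, g, S, R, -, ho, hback, -⟩ := (hT.state hk).toNatural_aux T.barredVal_mono (rep_places _)
    (domain_bound hT.1) (row_lt_of_semistandard hT hk) T.barredBoxes.length le_rfl
  rw [Nat.sub_self, ← List.range_eq_range', map_barredBox] at R hback
  rw [Nat.sub_self] at S ho
  change Rep _ _ _ T.toNatural g at R
  have hshape : T.toNatural.HasPartitionShape :=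
    (hasPartitionShape_congr (map_length_foldl_slide _ _ _ _)).2 hT.1
  refine ⟨S.semistandard T.barredVal_mono R hshape ho (Or.inr ⟨rfl, rfl⟩), ?_⟩
  unfold Filling.toSmallBar
  rw [S.barredBoxes T.barredVal_mono R ho, show T.toNatural.size = T.size from
    size_foldl_slide _ _ _ _]
  exact hback

/-- Conversion of a tableau for the natural order gives a tableau for the small bar order, and is
undone by the reverse conversion. -/
theorem IsSemistandard.toSmallBar {T : Filling} (hT : T.IsSemistandard NaturalLT) :
    T.toSmallBar.IsSemistandard SmallBarLT ∧ T.toSmallBar.toNatural = T := by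
  have hk : (0 = T.barredBoxes.length ∧ NaturalLT = SmallBarLT) ∨
    (0 = 0 ∧ NaturalLT = NaturalLT) := Or.inr ⟨rfl, rfl⟩
  obtain ⟨p, g, S, R, -, ho, hback, -⟩ := (hT.state hk).toSmallBar_aux T.barredVal_mono
    (rep_places _) (domain_bound hT.1) (row_lt_of_semistandard hT hk) T.barredBoxes.length le_rfl
  rw [map_barredBox] at R hback
  change Rep _ _ _ T.toSmallBar g at R
  have hshape : T.toSmallBar.HasPartitionShape :=
    (hasPartitionShape_congr (map_length_foldl_slide _ _ _ _)).2 hT.1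
  refine ⟨S.semistandard T.barredVal_mono R hshape ho (Or.inl ⟨rfl, rfl⟩), ?_⟩
  unfold Filling.toNatural
  rw [S.barredBoxes T.barredVal_mono R ho, show T.toSmallBar.size = T.size from
    size_foldl_slide _ _ _ _]
  exact hback

end Filling

namespace Filling

/-! ### Counting letters -/

theorem HasPartitionShape.length_le_width {T : Filling} (hT : T.HasPartitionShape) {i : ℕ}
    {row : List Letter} (h : T[i]? = some row) : row.length ≤ T.width := by
  obtain ⟨hi, rfl⟩ := List.getElem?_eq_some_iff.1 h
  unfold width
  rw [List.getD_eq_getElem _ _ (by omega)]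
  rcases Nat.eq_zero_or_pos i with rfl | h0
  · rfl
  · have := List.pairwise_iff_getElem.1 hT.2 0 i (by simp; omega) (by simpa using hi) h0
    simpa using this

theorem entry_eq_getElem?_getD (T : Filling) (i j : ℕ) : T.entry i j = (T.getD i [])[j]? := by
  unfold entry
  rw [List.getD_eq_getElem?_getD]
  cases T[i]? <;> simp

theorem _root_.List.countP_eq_card {α : Type*} (p : α → Bool) (l : List α) {n : ℕ} (h : l.length ≤ n) :
    l.countP p = ((Finset.range n).filter fun j => l[j]?.any p = true).card := by
  induction l generalizing n with
  | nil => simp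
  | cons a l ih =>
    obtain ⟨n, rfl⟩ : ∃ k, n = k + 1 := ⟨n - 1, by simp at h; omega⟩
    rw [List.countP_cons, ih (n := n) (by simpa using h), Finset.card_filter, Finset.card_filter,
      Finset.sum_range_succ']
    simp

theorem countP_row_eq_card {T : Filling} (hT : T.HasPartitionShape) (p : Letter → Bool) (i : ℕ) :
    (T.getD i []).countP p =
      ((Finset.range T.width).filter fun j => (T.entry i j).any p = true).card := by
  have h : (T.getD i []).length ≤ T.width := by
    rw [List.getD_eq_getElem?_getD]
    cases h : T[i]? with
    | none => simp
    | some row => exact hT.length_le_width h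
  rw [List.countP_eq_card p _ h]
  simp only [entry_eq_getElem?_getD]

theorem countP_take_flatten (T : Filling) (p : Letter → Bool) (n : ℕ) :
    (T.take n).flatten.countP p = ∑ i ∈ Finset.range n, (T.getD i []).countP p := by
  induction n with
  | zero => simp
  | succ n ih =>
    rw [Finset.sum_range_succ, ← ih, List.take_add_one, List.flatten_append, List.countP_append,
      List.getD_eq_getElem?_getD]
    cases T[n]? <;> simp

theorem countP_flatten (T : Filling) (p : Letter → Bool) {n : ℕ} (hn : T.length ≤ n) :
    T.flatten.countP p = ∑ i ∈ Finset.range n, (T.getD i []).countP p := by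
  rw [← countP_take_flatten, List.take_of_length_le hn]

theorem countP_flatten_eq_card {T : Filling} (hT : T.HasPartitionShape) (p : Letter → Bool) {n : ℕ}
    (hn : T.length ≤ n) : T.flatten.countP p =
      ((Finset.range n ×ˢ Finset.range T.width).filter
        fun c => (T.entry c.1 c.2).any p = true).card := by
  rw [countP_flatten T p hn, Finset.card_filter, Finset.sum_product]
  refine Finset.sum_congr rfl fun i _ => ?_
  rw [countP_row_eq_card hT, Finset.card_filter]

theorem length_barredBoxes {T : Filling} (hT : T.HasPartitionShape) :
    T.barredBoxes.length = T.totalColor := by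
  unfold totalColor
  rw [countP_flatten_eq_card hT _ le_rfl, ← List.toFinset_card_of_nodup T.nodup_barredBoxes]
  congr 1
  ext ⟨i, j⟩
  rw [List.mem_toFinset, mem_barredBoxes, Finset.mem_filter, Finset.mem_product, Finset.mem_range,
    Finset.mem_range]
  constructor
  · rintro ⟨s, hs⟩
    obtain ⟨row, h1, h2⟩ := entry_eq_some_iff.1 hs
    have h3 := hT.length_le_width h1
    have h4 := (List.getElem?_eq_some_iff.1 h1).1
    have h5 := (List.getElem?_eq_some_iff.1 h2).1
    exact ⟨⟨h4, by omega⟩, by rw [hs]; rfl⟩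
  · rintro ⟨-, h⟩
    rw [Option.any_eq_true] at h
    obtain ⟨⟨s, b⟩, h1, h2⟩ := h
    simp only at h2; subst h2
    exact ⟨s, h1⟩

/-- The number of unbarred letters `s` in the first `i` rows. -/
def cum (T : Filling) (i s : ℕ) : ℕ := (T.take i).flatten.count ⟨s, false⟩

/-- The number of unbarred letters `s` in row `i`. -/
def rowCount (T : Filling) (i s : ℕ) : ℕ := (T.getD i []).count ⟨s, false⟩

theorem cum_zero (T : Filling) (s : ℕ) : T.cum 0 s = 0 := by simp [cum]

theorem cum_eq_sum (T : Filling) (i s : ℕ) : T.cum i s = ∑ i' ∈ Finset.range i, T.rowCount i' s :=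
  countP_take_flatten T _ i

theorem cum_succ (T : Filling) (i s : ℕ) : T.cum (i + 1) s = T.cum i s + T.rowCount i s := by
  rw [cum_eq_sum, Finset.sum_range_succ, ← cum_eq_sum]

theorem cum_mono (T : Filling) (s : ℕ) : Monotone fun i => T.cum i s :=
  monotone_nat_of_le_succ fun i => by simp only [cum_succ]; omega

theorem cum_of_length_le {T : Filling} {i : ℕ} (h : T.length ≤ i) (s : ℕ) :
    T.cum i s = T.flatten.count ⟨s, false⟩ := by
  rw [cum, List.take_of_length_le h]

theorem cum_le (T : Filling) (i s : ℕ) : T.cum i s ≤ T.flatten.count ⟨s, false⟩ := by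
  rw [← cum_of_length_le (le_max_left T.length i)]
  exact T.cum_mono s (le_max_right _ _)

/-- The unbarred letters of a skew tableau form a Littlewood–Richardson filling: the letters `s + 1`
of the first `i + 1` rows are at most as many as the letters `s` of the first `i` rows. -/
def IsLR (T : Filling) : Prop := ∀ s, 1 ≤ s → ∀ i, T.cum (i + 1) (s + 1) ≤ T.cum i s

/-- The rows of barred letters are intervals ending with the letter `N`. -/
def BarsEndWith (N : ℕ) (T : Filling) : Prop :=
  ∀ i j s, T.entry i j = some ⟨s, true⟩ → s < N → T.entry i (j + 1) = some ⟨s + 1, true⟩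

theorem IsLR.cum_eq_zero {T : Filling} (h : T.IsLR) {i s : ℕ} (his : i < s) (hs : 1 < s) :
    T.cum i s = 0 := by
  induction i generalizing s with
  | zero => exact cum_zero T s
  | succ i ih =>
    obtain ⟨t, rfl⟩ : ∃ t, s = t + 1 := ⟨s - 1, by omega⟩
    have h1 := h t (by omega) i
    rcases Nat.lt_or_ge 1 t with h2 | h2
    · have := ih (s := t) (by omega) h2; omega
    · obtain rfl : i = 0 := by omega
      rw [cum_zero] at h1; omega

/-! ### The reading word -/

/-- The unbarred letters of a row, from right to left. -/
def rowWord (T : Filling) (i : ℕ) : List ℕ :=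
  (((T.getD i []).filter fun x => !x.bar).map Letter.val).reverse

theorem count_rowWord (T : Filling) (i s : ℕ) : (T.rowWord i).count s = T.rowCount i s := by
  unfold rowWord rowCount
  rw [List.count_reverse, List.count, List.countP_map, List.countP_filter, List.count]
  congr 1
  funext ⟨a, b⟩
  rw [Bool.eq_iff_iff]
  cases b <;> simp

theorem count_flatMap_rowWord (T : Filling) (i s : ℕ) :
    ((List.range i).flatMap T.rowWord).count s = T.cum i s := by
  induction i with
  | zero => simp [cum_zero]
  | succ i ih =>
    rw [List.range_succ, List.flatMap_append, List.count_append, ih, cum_succ, List.flatMap_singleton,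
      count_rowWord]

theorem _root_.List.filterMap_range_getElem? {α β : Type*} (g : α → Option β) (l : List α) {n : ℕ}
    (h : l.length ≤ n) : (List.range n).filterMap (fun j => l[j]?.bind g) = l.filterMap g := by
  induction l generalizing n with
  | nil => simp
  | cons a l ih =>
    obtain ⟨n, rfl⟩ : ∃ k, n = k + 1 := ⟨n - 1, by simp at h; omega⟩
    rw [List.range_succ_eq_map, List.filterMap_cons, List.filterMap_map, List.filterMap_cons]
    have := ih (n := n) (by simpa using h)
    simp only [List.getElem?_cons_zero, Option.bind_some, Function.comp_def, List.getElem?_cons_succ,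
      this]

/-- The boxes of the transposed subtableau of barred letters in reading order. -/
def columnBoxes (h w : ℕ) : List (ℕ × ℕ) :=
  (List.range w).flatMap fun c => (List.range h).reverse.map fun j => (j, c)

/-- The number of the barred letter in a box. -/
def barAt (T : Filling) (c : ℕ × ℕ) : Option ℕ :=
  ((T.entry c.1 c.2).filter fun x => x.bar).map Letter.val

theorem barAt_eq_some {T : Filling} {c : ℕ × ℕ} {s : ℕ} :
    T.barAt c = some s ↔ T.entry c.1 c.2 = some ⟨s, true⟩ := by
  unfold barAt
  rcases T.entry c.1 c.2 with _ | ⟨a, b⟩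
  · simp
  · cases b <;> simp

/-- The upper part is shifted by `barredLength` empty columns. The lower part is scanned further
than the barred letters extend; the additional boxes contribute nothing. Its rows are columns of the
tableau, read upwards. -/
theorem reverseReadingWord_eq {T : Filling} (hT : T.HasPartitionShape) :
    T.reverseReadingWord = (List.range T.length).flatMap T.rowWord ++
      (columnBoxes (T.barredLength + T.width) T.width).filterMap T.barAt := by
  unfold reverseReadingWord
  rw [List.range_add (n := T.length), List.flatMap_append]
  congr 1
  · apply List.flatMap_congr
    intro i hi
    rw [List.mem_range] at hi
    unfold unfolded
    simp only [hi, if_true]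
    rw [List.filterMap_reverse, List.range_add, List.filterMap_append, rowWord]
    congr 1
    rw [List.filterMap_eq_nil_iff.2, List.nil_append, List.filterMap_map]
    · have e : ((fun x => if T.barredLength ≤ x then
          Option.map Letter.val (Option.filter (fun x => !x.bar) (T.entry i (x - T.barredLength)))
          else none) ∘ fun x => T.barredLength + x) =
          fun j => (T.getD i [])[j]?.bind fun x => if x.bar then none else some x.val := by
        funext j
        simp only [Function.comp_apply, Nat.le_add_right, if_true, Nat.add_sub_cancel_left,
          entry_eq_getElem?_getD]
        rcases (T.getD i [])[j]? with _ | ⟨a, b⟩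
        · rfl
        · cases b <;> rfl
      rw [e, List.filterMap_range_getElem?]
      · rw [← List.filterMap_eq_map, List.filterMap_filter]
        congr 1
        funext ⟨a, b⟩
        cases b <;> rfl
      · rw [List.getD_eq_getElem _ _ hi]
        exact hT.length_le_width (List.getElem?_eq_getElem hi)
    · intro j hj
      rw [List.mem_range] at hj
      simp only [not_le.2 hj, if_false]
  · rw [columnBoxes, List.filterMap_flatMap, List.flatMap_map]
    apply List.flatMap_congr
    intro c hc
    rw [List.filterMap_map]
    congr 1
    funext j
    simp [unfolded, barAt]

end Filling

namespace Filling

/-! ### Yamanouchi tableaux -/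

theorem IsSemistandard.row_rel {lt : Letter → Letter → Prop} (htr : ∀ a b c, lt a b → lt b c → lt a c)
    {T : Filling} (hT : T.IsSemistandard lt) {i j j' : ℕ} (h : j < j') {x y : Letter}
    (hx : T.entry i j = some x) (hy : T.entry i j' = some y) : lt x y ∨ (x = y ∧ x.bar = false) := by
  induction j', h using Nat.le_induction generalizing y with
  | base => exact hT.2.1 _ _ _ _ hx hy
  | succ n hn ih =>
    obtain ⟨z, hz⟩ := Option.isSome_iff_exists.1
      (hT.1.isSome_of_le (by rw [hy]; rfl) le_rfl (Nat.le_succ n))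
    rcases ih hz with h1 | ⟨rfl, h1⟩ <;> rcases hT.2.1 _ _ _ _ hz hy with h2 | ⟨rfl, h2⟩
    · exact Or.inl (htr _ _ _ h1 h2)
    · exact Or.inl h1
    · exact Or.inl h2
    · exact Or.inr ⟨rfl, h1⟩

theorem IsSemistandard.col_rel {lt : Letter → Letter → Prop} (htr : ∀ a b c, lt a b → lt b c → lt a c)
    {T : Filling} (hT : T.IsSemistandard lt) {i i' j : ℕ} (h : i < i') {x y : Letter}
    (hx : T.entry i j = some x) (hy : T.entry i' j = some y) : lt x y ∨ (x = y ∧ x.bar = true) := by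
  induction i', h using Nat.le_induction generalizing y with
  | base => exact hT.2.2 _ _ _ _ hx hy
  | succ n hn ih =>
    obtain ⟨z, hz⟩ := Option.isSome_iff_exists.1
      (hT.1.isSome_of_le (by rw [hy]; rfl) (Nat.le_succ n) le_rfl)
    rcases ih hz with h1 | ⟨rfl, h1⟩ <;> rcases hT.2.2 _ _ _ _ hz hy with h2 | ⟨rfl, h2⟩
    · exact Or.inl (htr _ _ _ h1 h2)
    · exact Or.inl h1
    · exact Or.inl h2
    · exact Or.inr ⟨rfl, h1⟩

theorem _root_.SmallBarLT.trans (a b c : Letter) (h : SmallBarLT a b) (h' : SmallBarLT b c) :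
    SmallBarLT a c := by
  obtain ⟨s, b1⟩ := a
  obtain ⟨t, b2⟩ := b
  obtain ⟨u, b3⟩ := c
  cases b1 <;> cases b2 <;> cases b3 <;> simp [SmallBarLT] at h h' ⊢ <;> omega

theorem IsSemistandard.bar_of_le {T : Filling} (hT : T.IsSemistandard SmallBarLT) {i j i' j' s : ℕ}
    (h : T.entry i j = some ⟨s, true⟩) (hi : i' ≤ i) (hj : j' ≤ j) :
    ∃ t, T.entry i' j' = some ⟨t, true⟩ := by
  have key : ∀ x : Letter, ∀ s, SmallBarLT x ⟨s, true⟩ → ∃ t, x = ⟨t, true⟩ := by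
    rintro ⟨t, b⟩ s h
    cases b <;> simp [SmallBarLT] at h ⊢
  have h1 : ∃ t, T.entry i j' = some ⟨t, true⟩ := by
    rcases hj.eq_or_lt with rfl | hj
    · exact ⟨s, h⟩
    · obtain ⟨x, hx⟩ := Option.isSome_iff_exists.1
        (hT.1.isSome_of_le (by rw [h]; rfl) le_rfl hj.le)
      rcases hT.row_rel SmallBarLT.trans hj hx h with h1 | ⟨rfl, h1⟩
      · obtain ⟨t, rfl⟩ := key _ _ h1; exact ⟨t, hx⟩
      · simp at h1
  obtain ⟨t, h1⟩ := h1
  rcases hi.eq_or_lt with rfl | hi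
  · exact ⟨t, h1⟩
  · obtain ⟨x, hx⟩ := Option.isSome_iff_exists.1
      (hT.1.isSome_of_le (by rw [h1]; rfl) hi.le le_rfl)
    rcases hT.col_rel SmallBarLT.trans hi hx h1 with h2 | ⟨rfl, h2⟩
    · obtain ⟨t, rfl⟩ := key _ _ h2; exact ⟨t, hx⟩
    · exact ⟨t, hx⟩

theorem _root_.List.countP_eq_of_prefix {α : Type*} (p : α → Bool) (l : List α)
    (h : l.Pairwise fun a b => p b = true → p a = true) (i : ℕ) (hi : i < l.length) :
    p l[i] = true ↔ i < l.countP p := by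
  induction l generalizing i with
  | nil => simp at hi
  | cons a l ih =>
    rw [List.pairwise_cons] at h
    rw [List.countP_cons]
    by_cases ha : p a = true
    · rw [if_pos ha]
      cases i with
      | zero => simpa using ha
      | succ i => simpa using ih h.2 i (by simpa using hi)
    · have h0 : l.countP p = 0 := List.countP_eq_zero.2 fun b hb hpb => ha (h.1 b hb hpb)
      rw [if_neg ha, h0]
      cases i with
      | zero => simpa using ha
      | succ i =>
        simp only [List.getElem_cons_succ, add_zero, Nat.not_lt_zero, iff_false]
        exact fun hpb => ha (h.1 _ (List.getElem_mem _) hpb)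

theorem IsSemistandard.lt_barredLength_iff {T : Filling} (hT : T.IsSemistandard SmallBarLT) {i : ℕ} :
    i < T.barredLength ↔ ∃ s, T.entry i 0 = some ⟨s, true⟩ := by
  have key : ∀ i (hi : i < T.length), T[i].any Letter.bar = true ↔
      ∃ s, T.entry i 0 = some ⟨s, true⟩ := by
    intro i hi
    rw [List.any_eq_true]
    constructor
    · rintro ⟨⟨s, b⟩, hx, hb⟩
      simp only at hb; subst hb
      obtain ⟨j, hj, hx⟩ := List.getElem_of_mem hx
      exact hT.bar_of_le (i := i) (j := j) (s := s)
        (entry_eq_some_iff.2 ⟨T[i], List.getElem?_eq_getElem hi, by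
          rw [← hx]; exact List.getElem?_eq_getElem hj⟩) le_rfl (Nat.zero_le j)
    · rintro ⟨s, hs⟩
      obtain ⟨row, h1, h2⟩ := entry_eq_some_iff.1 hs
      rw [List.getElem?_eq_getElem hi, Option.some.injEq] at h1
      subst h1
      exact ⟨_, List.mem_of_getElem? h2, rfl⟩
  have hp : T.Pairwise fun a b => b.any Letter.bar = true → a.any Letter.bar = true := by
    rw [List.pairwise_iff_getElem]
    intro i j hi hj hij h
    rw [key] at h ⊢
    obtain ⟨s, h⟩ := h
    exact hT.bar_of_le h hij.le le_rfl
  unfold barredLength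
  constructor
  · intro h
    have hi : i < T.length := h.trans_le List.countP_le_length
    rw [← key i hi]
    exact (List.countP_eq_of_prefix (fun row => row.any Letter.bar) T hp i hi).2 h
  · rintro ⟨s, hs⟩
    obtain ⟨row, h1, h2⟩ := entry_eq_some_iff.1 hs
    have hi := (List.getElem?_eq_some_iff.1 h1).1
    exact (List.countP_eq_of_prefix (fun row => row.any Letter.bar) T hp i hi).1
      ((key i hi).2 ⟨s, hs⟩)

theorem IsSemistandard.lt_barredLength {T : Filling} (hT : T.IsSemistandard SmallBarLT) {i j s : ℕ}
    (h : T.entry i j = some ⟨s, true⟩) : i < T.barredLength :=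
  hT.lt_barredLength_iff.2 (hT.bar_of_le h le_rfl (Nat.zero_le j))

theorem mem_columnBoxes {h w : ℕ} {c : ℕ × ℕ} : c ∈ columnBoxes h w ↔ c.1 < h ∧ c.2 < w := by
  obtain ⟨j, c⟩ := c
  simp only [columnBoxes, List.mem_flatMap, List.mem_map, List.mem_reverse, List.mem_range,
    Prod.mk.injEq]
  constructor
  · rintro ⟨c', h1, j', h2, rfl, rfl⟩; exact ⟨h2, h1⟩
  · rintro ⟨h1, h2⟩; exact ⟨c, h2, j, h1, rfl, rfl⟩

theorem pairwise_columnBoxes (h w : ℕ) :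
    (columnBoxes h w).Pairwise fun a b => a.2 < b.2 ∨ (a.2 = b.2 ∧ b.1 < a.1) := by
  unfold columnBoxes
  rw [List.pairwise_flatMap]
  constructor
  · intro c _
    rw [List.pairwise_map, List.pairwise_reverse]
    exact List.pairwise_lt_range.imp fun h => Or.inr ⟨rfl, h⟩
  · refine List.pairwise_lt_range.imp ?_
    intro c c' hc x hx y hy
    rw [List.mem_map] at hx hy
    obtain ⟨_, _, rfl⟩ := hx
    obtain ⟨_, _, rfl⟩ := hy
    exact Or.inl hc

theorem nodup_columnBoxes (h w : ℕ) : (columnBoxes h w).Nodup :=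
  (pairwise_columnBoxes h w).imp fun hab e => by subst e; omega

theorem count_filterMap_barAt (T : Filling) {L : List (ℕ × ℕ)} (hL : L.Nodup) (s : ℕ) :
    (L.filterMap T.barAt).count s =
      (L.toFinset.filter fun c => T.entry c.1 c.2 = some ⟨s, true⟩).card := by
  induction L with
  | nil => simp
  | cons a L ih =>
    rw [List.nodup_cons] at hL
    rw [List.toFinset_cons, Finset.filter_insert]
    by_cases h : T.entry a.1 a.2 = some ⟨s, true⟩
    · rw [if_pos h, Finset.card_insert_of_notMem (by simp [hL.1]), ← ih hL.2,
        List.filterMap_cons_some (barAt_eq_some.2 h), List.count_cons_self]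
    · rw [if_neg h, ← ih hL.2]
      cases hb : T.barAt a with
      | none => rw [List.filterMap_cons_none hb]
      | some t =>
        rw [List.filterMap_cons_some hb, List.count_cons_of_ne]
        rintro rfl
        exact h (barAt_eq_some.1 hb)

theorem HasPartitionShape.lt_of_entry {T : Filling} (hT : T.HasPartitionShape) {i j : ℕ} {x : Letter}
    (h : T.entry i j = some x) : i < T.length ∧ j < T.width := by
  obtain ⟨row, h1, h2⟩ := entry_eq_some_iff.1 h
  have h3 := hT.length_le_width h1
  have h4 := (List.getElem?_eq_some_iff.1 h1).1
  have h5 := (List.getElem?_eq_some_iff.1 h2).1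
  exact ⟨h4, by omega⟩

/-- The boxes in which the barred letters are read. -/
def barBoxes (T : Filling) : List (ℕ × ℕ) := columnBoxes (T.barredLength + T.width) T.width

theorem IsSemistandard.mem_barBoxes {T : Filling} (hT : T.IsSemistandard SmallBarLT) {i j s : ℕ}
    (h : T.entry i j = some ⟨s, true⟩) : (i, j) ∈ T.barBoxes := by
  rw [barBoxes, mem_columnBoxes]
  exact ⟨by have := hT.lt_barredLength h; simp only; omega, (hT.1.lt_of_entry h).2⟩

theorem IsSemistandard.count_barBoxes {T : Filling} (hT : T.IsSemistandard SmallBarLT) (s : ℕ) :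
    (T.barBoxes.filterMap T.barAt).count s = T.flatten.count ⟨s, true⟩ := by
  rw [count_filterMap_barAt T (L := T.barBoxes) (nodup_columnBoxes _ _), List.count,
    countP_flatten_eq_card hT.1 _ le_rfl]
  congr 1
  ext ⟨i, j⟩
  rw [Finset.mem_filter, Finset.mem_filter, Finset.mem_product, Finset.mem_range, Finset.mem_range,
    List.mem_toFinset]
  simp only [Option.any_eq_true, beq_iff_eq, exists_eq_right]
  constructor
  · rintro ⟨-, h⟩; exact ⟨hT.1.lt_of_entry h, h⟩
  · rintro ⟨-, h⟩; exact ⟨hT.mem_barBoxes h, h⟩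

theorem _root_.List.countP_val (l : List Letter) (s : ℕ) :
    l.countP (fun x => x.val = s) = l.count ⟨s, false⟩ + l.count ⟨s, true⟩ := by
  induction l with
  | nil => simp
  | cons a l ih =>
    obtain ⟨t, b⟩ := a
    rw [List.countP_cons, List.count_cons, List.count_cons, ih]
    by_cases h : t = s <;> cases b <;> simp [h] <;> omega

theorem IsSemistandard.count_word {T : Filling} (hT : T.IsSemistandard SmallBarLT) (s : ℕ) :
    T.reverseReadingWord.count s = T.flatten.countP (fun x => x.val = s) := by
  rw [reverseReadingWord_eq hT.1, List.count_append, count_flatMap_rowWord,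
    cum_of_length_le le_rfl, ← barBoxes, hT.count_barBoxes, List.countP_val]

theorem IsSemistandard.pairwise_row {lt : Letter → Letter → Prop}
    (htr : ∀ a b c, lt a b → lt b c → lt a c) {T : Filling} (hT : T.IsSemistandard lt) (i : ℕ) :
    (T.getD i []).Pairwise fun x y => lt x y ∨ (x = y ∧ x.bar = false) := by
  rw [List.pairwise_iff_getElem]
  intro j j' hj hj' hlt
  exact hT.row_rel htr (i := i) hlt
    (by rw [entry_eq_getElem?_getD]; exact List.getElem?_eq_getElem hj)
    (by rw [entry_eq_getElem?_getD]; exact List.getElem?_eq_getElem hj')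

theorem IsSemistandard.pairwise_rowWord {T : Filling} (hT : T.IsSemistandard SmallBarLT) (i : ℕ) :
    (T.rowWord i).Pairwise (· ≥ ·) := by
  unfold rowWord
  rw [List.pairwise_reverse, List.pairwise_map, List.pairwise_filter]
  refine (hT.pairwise_row SmallBarLT.trans i).imp ?_
  rintro ⟨s, b⟩ ⟨t, b'⟩ h hb hb'
  cases b <;> cases b' <;> simp [SmallBarLT] at h hb hb' ⊢; omega

theorem _root_.List.count_takeWhile_lt {D : List ℕ} (hD : D.Pairwise (· ≥ ·)) (s : ℕ) :
    (D.takeWhile (s < ·)).count (s + 1) = D.count (s + 1) ∧ (D.takeWhile (s < ·)).count s = 0 := by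
  induction D with
  | nil => simp
  | cons a D ih =>
    rw [List.pairwise_cons] at hD
    by_cases h : s < a
    · rw [List.takeWhile_cons_of_pos (by simpa using h), List.count_cons, List.count_cons,
        List.count_cons, (ih hD.2).1, (ih hD.2).2]
      simp; omega
    · rw [List.takeWhile_cons_of_neg (by simpa using h)]
      refine ⟨?_, by simp⟩
      rw [List.count_nil, eq_comm, List.count_eq_zero]
      intro hm
      rcases List.mem_cons.1 hm with h1 | h1
      · omega
      · have := hD.1 _ h1; omega

/-- Rows are read from right to left, hence decreasingly. Cutting row `i` after its letters greater
than `s` gives an initial factor containing all letters `s + 1` of this row and none of its letters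
`s`. -/
theorem IsSemistandard.isLR_of_lattice {T : Filling} (hT : T.IsSemistandard SmallBarLT)
    (h : IsLatticePermutation T.reverseReadingWord) : T.IsLR := by
  intro s hs i
  rw [reverseReadingWord_eq hT.1] at h
  rcases Nat.lt_or_ge i T.length with hi | hi
  · have hp : (List.range i).flatMap T.rowWord ++ (T.rowWord i).takeWhile (s < ·) <+:
        (List.range T.length).flatMap T.rowWord ++
          (columnBoxes (T.barredLength + T.width) T.width).filterMap T.barAt := by
      refine List.IsPrefix.trans ?_ (List.prefix_append _ _)
      obtain ⟨n, hn⟩ : ∃ n, T.length = i + (n + 1) := ⟨T.length - i - 1, by omega⟩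
      rw [hn, List.range_add, List.flatMap_append, List.prefix_append_right_inj,
        List.range_succ_eq_map, List.map_cons, List.flatMap_cons, add_zero]
      exact (List.takeWhile_prefix _).trans (List.prefix_append _ _)
    have := h _ hp s hs
    have h2 := List.count_takeWhile_lt (hT.pairwise_rowWord i) s
    rw [List.count_append, List.count_append, h2.1, h2.2, count_flatMap_rowWord,
      count_flatMap_rowWord, count_rowWord] at this
    rw [cum_succ]; omega
  · have := h _ (List.prefix_append _ _) s hs
    rw [count_flatMap_rowWord, count_flatMap_rowWord] at this
    rw [cum_of_length_le (by omega), cum_of_length_le hi, ← cum_of_length_le le_rfl,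
      ← cum_of_length_le le_rfl]
    exact this

theorem mem_of_append_columnBoxes {h w : ℕ} {L₁ L₂ : List (ℕ × ℕ)} (e : columnBoxes h w = L₁ ++ L₂)
    {a b : ℕ × ℕ} (ha : a ∈ L₂) (hb : b ∈ columnBoxes h w)
    (hab : a.2 < b.2 ∨ (a.2 = b.2 ∧ b.1 ≤ a.1)) : b ∈ L₂ := by
  rw [e, List.mem_append] at hb
  rcases hb with hb | hb
  · have := pairwise_columnBoxes h w
    rw [e, List.pairwise_append] at this
    have := this.2.2 b hb a ha
    exfalso; omega
  · exact hb

/-- Initial factors of the reading word that contain all unbarred letters satisfy the lattice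
condition if and only if the complementary final factors satisfy the reverse condition. -/
theorem IsSemistandard.count_prefix {T : Filling} (hT : T.IsSemistandard SmallBarLT) {m N : ℕ}
    (hc : T.HasRectContent m N) {L₁ L₂ : List (ℕ × ℕ)} (e : T.barBoxes = L₁ ++ L₂) {s : ℕ}
    (hs : 1 ≤ s) (hsN : s < N) :
    ((List.range T.length).flatMap T.rowWord ++ L₁.filterMap T.barAt).count (s + 1) ≤
      ((List.range T.length).flatMap T.rowWord ++ L₁.filterMap T.barAt).count s ↔
    (L₂.toFinset.filter fun c => T.entry c.1 c.2 = some ⟨s, true⟩).card ≤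
      (L₂.toFinset.filter fun c => T.entry c.1 c.2 = some ⟨s + 1, true⟩).card := by
  have h1 := hT.count_word s
  have h2 := hT.count_word (s + 1)
  rw [hc, reverseReadingWord_eq hT.1, ← barBoxes, e, List.filterMap_append, ← List.append_assoc,
    List.count_append] at h1 h2
  rw [if_pos (by omega)] at h1 h2
  have h0 : T.barBoxes.Nodup := nodup_columnBoxes _ _
  rw [e] at h0
  have hn : L₂.Nodup := (List.nodup_append.1 h0).2.1
  rw [← count_filterMap_barAt _ hn, ← count_filterMap_barAt _ hn]
  omega

/-- Induction on the letter `s`. If `s̄` is not followed by the next letter, consider the final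
factor beginning with this `s̄`, in which `s + 1` must be at least as frequent as `s`. Some other
row then contains `s + 1` but no `s` there, and the letter to the left of that `s + 1` contradicts
the induction hypothesis. -/
theorem IsSemistandard.barsEndWith_of_lattice {T : Filling} (hT : T.IsSemistandard SmallBarLT)
    {m N : ℕ} (hc : T.HasRectContent m N) (h : IsLatticePermutation T.reverseReadingWord) :
    T.BarsEndWith N := by
  have val_pos : ∀ {i j s}, T.entry i j = some ⟨s, true⟩ → 1 ≤ s := by
    intro i j s hx
    by_contra hs
    have h0 := hc s
    rw [if_neg (by omega), List.countP_eq_zero] at h0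
    exact h0 _ (entry_mem_flatten hx) (by simp)
  suffices H : ∀ s i j, T.entry i j = some ⟨s, true⟩ → s < N →
      T.entry i (j + 1) = some ⟨s + 1, true⟩ from fun i j s => H s i j
  intro s
  induction s using Nat.strong_induction_on with
  | _ s ih =>
  intro i j hij hs
  by_contra hcon
  obtain ⟨L₁, L₂, e⟩ := List.append_of_mem (hT.mem_barBoxes hij)
  have hlat := h ((List.range T.length).flatMap T.rowWord ++ L₁.filterMap T.barAt) (by
    rw [reverseReadingWord_eq hT.1, ← barBoxes, e, List.filterMap_append,
      ← List.append_assoc]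
    exact List.prefix_append _ _) s (val_pos hij)
  rw [hT.count_prefix hc e (val_pos hij) hs] at hlat
  have hL₂ : ∀ b ∈ (i, j) :: L₂, j < b.2 ∨ (j = b.2 ∧ b.1 ≤ i) := by
    intro b hb
    rcases List.mem_cons.1 hb with rfl | hb
    · exact Or.inr ⟨rfl, le_rfl⟩
    · have := pairwise_columnBoxes (T.barredLength + T.width) T.width
      rw [← barBoxes, e, List.pairwise_append, List.pairwise_cons] at this
      have := this.2.1.1 b hb
      simp only at this; omega
  have row_unique : ∀ {a c c' t}, T.entry a c = some ⟨t, true⟩ → T.entry a c' = some ⟨t, true⟩ →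
      c = c' := by
    intro a c c' t h1 h2
    rcases lt_trichotomy c c' with h3 | h3 | h3
    · have := hT.row_rel SmallBarLT.trans h3 h1 h2; simp [SmallBarLT] at this
    · exact h3
    · have := hT.row_rel SmallBarLT.trans h3 h2 h1; simp [SmallBarLT] at this
  set A := ((i, j) :: L₂).toFinset.filter fun c => T.entry c.1 c.2 = some ⟨s, true⟩ with hA
  set B := ((i, j) :: L₂).toFinset.filter fun c => T.entry c.1 c.2 = some ⟨s + 1, true⟩ with hB
  have cardA : (A.image Prod.fst).card = A.card := by
    apply Finset.card_image_of_injOn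
    rintro ⟨a, c⟩ h1 ⟨a', c'⟩ h2 h3
    simp only [hA, Finset.coe_filter, Set.mem_ofPred_eq] at h1 h2 h3
    subst h3; rw [row_unique h1.2 h2.2]
  have cardB : (B.image Prod.fst).card = B.card := by
    apply Finset.card_image_of_injOn
    rintro ⟨a, c⟩ h1 ⟨a', c'⟩ h2 h3
    simp only [hB, Finset.coe_filter, Set.mem_ofPred_eq] at h1 h2 h3
    subst h3; rw [row_unique h1.2 h2.2]
  have hiA : i ∈ A.image Prod.fst := Finset.mem_image.2 ⟨(i, j), by simp [hA, hij], rfl⟩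
  -- In row `i` the letter `s + 1` could only stand immediately to the right of `s`, because barred
  -- letters increase strictly along rows.
  have hiB : i ∉ B.image Prod.fst := by
    intro hi
    obtain ⟨⟨a, c⟩, h1, rfl⟩ := Finset.mem_image.1 hi
    rw [hB, Finset.mem_filter, List.mem_toFinset] at h1
    obtain ⟨h1, h2⟩ := h1
    have h3 := hL₂ _ h1
    simp only at h2 h3 hij hcon
    have h4 : j < c := by
      rcases h3 with h3 | ⟨rfl, -⟩
      · exact h3
      · rw [hij] at h2; simp at h2
    obtain ⟨t, ht⟩ := hT.bar_of_le (i' := a) (j' := j + 1) h2 le_rfl h4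
    have h5 := hT.2.1 _ _ _ _ hij ht
    have h6 : t ≤ s + 1 := by
      rcases (show j + 1 ≤ c from h4).eq_or_lt with h7 | h7
      · rw [h7, h2] at ht; simp at ht; omega
      · have := hT.row_rel SmallBarLT.trans h7 ht h2; simp [SmallBarLT] at this; omega
    simp [SmallBarLT] at h5
    obtain rfl : t = s + 1 := by omega
    exact hcon ht
  -- A letter occurs at most once per row among the barred letters, so the frequencies count rows.
  -- `B` has at least as many rows as `A` and misses the row `i` of `A`.
  obtain ⟨i', hi'B, hi'A⟩ : ∃ i' ∈ B.image Prod.fst, i' ∉ A.image Prod.fst := by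
    by_contra hno
    push Not at hno
    have hss : B.image Prod.fst ⊆ (A.image Prod.fst).erase i := fun x hx =>
      Finset.mem_erase.2 ⟨fun e => hiB (e ▸ hx), hno x hx⟩
    have := Finset.card_le_card hss
    rw [Finset.card_erase_of_mem hiA, cardA, cardB] at this
    have : 0 < A.card := by rw [← cardA]; exact Finset.card_pos.2 ⟨i, hiA⟩
    omega
  obtain ⟨⟨a, c⟩, h1, rfl⟩ := Finset.mem_image.1 hi'B
  rw [hB, Finset.mem_filter, List.mem_toFinset] at h1
  obtain ⟨h1, h2⟩ := h1
  have h3 := hL₂ _ h1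
  simp only at h2 h3 hi'A
  have col_le : ∀ {a a' c t t'}, a < a' → T.entry a c = some ⟨t, true⟩ →
      T.entry a' c = some ⟨t', true⟩ → t ≤ t' := by
    intro a a' c t t' h4 h5 h6
    have := hT.col_rel SmallBarLT.trans h4 h5 h6
    simp [SmallBarLT] at this; omega
  have row_lt : ∀ {a c c' t t'}, c < c' → T.entry a c = some ⟨t, true⟩ →
      T.entry a c' = some ⟨t', true⟩ → t < t' := by
    intro a c c' t t' h4 h5 h6
    have := hT.row_rel SmallBarLT.trans h4 h5 h6
    simpa [SmallBarLT] using this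
  have h4 : j < c := by
    rcases h3 with h3 | ⟨rfl, h3⟩
    · exact h3
    · rcases h3.eq_or_lt with rfl | h3
      · rw [hij] at h2; simp at h2
      · have := col_le h3 h2 hij; omega
  -- Below row `i`, the letter in `(i, j + 1)` would be squeezed between `s` and `s + 1`, so it
  -- would be the missing `s + 1`.
  have h5 : a < i := by
    by_contra h5
    rcases (not_lt.1 h5).eq_or_lt with rfl | h5
    · exact hiB hi'B
    · obtain ⟨t, ht⟩ := hT.bar_of_le (i' := i) (j' := j + 1) h2 h5.le h4
      obtain ⟨t', ht'⟩ := hT.bar_of_le (i' := i) (j' := c) h2 h5.le le_rfl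
      have h6 := row_lt (Nat.lt_succ_self j) hij ht
      have h7 := col_le h5 ht' h2
      have h8 : t ≤ t' := by
        rcases (show j + 1 ≤ c from h4).eq_or_lt with h9 | h9
        · rw [h9, ht'] at ht; simp at ht; omega
        · exact (row_lt h9 ht ht').le
      obtain rfl : t = s + 1 := by omega
      exact hcon ht
  obtain ⟨c, rfl⟩ : ∃ c', c = c' + 1 := ⟨c - 1, by omega⟩
  obtain ⟨t, ht⟩ := hT.bar_of_le (i' := a) (j' := c) h2 le_rfl (Nat.le_succ c)
  have h6 := row_lt (Nat.lt_succ_self c) ht h2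
  -- A letter `s` in this box would still belong to the final factor: its column is at least `j` and
  -- its row lies above row `i`.
  have h7 : t ≠ s := by
    rintro rfl
    apply hi'A
    refine Finset.mem_image.2 ⟨(a, c), ?_, rfl⟩
    rw [hA, Finset.mem_filter, List.mem_toFinset]
    refine ⟨?_, ht⟩
    refine mem_of_append_columnBoxes (by rw [← barBoxes]; exact e) (List.mem_cons_self)
      (hT.mem_barBoxes ht) ?_
    simp only; omega
  -- Now `t < s`, and the induction hypothesis makes the next letter `t + 1`, although it is `s +
  -- 1`.
  have h8 := ih t (by omega) a c ht (by omega)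
  rw [h2] at h8
  simp at h8; omega

theorem _root_.List.prefix_append_cases {α : Type*} {v a b : List α} (h : v <+: a ++ b) :
    v <+: a ∨ ∃ p, v = a ++ p ∧ p <+: b := by
  rcases List.prefix_or_prefix_of_prefix h (List.prefix_append a b) with h1 | ⟨p, rfl⟩
  · exact Or.inl h1
  · exact Or.inr ⟨p, rfl, (List.prefix_append_right_inj a).1 h⟩

theorem _root_.List.prefix_flatMap_range {α : Type*} (f : ℕ → List α) {n : ℕ} {v : List α}
    (h : v <+: (List.range n).flatMap f) :
    v = (List.range n).flatMap f ∨ ∃ i < n, ∃ p, p <+: f i ∧ v = (List.range i).flatMap f ++ p := by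
  induction n with
  | zero => left; simpa using h
  | succ n ih =>
    rw [List.range_succ, List.flatMap_append, List.flatMap_singleton] at h ⊢
    rcases List.prefix_append_cases h with h1 | ⟨p, h1, h2⟩
    · rcases ih h1 with h2 | ⟨i, hi, h2⟩
      · exact Or.inr ⟨n, by omega, [], List.nil_prefix, by simpa using h2⟩
      · exact Or.inr ⟨i, by omega, h2⟩
    · exact Or.inr ⟨n, by omega, p, h2, h1⟩

/-- Within the rows, the letters `s + 1` read from row `i` are already compensated by letters `s` of
earlier rows. For barred letters one passes to the complementary final factor, where each `s` has
its own `s + 1` to the right. -/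
theorem IsSemistandard.lattice {T : Filling} (hT : T.IsSemistandard SmallBarLT)
    {m N : ℕ} (hc : T.HasRectContent m N) (hLR : T.IsLR) (hb : T.BarsEndWith N) :
    IsLatticePermutation T.reverseReadingWord := by
  intro v hv s hs
  rw [reverseReadingWord_eq hT.1, ← barBoxes] at hv
  have rows : ∀ v, v <+: (List.range T.length).flatMap T.rowWord → v.count (s + 1) ≤ v.count s := by
    intro v hv
    rcases List.prefix_flatMap_range _ hv with rfl | ⟨i, hi, p, hp, rfl⟩
    · rw [count_flatMap_rowWord, count_flatMap_rowWord]
      exact (T.cum_mono (s + 1) (Nat.le_succ _)).trans (hLR s hs _)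
    · rw [List.count_append, List.count_append, count_flatMap_rowWord, count_flatMap_rowWord]
      have h1 := hLR s hs i
      rw [cum_succ, ← count_rowWord] at h1
      have := hp.sublist.count_le (s + 1)
      omega
  rcases List.prefix_append_cases hv with h1 | ⟨p, rfl, h2⟩
  · exact rows v h1
  · obtain ⟨q, hq⟩ := h2
    obtain ⟨L₁, L₂, e, h3, h4⟩ := List.filterMap_eq_append_iff.1 hq.symm
    rcases Nat.lt_or_ge s N with hsN | hsN
    · rw [← h3, hT.count_prefix hc e hs hsN]
      -- Columns are read from left to right, so a final factor is closed under passing to the box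
      -- on the right among the barred boxes.
      refine Finset.card_le_card_of_injOn (fun c => (c.1, c.2 + 1)) ?_ ?_
      · rintro ⟨i, j⟩ hij
        simp only [Finset.coe_filter, Set.mem_ofPred_eq, List.mem_toFinset] at hij ⊢
        have h5 := hb i j s hij.2 hsN
        refine ⟨mem_of_append_columnBoxes (by rw [← barBoxes]; exact e) hij.1 (hT.mem_barBoxes h5) ?_, h5⟩
        simp
      · rintro ⟨i, j⟩ _ ⟨i', j'⟩ _ h
        simpa using h
    -- For `s ≥ N` the letter `s + 1` does not occur at all.
    · have h5 := hT.count_word (s + 1)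
      rw [hc, if_neg (by omega), reverseReadingWord_eq hT.1, ← barBoxes, ← hq,
        ← List.append_assoc, List.count_append] at h5
      omega

theorem IsSemistandard.lattice_iff {T : Filling} (hT : T.IsSemistandard SmallBarLT)
    {m N : ℕ} (hc : T.HasRectContent m N) :
    IsLatticePermutation T.reverseReadingWord ↔ T.IsLR ∧ T.BarsEndWith N :=
  ⟨fun h => ⟨hT.isLR_of_lattice h, hT.barsEndWith_of_lattice hc h⟩,
    fun h => hT.lattice hc h.1 h.2⟩

end Filling

namespace Filling

/-! ### Consecutive rows of a Littlewood–Richardson filling -/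

theorem exists_rowCount_pos {T : Filling} {i j s : ℕ} (h : T.entry i j = some ⟨s, false⟩) :
    0 < T.rowCount i s := by
  rw [entry_eq_getElem?_getD] at h
  exact List.count_pos_iff.2 (List.mem_of_getElem? h)

theorem IsLR.le_of_entry {T : Filling} (h : T.IsLR) {i j s : ℕ}
    (hs : T.entry i j = some ⟨s, false⟩) : s ≤ i + 1 := by
  by_contra hc
  have h1 := h.cum_eq_zero (i := i + 1) (s := s) (by omega) (by omega)
  rw [cum_succ] at h1
  have := exists_rowCount_pos hs
  omega

theorem _root_.List.countP_not_bar (l : List Letter) {n : ℕ} (hn : ∀ x ∈ l, x.bar = false → x.val < n) :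
    l.countP (fun x => !x.bar) = ∑ s ∈ Finset.range n, l.count ⟨s, false⟩ := by
  induction l with
  | nil => simp
  | cons a l ih =>
    obtain ⟨t, b⟩ := a
    rw [List.countP_cons, ih fun x hx => hn x (by simp [hx])]
    simp only [List.count_cons, Finset.sum_add_distrib]
    congr 1
    cases b with
    | true => simp
    | false =>
      have := hn ⟨t, false⟩ (by simp) rfl
      simp only at this
      simp [this]

/-- The boxes of the letters `r` lie in different columns and below row `i`, so that row `i` has at
least as many unbarred letters. -/
theorem HasPartitionShape.count_le_countP_row {T : Filling} (hT : T.HasPartitionShape) {i r : ℕ}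
    (hrow : ∀ i' j, T.entry i' j = some ⟨r, false⟩ → ∃ s, T.entry i j = some ⟨s, false⟩)
    (hcol : ∀ i₁ i₂ j, T.entry i₁ j = some ⟨r, false⟩ → T.entry i₂ j = some ⟨r, false⟩ → i₁ = i₂) :
    T.flatten.count ⟨r, false⟩ ≤ (T.getD i []).countP fun x => !x.bar := by
  have key : ∀ (o : Option Letter), (o.any fun x => x == ⟨r, false⟩) = true ↔ o = some ⟨r, false⟩ := by
    intro o; cases o <;> simp
  rw [List.count, countP_flatten_eq_card hT _ le_rfl, countP_row_eq_card hT]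
  refine Finset.card_le_card_of_injOn Prod.snd ?_ ?_
  · rintro ⟨i', j⟩ h
    simp only [Finset.coe_filter, Finset.mem_product, Finset.mem_range, Set.mem_ofPred_eq, key] at h ⊢
    obtain ⟨s, hs⟩ := hrow i' j h.2
    exact ⟨h.1.2, by rw [hs]; rfl⟩
  · rintro ⟨i₁, j⟩ h₁ ⟨i₂, j₂⟩ h₂ (rfl : j = j₂)
    simp only [Finset.coe_filter, Finset.mem_product, Finset.mem_range, Set.mem_ofPred_eq, key] at h₁ h₂
    rw [hcol i₁ i₂ j h₁.2 h₂.2]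

/-- If row `i` of a Littlewood–Richardson filling has at least as many unbarred letters as the filling
has letters `1`, then all the conditions for row `i` are equalities. -/
theorem IsLR.cum_eq {T : Filling} (hLR : T.IsLR) (h0 : T.flatten.count ⟨0, false⟩ = 0) {i : ℕ}
    (hi : T.flatten.count ⟨1, false⟩ ≤ (T.getD i []).countP fun x => !x.bar) :
    (∀ s, 1 ≤ s → T.cum (i + 1) (s + 1) = T.cum i s) ∧
      T.cum (i + 1) 1 = T.flatten.count ⟨1, false⟩ ∧
      ((T.getD i []).countP fun x => !x.bar) = T.flatten.count ⟨1, false⟩ := by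
  -- Both sides count the unbarred letters of the first `i + 1` rows; the letters involved are at
  -- most `i + 1`, so a range of this length captures them. Comparing the row size with the number
  -- of letters `1` leaves no room for a strict inequality in the sum.
  have key : ∀ n, i + 1 ≤ n → ∑ s ∈ Finset.range n, T.cum (i + 1) (s + 1 + 1) + T.cum (i + 1) 1 =
      ∑ s ∈ Finset.range n, T.cum i (s + 1) + (T.getD i []).countP fun x => !x.bar := by
    intro n hn
    rw [List.countP_not_bar (n := n + 1)]
    · have e0 : (T.getD i []).count ⟨0, false⟩ = 0 := by
        have h1 := T.cum_le (i + 1) 0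
        rw [cum_succ] at h1
        unfold rowCount at h1; omega
      rw [Finset.sum_range_succ', e0]
      have e1 : ∑ s ∈ Finset.range n, T.cum (i + 1) (s + 1) =
          ∑ s ∈ Finset.range n, T.cum i (s + 1) +
            ∑ s ∈ Finset.range n, (T.getD i []).count ⟨s + 1, false⟩ := by
        rw [← Finset.sum_add_distrib]
        exact Finset.sum_congr rfl fun s _ => T.cum_succ i (s + 1)
      have e2 := Finset.sum_range_succ' (fun s => T.cum (i + 1) (s + 1)) n
      rw [Finset.sum_range_succ, hLR.cum_eq_zero (i := i + 1) (s := n + 1) (by omega) (by omega), zero_add] at e2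
      omega
    · rintro ⟨t, b⟩ hx rfl
      obtain ⟨j, hj⟩ := List.getElem?_of_mem hx
      rw [← entry_eq_getElem?_getD] at hj
      have := hLR.le_of_entry hj
      simp only; omega
  have hle : T.cum (i + 1) 1 ≤ T.flatten.count ⟨1, false⟩ := T.cum_le _ _
  have hsum : ∀ n, ∑ s ∈ Finset.range n, T.cum (i + 1) (s + 1 + 1) ≤
      ∑ s ∈ Finset.range n, T.cum i (s + 1) :=
    fun n => Finset.sum_le_sum fun s _ => hLR (s + 1) (by omega) i
  refine ⟨fun s hs => ?_, ?_, ?_⟩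
  · obtain ⟨t, rfl⟩ : ∃ t, s = t + 1 := ⟨s - 1, by omega⟩
    -- The range is extended so that it contains the index `t`. The sums agree and the terms are
    -- ordered, so all terms agree.
    have h1 := key (i + 1 + t + 1) (by omega)
    have h2 := hsum (i + 1 + t + 1)
    have h3 : ∑ s ∈ Finset.range (i + 1 + t + 1), T.cum (i + 1) (s + 1 + 1) =
      ∑ s ∈ Finset.range (i + 1 + t + 1), T.cum i (s + 1) := by omega
    exact (Finset.sum_eq_sum_iff_of_le fun s _ => hLR (s + 1) (by omega) i).1 h3 t (by simp)
  · have := key _ le_rfl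
    have := hsum (i + 1)
    omega
  · have := key _ le_rfl
    have := hsum (i + 1)
    omega

/-- The conditions under which row `i` contains one letter above each letter `r`. -/
theorem IsLR.cum_eq_of_columns {T : Filling} (hT : T.HasPartitionShape) (hLR : T.IsLR)
    (h0 : T.flatten.count ⟨0, false⟩ = 0) {m r : ℕ} (hr : 1 ≤ r)
    (hm : ∀ s, 1 ≤ s → s ≤ r → T.flatten.count ⟨s, false⟩ = m) {i : ℕ} (hi : i < r)
    (hrow : ∀ i' j, i ≤ i' → T.entry i' j = some ⟨r, false⟩ → ∃ s, T.entry i j = some ⟨s, false⟩)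
    (hcol : ∀ i₁ i₂ j, T.entry i₁ j = some ⟨r, false⟩ → T.entry i₂ j = some ⟨r, false⟩ → i₁ = i₂) :
    (∀ s, 1 ≤ s → T.cum (i + 1) (s + 1) = T.cum i s) ∧ T.cum (i + 1) 1 = m ∧
      ((T.getD i []).countP fun x => !x.bar) = m := by
  -- By the Littlewood–Richardson condition a letter `r` is not above row `r - 1`, counted from 0,
  -- so it is not above row `i`.
  have h1 := hT.count_le_countP_row (i := i) (r := r) (fun i' j h => hrow i' j (by
    have := hLR.le_of_entry h; omega) h) hcol
  rw [hm r hr le_rfl] at h1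
  have h2 := hLR.cum_eq h0 (i := i) (by rw [hm 1 le_rfl hr]; exact h1)
  rwa [hm 1 le_rfl hr] at h2

theorem raise_injective : Function.Injective raise := by
  rintro ⟨a, b⟩ ⟨a', b'⟩ h
  simpa [raise] using h

/-- Two consecutive rows without barred letters, for which the Littlewood–Richardson conditions are
equalities, differ by one. -/
theorem getD_succ_eq_map_raise {T : Filling} {i : ℕ}
    (hb : ∀ x ∈ T.getD i [], x.bar = false) (hb' : ∀ x ∈ T.getD (i + 1) [], x.bar = false)
    (hs : (T.getD i []).Pairwise fun x y => x.val ≤ y.val)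
    (hs' : (T.getD (i + 1) []).Pairwise fun x y => x.val ≤ y.val)
    (h0 : T.flatten.count ⟨0, false⟩ = 0)
    (h : ∀ s, 1 ≤ s → T.cum (i + 1) (s + 1) = T.cum i s)
    (h' : ∀ s, 1 ≤ s → T.cum (i + 1 + 1) (s + 1) = T.cum (i + 1) s)
    (h1 : T.cum (i + 1 + 1) 1 = T.cum (i + 1) 1) :
    T.getD (i + 1) [] = (T.getD i []).map raise := by
  refine List.Perm.eq_of_pairwise (le := fun x y => x.val ≤ y.val) ?_ hs' ?_ ?_
  · intro a b ha hb2 h1 h2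
    obtain ⟨x, hx, rfl⟩ := List.mem_map.1 hb2
    have e1 := hb' a ha
    have e2 := hb x hx
    ext
    · exact le_antisymm h1 h2
    · rw [e1, raise, e2]
  · exact List.pairwise_map.2 (hs.imp fun h => Nat.succ_le_succ h)
  · rw [List.perm_iff_count]
    have c0 : ∀ i, T.rowCount i 0 = 0 := by
      intro i
      have h1 := T.cum_le (i + 1) 0
      rw [cum_succ] at h1; omega
    rintro ⟨s, b⟩
    cases b with
    | true =>
      rw [List.count_eq_zero.2 fun hx => by simpa using hb' _ hx, eq_comm, List.count_eq_zero]
      intro hx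
      obtain ⟨x, hx, e⟩ := List.mem_map.1 hx
      have := hb x hx
      simp [raise] at e
      simp_all
    | false =>
      cases s with
      | zero =>
        rw [eq_comm, List.count_eq_zero.2]
        · exact (c0 _).symm
        · intro hx
          obtain ⟨x, hx, e⟩ := List.mem_map.1 hx
          simp [raise] at e
      | succ s =>
        rw [show (⟨s + 1, false⟩ : Letter) = raise ⟨s, false⟩ from rfl,
          List.count_map_of_injective _ _ raise_injective]
        change T.rowCount (i + 1) (s + 1) = T.rowCount i s
        cases s with
        | zero => rw [c0]; rw [cum_succ] at h1; simp only [zero_add]; omega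
        | succ s =>
          have a1 := h (s + 1) (by omega)
          have a2 := h' (s + 1) (by omega)
          rw [cum_succ, a1, cum_succ] at a2
          omega

end Filling

/-! ### Good tableaux and their rows directly below the barred letters. -/

namespace Filling

/-- The tableaux for the small bar order that correspond to the elements of `B m d w`. -/
structure IsGood (m d w : ℕ) (T : Filling) : Prop where
  sst : T.IsSemistandard SmallBarLT
  content : T.HasRectContent m (d + w)
  color : T.totalColor = d
  lr : T.IsLR
  bars : T.BarsEndWith (d + w)

namespace IsGood

variable {m d w : ℕ} {T : Filling}

theorem count_eq (hT : T.IsGood m d w) (s : ℕ) :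
    T.flatten.count ⟨s, false⟩ + T.flatten.count ⟨s, true⟩ = if 1 ≤ s ∧ s ≤ d + w then m else 0 := by
  rw [← List.countP_val, hT.content]

theorem val_of_entry (hT : T.IsGood m d w) {i j s : ℕ} {b : Bool} (h : T.entry i j = some ⟨s, b⟩) :
    1 ≤ s ∧ s ≤ d + w := by
  have h1 := hT.content s
  by_contra hc
  rw [if_neg hc, List.countP_eq_zero] at h1
  exact h1 _ (entry_mem_flatten h) (by simp)

theorem bars_add (hT : T.IsGood m d w) {i j s : ℕ} (h : T.entry i j = some ⟨s, true⟩) (k : ℕ)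
    (hk : s + k ≤ d + w) : T.entry i (j + k) = some ⟨s + k, true⟩ := by
  induction k with
  | zero => exact h
  | succ k ih => exact hT.bars _ _ (s + k) (ih (by omega)) (by omega)

/-- The barred letters are large. -/
theorem barredLength_add_le (hT : T.IsGood m d w) {i j s : ℕ} (h : T.entry i j = some ⟨s, true⟩) :
    T.barredLength + w ≤ s := by
  have hs := (hT.val_of_entry h).2
  have hi := hT.sst.lt_barredLength h
  -- The barred letters from `s` to the end `d + w` of its row are `d + w - s + 1` in number, and
  -- every other of the `barredLength` rows contributes one in its first column. Together these are
  -- at most `d` boxes, which gives the bound.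
  set A := (Finset.range (d + w - s + 1)).image fun k => (i, j + k) with hA
  set B := ((Finset.range T.barredLength).erase i).image fun k => (k, 0) with hB
  have hAB : Disjoint A B := by
    rw [Finset.disjoint_left]
    rintro c h1 h2
    obtain ⟨k, -, rfl⟩ := Finset.mem_image.1 h1
    obtain ⟨k', h3, h4⟩ := Finset.mem_image.1 h2
    exact (Finset.mem_erase.1 h3).1 (Prod.ext_iff.1 h4).1
  have hsub : A ∪ B ⊆ T.barredBoxes.toFinset := by
    intro c hc
    rw [List.mem_toFinset, mem_barredBoxes]
    rcases Finset.mem_union.1 hc with h1 | h1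
    · obtain ⟨k, hk, rfl⟩ := Finset.mem_image.1 h1
      rw [Finset.mem_range] at hk
      exact ⟨_, hT.bars_add h k (by omega)⟩
    · obtain ⟨k, hk, rfl⟩ := Finset.mem_image.1 h1
      exact hT.sst.lt_barredLength_iff.1 (Finset.mem_range.1 (Finset.mem_of_mem_erase hk))
  have hcard := Finset.card_le_card hsub
  rw [Finset.card_union_of_disjoint hAB, List.toFinset_card_of_nodup T.nodup_barredBoxes,
    length_barredBoxes hT.sst.1, hT.color, hA, hB, Finset.card_image_of_injective,
    Finset.card_image_of_injective, Finset.card_range, Finset.card_erase_of_mem (by simpa using hi),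
    Finset.card_range] at hcard
  · omega
  · intro a b h; simpa using h
  · intro a b h; simpa using h

theorem barredLength_le (hT : T.IsGood m d w) : T.barredLength ≤ d := by
  rcases Nat.eq_zero_or_pos T.barredLength with h | h
  · omega
  · obtain ⟨s, hs⟩ := hT.sst.lt_barredLength_iff.1 h
    have := hT.barredLength_add_le hs
    have := (hT.val_of_entry hs).2
    omega

theorem count_zero (hT : T.IsGood m d w) : T.flatten.count ⟨0, false⟩ = 0 := by
  have := hT.count_eq 0
  simp only [nonpos_iff_eq_zero, one_ne_zero, false_and, if_false] at this
  omega

theorem count_plain (hT : T.IsGood m d w) {s : ℕ} (hs : 1 ≤ s) (hs' : s < T.barredLength + w) :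
    T.flatten.count ⟨s, false⟩ = m := by
  have h1 := hT.count_eq s
  have := hT.barredLength_le
  rw [if_pos (by omega), List.count_eq_zero (a := (⟨s, true⟩ : Letter)).2, add_zero] at h1
  · exact h1
  · intro h
    obtain ⟨row, h2, h3⟩ := List.mem_flatten.1 h
    obtain ⟨i, hi⟩ := List.getElem?_of_mem h2
    obtain ⟨j, hj⟩ := List.getElem?_of_mem h3
    have := hT.barredLength_add_le (entry_eq_some_iff.2 ⟨row, hi, hj⟩)
    omega

theorem not_bar (hT : T.IsGood m d w) {i : ℕ} (hi : T.barredLength ≤ i) :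
    ∀ x ∈ T.getD i [], x.bar = false := by
  rintro ⟨s, b⟩ hx
  obtain ⟨j, hj⟩ := List.getElem?_of_mem hx
  rw [← entry_eq_getElem?_getD] at hj
  cases b with
  | false => rfl
  | true => have := hT.sst.lt_barredLength hj; omega

/-- The rows without barred letters above row `r = ℓ(η) + w - 1`. -/
theorem cum_eq (hT : T.IsGood m d w) {i : ℕ} (hi : T.barredLength ≤ i)
    (hi' : i + 1 < T.barredLength + w) :
    (∀ s, 1 ≤ s → T.cum (i + 1) (s + 1) = T.cum i s) ∧ T.cum (i + 1) 1 = m ∧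
      (T.getD i []).length = m := by
  -- The letter `r = ℓ(η) + w - 1` is the largest one that the preceding bound guarantees to be
  -- always unbarred.
  have h := hT.lr.cum_eq_of_columns hT.sst.1 hT.count_zero (m := m) (r := T.barredLength + w - 1)
    (by omega) (fun s h1 h2 => hT.count_plain h1 (by omega)) (i := i) (by omega) ?_ ?_
  · refine ⟨h.1, h.2.1, ?_⟩
    rw [← h.2.2, eq_comm, List.countP_eq_length]
    intro x hx
    simp [hT.not_bar hi x hx]
  · intro i' j hii h
    obtain ⟨⟨s, b⟩, hx⟩ := Option.isSome_iff_exists.1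
      (hT.sst.1.isSome_of_le (i' := i) (j' := j) (by rw [h]; rfl) hii le_rfl)
    cases b with
    | false => exact ⟨s, hx⟩
    | true => have := hT.sst.lt_barredLength hx; omega
  · intro i₁ i₂ j h₁ h₂
    have key : ∀ a b, a < b → T.entry a j = some ⟨T.barredLength + w - 1, false⟩ →
        T.entry b j = some ⟨T.barredLength + w - 1, false⟩ → False := by
      intro a b hab ha hb
      rcases hT.sst.col_rel SmallBarLT.trans hab ha hb with h | h <;> simp [SmallBarLT] at h
    rcases lt_trichotomy i₁ i₂ with h | h | h
    · exact (key _ _ h h₁ h₂).elim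
    · exact h
    · exact (key _ _ h h₂ h₁).elim

theorem pairwise_getD (hT : T.IsGood m d w) {i : ℕ} (hi : T.barredLength ≤ i) :
    (T.getD i []).Pairwise fun x y => x.val ≤ y.val := by
  refine (List.Pairwise.and_mem.1 (hT.sst.pairwise_row SmallBarLT.trans i)).imp ?_
  rintro ⟨s, b⟩ ⟨t, b'⟩ ⟨h1, h2, h⟩
  have e1 := hT.not_bar hi _ h1
  have e2 := hT.not_bar hi _ h2
  simp only at e1 e2
  subst e1 e2
  simp [SmallBarLT] at h
  simp only; omega

/-- With `w + 1` in place of `w` this identifies the row that the inverse of `phi` has to remove. -/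
theorem getD_succ (hT : T.IsGood m d w) {i : ℕ} (hi : T.barredLength ≤ i)
    (hi' : i + 2 < T.barredLength + w) : T.getD (i + 1) [] = (T.getD i []).map raise := by
  have h := hT.cum_eq hi (by omega)
  have h' := hT.cum_eq (i := i + 1) (by omega) (by omega)
  exact getD_succ_eq_map_raise (hT.not_bar hi) (hT.not_bar (by omega)) (hT.pairwise_getD hi)
    (hT.pairwise_getD (by omega)) hT.count_zero h.1 h'.1 (by rw [h.2.1, h'.2.1])

theorem lt_length (hT : T.IsGood m d w) (hm : 1 ≤ m) {i : ℕ} (hi' : i + 1 < T.barredLength + w)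
    (hw : 2 ≤ w) : i < T.length := by
  have h := (hT.cum_eq (i := T.barredLength + w - 2) (by omega) (by omega)).2.2
  by_contra hc
  rw [List.getD_eq_default _ _ (by omega)] at h
  simp at h; omega

end IsGood

end Filling

/-! ### Insertion of a row, and bijectivity of `phi`. -/

namespace Filling

theorem hasPartitionShape_iff {T : Filling} : T.HasPartitionShape ↔
    (∀ i < T.length, (T.getD i []).length ≠ 0) ∧
      ∀ i, (T.getD (i + 1) []).length ≤ (T.getD i []).length := by
  unfold HasPartitionShape
  refine and_congr ?_ ?_
  · rw [List.forall_mem_iff_forall_getElem]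
    refine forall₂_congr fun i hi => ?_
    rw [List.getD_eq_getElem _ _ hi, ne_eq, ne_eq, List.length_eq_zero_iff]
  · rw [← List.isChain_iff_pairwise, List.isChain_iff_getElem]
    constructor
    · intro h i
      by_cases hi : i + 1 < T.length
      · have := h i (by simpa using hi)
        rw [List.getD_eq_getElem _ _ hi, List.getD_eq_getElem _ _ (by omega)]
        simpa using this
      · rw [List.getD_eq_default _ _ (by omega)]; simp
    · intro h i hi
      have := h i
      simp only [List.length_map] at hi
      rw [List.getD_eq_getElem _ _ hi, List.getD_eq_getElem _ _ (by omega)] at this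
      simpa using this

theorem ext_getD {T T' : Filling} (hl : T.length = T'.length)
    (h : ∀ i, T.getD i [] = T'.getD i []) : T = T' :=
  ext_entry hl fun i j => by rw [entry_eq_getElem?_getD, entry_eq_getElem?_getD, h]

theorem raiseBarred_of_not_bar {x : Letter} (h : x.bar = false) : raiseBarred x = x := by
  simp [raiseBarred, h]

@[simp] theorem bar_raise (x : Letter) : (raise x).bar = x.bar := rfl

@[simp] theorem bar_raiseBarred (x : Letter) : (raiseBarred x).bar = x.bar := by
  unfold raiseBarred; split_ifs <;> rfl

theorem raiseBarred_injective : Function.Injective raiseBarred := by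
  rintro ⟨a, b⟩ ⟨a', b'⟩ h
  cases b <;> cases b' <;> simp [raiseBarred, raise] at h <;> simp [h]

theorem smallBarLT_raise {x y : Letter} : SmallBarLT (raise x) (raise y) ↔ SmallBarLT x y := by
  simp [SmallBarLT, raise]

theorem smallBarLT_raiseBarred {x y : Letter} :
    SmallBarLT (raiseBarred x) (raiseBarred y) ↔ SmallBarLT x y := by
  obtain ⟨a, b⟩ := x
  obtain ⟨a', b'⟩ := y
  cases b <;> cases b' <;> simp [SmallBarLT, raiseBarred, raise]

theorem smallBarLT_of_raise {x y : Letter} (h : y = raise x) :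
    SmallBarLT x y := by
  subst h
  exact Or.inr ⟨by simp, by simp [raise]⟩

/-- The filling `T'` arises from `T` by raising the barred letters of the rows up to row `q`, and by
inserting below row `q` a row obtained by raising row `q` and raising all the later rows. -/
structure Inserted (q : ℕ) (T T' : Filling) : Prop where
  length_eq : T'.length = T.length + 1
  lt_length : q < T.length
  low : ∀ i ≤ q, T'.getD i [] = (T.getD i []).map raiseBarred
  high : ∀ i, q ≤ i → T'.getD (i + 1) [] = (T.getD i []).map raise
  plain : ∀ x ∈ T.getD q [], x.bar = false

namespace Inserted

variable {q : ℕ} {T T' : Filling}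

theorem entry_low (I : Inserted q T T') {i : ℕ} (hi : i ≤ q) (j : ℕ) :
    T'.entry i j = (T.entry i j).map raiseBarred := by
  rw [entry_eq_getElem?_getD, entry_eq_getElem?_getD, I.low i hi, List.getElem?_map]

theorem entry_high (I : Inserted q T T') {i : ℕ} (hi : q ≤ i) (j : ℕ) :
    T'.entry (i + 1) j = (T.entry i j).map raise := by
  rw [entry_eq_getElem?_getD, entry_eq_getElem?_getD, I.high i hi, List.getElem?_map]

theorem not_bar (I : Inserted q T T') {j : ℕ} {x : Letter} (h : T.entry q j = some x) :
    x.bar = false := by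
  rw [entry_eq_getElem?_getD] at h
  exact I.plain x (List.mem_of_getElem? h)

theorem hasPartitionShape (I : Inserted q T T') : T'.HasPartitionShape ↔ T.HasPartitionShape := by
  rw [hasPartitionShape_iff, hasPartitionShape_iff, I.length_eq]
  have hl : ∀ i ≤ q, (T'.getD i []).length = (T.getD i []).length := fun i hi => by
    rw [I.low i hi, List.length_map]
  have hh : ∀ i, q ≤ i → (T'.getD (i + 1) []).length = (T.getD i []).length := fun i hi => by
    rw [I.high i hi, List.length_map]
  have := I.lt_length
  constructor
  · rintro ⟨h1, h2⟩
    refine ⟨fun i hi => ?_, fun i => ?_⟩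
    · rcases le_or_gt i q with h | h
      · rw [← hl i h]; exact h1 i (by omega)
      · rw [← hh i h.le]; exact h1 (i + 1) (by omega)
    · rcases lt_or_ge i q with h | h
      · rw [← hl i h.le, ← hl (i + 1) h]; exact h2 i
      · rw [← hh i h, ← hh (i + 1) (by omega)]; exact h2 (i + 1)
  · rintro ⟨h1, h2⟩
    refine ⟨fun i hi => ?_, fun i => ?_⟩
    · rcases le_or_gt i q with h | h
      · rw [hl i h]; exact h1 i (by omega)
      · obtain ⟨i, rfl⟩ : ∃ k, i = k + 1 := ⟨i - 1, by omega⟩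
        rw [hh i (by omega)]; exact h1 i (by omega)
    · rcases lt_trichotomy i q with h | h | h
      · rw [hl i h.le, hl (i + 1) h]; exact h2 i
      · subst h; rw [hl i le_rfl, hh i le_rfl]
      · obtain ⟨i, rfl⟩ : ∃ k, i = k + 1 := ⟨i - 1, by omega⟩
        rw [hh i (by omega), hh (i + 1) (by omega)]; exact h2 i

theorem isSemistandard (I : Inserted q T T') :
    T'.IsSemistandard SmallBarLT ↔ T.IsSemistandard SmallBarLT := by
  unfold IsSemistandard
  refine and_congr I.hasPartitionShape ⟨?_, ?_⟩
  · rintro ⟨h1, h2⟩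
    refine ⟨fun i j a b ha hb => ?_, fun i j a b ha hb => ?_⟩
    · rcases le_or_gt i q with h | h
      · have := h1 i j (raiseBarred a) (raiseBarred b) (by rw [I.entry_low h, ha]; rfl)
          (by rw [I.entry_low h, hb]; rfl)
        rwa [smallBarLT_raiseBarred, raiseBarred_injective.eq_iff, bar_raiseBarred] at this
      · have := h1 (i + 1) j (raise a) (raise b) (by rw [I.entry_high h.le, ha]; rfl)
          (by rw [I.entry_high h.le, hb]; rfl)
        rwa [smallBarLT_raise, raise_injective.eq_iff, bar_raise] at this
    · rcases lt_or_ge i q with h | h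
      · have := h2 i j (raiseBarred a) (raiseBarred b) (by rw [I.entry_low h.le, ha]; rfl)
          (by rw [I.entry_low h, hb]; rfl)
        rwa [smallBarLT_raiseBarred, raiseBarred_injective.eq_iff, bar_raiseBarred] at this
      · have := h2 (i + 1) j (raise a) (raise b) (by rw [I.entry_high h, ha]; rfl)
          (by rw [I.entry_high (by omega), hb]; rfl)
        rwa [smallBarLT_raise, raise_injective.eq_iff, bar_raise] at this
  · rintro ⟨h1, h2⟩
    refine ⟨fun i j a b ha hb => ?_, fun i j a b ha hb => ?_⟩
    · rcases le_or_gt i q with h | h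
      · rw [I.entry_low h, Option.map_eq_some_iff] at ha hb
        obtain ⟨a, ha, rfl⟩ := ha
        obtain ⟨b, hb, rfl⟩ := hb
        rw [smallBarLT_raiseBarred, raiseBarred_injective.eq_iff, bar_raiseBarred]
        exact h1 _ _ _ _ ha hb
      · obtain ⟨i, rfl⟩ : ∃ k, i = k + 1 := ⟨i - 1, by omega⟩
        rw [I.entry_high (by omega), Option.map_eq_some_iff] at ha hb
        obtain ⟨a, ha, rfl⟩ := ha
        obtain ⟨b, hb, rfl⟩ := hb
        rw [smallBarLT_raise, raise_injective.eq_iff, bar_raise]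
        exact h1 _ _ _ _ ha hb
    · rcases lt_trichotomy i q with h | rfl | h
      · rw [I.entry_low (by omega), Option.map_eq_some_iff] at ha hb
        obtain ⟨a, ha, rfl⟩ := ha
        obtain ⟨b, hb, rfl⟩ := hb
        rw [smallBarLT_raiseBarred, raiseBarred_injective.eq_iff, bar_raiseBarred]
        exact h2 _ _ _ _ ha hb
      · rw [I.entry_low le_rfl, Option.map_eq_some_iff] at ha
        obtain ⟨a, ha, rfl⟩ := ha
        have h3 := I.not_bar ha
        rw [I.entry_high le_rfl, ha, Option.map_some, Option.some_inj] at hb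
        rw [raiseBarred_of_not_bar h3]
        exact Or.inl (smallBarLT_of_raise hb.symm)
      · obtain ⟨i, rfl⟩ : ∃ k, i = k + 1 := ⟨i - 1, by omega⟩
        rw [I.entry_high (by omega), Option.map_eq_some_iff] at ha hb
        obtain ⟨a, ha, rfl⟩ := ha
        obtain ⟨b, hb, rfl⟩ := hb
        rw [smallBarLT_raise, raise_injective.eq_iff, bar_raise]
        exact h2 _ _ _ _ ha hb

theorem barsEndWith (I : Inserted q T T') {N : ℕ} :
    T'.BarsEndWith (N + 1) ↔ T.BarsEndWith N := by
  have hr : ∀ {x : Letter} {s : ℕ}, raise x = ⟨s, true⟩ ↔ x.val + 1 = s ∧ x.bar = true := by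
    rintro ⟨a, b⟩ s; simp [raise]
  have hb : ∀ {x : Letter} {s : ℕ}, raiseBarred x = ⟨s, true⟩ ↔ x.val + 1 = s ∧ x.bar = true := by
    rintro ⟨a, b⟩ s; cases b <;> simp [raiseBarred, raise]
  have e : ∀ (x : Letter) (s : ℕ), x = ⟨s, true⟩ ↔ x.val = s ∧ x.bar = true := by
    rintro ⟨a, b⟩ s; simp
  constructor
  · intro h i j s hs hN
    rcases le_or_gt i q with hi | hi
    · have := h i j (s + 1) (by rw [I.entry_low hi, hs]; rfl) (by omega)
      rw [I.entry_low hi, Option.map_eq_some_iff] at this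
      obtain ⟨x, hx, h1⟩ := this
      rw [hx, Option.some_inj, e]
      exact ⟨by have := (hb.1 h1).1; omega, (hb.1 h1).2⟩
    · have := h (i + 1) j (s + 1) (by rw [I.entry_high hi.le, hs]; rfl) (by omega)
      rw [I.entry_high hi.le, Option.map_eq_some_iff] at this
      obtain ⟨x, hx, h1⟩ := this
      rw [hx, Option.some_inj, e]
      exact ⟨by have := (hr.1 h1).1; omega, (hr.1 h1).2⟩
  · intro h i j s hs hN
    rcases le_or_gt i q with hi | hi
    · rw [I.entry_low hi, Option.map_eq_some_iff] at hs ⊢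
      obtain ⟨⟨t, b⟩, hx, h1⟩ := hs
      obtain ⟨rfl, rfl⟩ := hb.1 h1
      exact ⟨_, h i j t hx (by simp only at hN; omega), rfl⟩
    · obtain ⟨i, rfl⟩ : ∃ k, i = k + 1 := ⟨i - 1, by omega⟩
      rw [I.entry_high (by omega), Option.map_eq_some_iff] at hs ⊢
      obtain ⟨⟨t, b⟩, hx, h1⟩ := hs
      obtain ⟨rfl, rfl⟩ := hr.1 h1
      exact ⟨_, h i j t hx (by simp only at hN; omega), rfl⟩

theorem countP_flatten_eq (I : Inserted q T T') (p : Letter → Bool) (hp : ∀ x, p x = true → x.bar = true) :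
    T'.flatten.countP p = T.flatten.countP (p ∘ raise) := by
  have e : ∀ x, p (raiseBarred x) = p (raise x) := by
    rintro ⟨a, b⟩
    cases b with
    | true => rfl
    | false =>
      have h1 : ∀ t, p ⟨t, false⟩ = false := fun t => Bool.eq_false_iff.2 fun h => by simpa using hp _ h
      exact (h1 a).trans (h1 (a + 1)).symm
  have key1 : ∀ i ≤ q + 1, ∑ k ∈ Finset.range i, (T'.getD k []).countP p =
      ∑ k ∈ Finset.range i, (T.getD k []).countP (p ∘ raise) := by
    intro i hi
    refine Finset.sum_congr rfl fun k hk => ?_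
    rw [Finset.mem_range] at hk
    rw [I.low k (by omega), List.countP_map]
    congr 1
    exact funext e
  have key2 : ∀ i, q ≤ i → ∑ k ∈ Finset.range (i + 1), (T'.getD k []).countP p =
      ∑ k ∈ Finset.range i, (T.getD k []).countP (p ∘ raise) := by
    intro i hi
    induction i, hi using Nat.le_induction with
    | base =>
      rw [key1 _ le_rfl, Finset.sum_range_succ, List.countP_eq_zero.2, add_zero]
      intro x hx h
      simpa [I.plain x hx] using hp _ h
    | succ i hi ih =>
      rw [Finset.sum_range_succ, ih, Finset.sum_range_succ, I.high i hi, List.countP_map]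
  rw [countP_flatten T' p le_rfl, countP_flatten T _ le_rfl, I.length_eq, key2 _ I.lt_length.le]

theorem totalColor_eq (I : Inserted q T T') : T'.totalColor = T.totalColor :=
  I.countP_flatten_eq _ fun _ h => h

theorem count_bar (I : Inserted q T T') (s : ℕ) :
    T'.flatten.count ⟨s + 1, true⟩ = T.flatten.count ⟨s, true⟩ := by
  rw [List.count, I.countP_flatten_eq, List.count]
  · congr 1
    funext ⟨a, b⟩
    simp only [Function.comp_apply, raise, beq_eq_beq]
    simp
  · intro x h; rw [beq_iff_eq] at h; rw [h]

theorem count_bar_zero (I : Inserted q T T') : T'.flatten.count ⟨0, true⟩ = 0 := by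
  rw [List.count, I.countP_flatten_eq, List.countP_eq_zero]
  · intro x _; simp [raise]
  · intro x h; rw [beq_iff_eq] at h; rw [h]

theorem cum_of_le (I : Inserted q T T') {i : ℕ} (hi : i ≤ q + 1) (s : ℕ) : T'.cum i s = T.cum i s := by
  rw [cum_eq_sum, cum_eq_sum]
  refine Finset.sum_congr rfl fun k hk => ?_
  rw [Finset.mem_range] at hk
  unfold rowCount
  rw [I.low k (by omega), show (⟨s, false⟩ : Letter) = raiseBarred ⟨s, false⟩ from rfl,
    List.count_map_of_injective _ _ raiseBarred_injective]
  rfl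

theorem cum_add (I : Inserted q T T') {i : ℕ} (hi : q ≤ i) (s : ℕ) :
    T'.cum (i + 1) (s + 1) + T.cum q s = T.cum (q + 1) (s + 1) + T.cum i s := by
  induction i, hi using Nat.le_induction with
  | base => rw [I.cum_of_le le_rfl]
  | succ i hi ih =>
    have h : T'.rowCount (i + 1) (s + 1) = T.rowCount i s := by
      unfold rowCount
      rw [I.high i hi, show (⟨s + 1, false⟩ : Letter) = raise ⟨s, false⟩ from rfl,
        List.count_map_of_injective _ _ raise_injective]
    rw [cum_succ, cum_succ T i, h]
    omega

theorem cum_zero_eq (I : Inserted q T T') {i : ℕ} (hi : q ≤ i) :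
    T'.cum (i + 1) 0 = T.cum (q + 1) 0 := by
  induction i, hi using Nat.le_induction with
  | base => rw [I.cum_of_le le_rfl]
  | succ i hi ih =>
    have h : T'.rowCount (i + 1) 0 = 0 := by
      unfold rowCount
      rw [I.high i hi, List.count_eq_zero]
      intro h
      obtain ⟨x, -, hx⟩ := List.mem_map.1 h
      simp [raise] at hx
    rw [cum_succ, h, ih, add_zero]

theorem count_eq_cum (I : Inserted q T T') (s : ℕ) :
    T'.flatten.count ⟨s, false⟩ = T'.cum (T.length + 1) s := by
  rw [← cum_of_length_le I.length_eq.le]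

/-- Insertion takes place below a row without bars, so it does not change which rows begin with a
barred letter. This makes the place of insertion recoverable from the image. -/
theorem barredLength_eq (I : Inserted q T T') (hT : T.IsSemistandard SmallBarLT) :
    T'.barredLength = T.barredLength := by
  have hT' := I.isSemistandard.2 hT
  have hq : T.barredLength ≤ q := by
    by_contra hc
    obtain ⟨s, hs⟩ := hT.lt_barredLength_iff.1 (not_le.1 hc)
    simpa using I.not_bar hs
  have key : ∀ i, i < T'.barredLength ↔ i < T.barredLength := by
    intro i
    rcases le_or_gt i q with h | h
    · rw [hT.lt_barredLength_iff, hT'.lt_barredLength_iff, I.entry_low h]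
      constructor
      · rintro ⟨s, hs⟩
        obtain ⟨⟨t, b⟩, hx, h1⟩ := Option.map_eq_some_iff.1 hs
        have h2 : b = true := (bar_raiseBarred ⟨t, b⟩).symm.trans (congrArg Letter.bar h1)
        subst h2
        exact ⟨t, hx⟩
      · rintro ⟨s, hs⟩
        exact ⟨s + 1, by rw [hs]; rfl⟩
    · refine iff_of_false (fun hi => ?_) (by omega)
      obtain ⟨i, rfl⟩ : ∃ k, i = k + 1 := ⟨i - 1, by omega⟩
      obtain ⟨s, hs⟩ := hT'.lt_barredLength_iff.1 hi
      rw [I.entry_high (by omega), Option.map_eq_some_iff] at hs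
      obtain ⟨⟨t, b⟩, hx, h1⟩ := hs
      have h2 : b = true := (bar_raise ⟨t, b⟩).symm.trans (congrArg Letter.bar h1)
      subst h2
      have := hT.lt_barredLength hx
      omega
  exact le_antisymm (le_of_not_gt fun h => absurd ((key _).1 h) (lt_irrefl _))
    (le_of_not_gt fun h => absurd ((key _).2 h) (lt_irrefl _))

/-- Below row `q` all letters are raised, so counts of `s + 1` and of `s` grow at the same rate. The
equalities for row `q` say that the difference is zero at the start. -/
theorem cum_shift (I : Inserted q T T') (hq : ∀ s, 1 ≤ s → T.cum (q + 1) (s + 1) = T.cum q s)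
    {i s : ℕ} (hi : q ≤ i) (hs : 1 ≤ s) : T'.cum (i + 1) (s + 1) = T.cum i s := by
  have h1 := I.cum_add hi s
  have h2 := hq s hs
  omega

theorem cum_one (I : Inserted q T T') (h0 : T.flatten.count ⟨0, false⟩ = 0) {i : ℕ} (hi : q ≤ i) :
    T'.cum (i + 1) 1 = T.cum (q + 1) 1 := by
  have h1 := I.cum_add hi 0
  have h2 := T.cum_le i 0
  have h3 := T.cum_le q 0
  simp only [zero_add] at h1
  omega

variable {m d w : ℕ}

theorem count_val (I : Inserted q T T') (hq : ∀ s, 1 ≤ s → T.cum (q + 1) (s + 1) = T.cum q s) {s : ℕ}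
    (hs : 1 ≤ s) : T'.flatten.countP (fun x => x.val = s + 1) = T.flatten.countP fun x => x.val = s := by
  rw [List.countP_val, List.countP_val, I.count_bar, I.count_eq_cum,
    I.cum_shift hq I.lt_length.le hs, cum_of_length_le le_rfl]

/-- Above the insertion nothing changes for unbarred letters, and below it the conditions are those
of `T` shifted by one row and one letter. The hypothesis `h1` says that the first `q + 1` rows
already contain `m` letters `1`, so the content of the letter `1` is right after all later letters
have been raised. -/
theorem isGood (I : Inserted q T T') (hT : T.IsGood m d w)
    (hq : ∀ s, 1 ≤ s → T.cum (q + 1) (s + 1) = T.cum q s) (h1 : T.cum (q + 1) 1 = m) :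
    T'.IsGood m d (w + 1) := by
  have h0 := hT.count_zero
  refine ⟨I.isSemistandard.2 hT.sst, fun s => ?_, I.totalColor_eq.trans hT.color, fun s hs i => ?_,
    I.barsEndWith.2 hT.bars⟩
  · obtain _ | _ | s := s
    · rw [List.countP_val, I.count_bar_zero, I.count_eq_cum, I.cum_zero_eq I.lt_length.le]
      have := T.cum_le (q + 1) 0
      simp; omega
    · have hb := hT.count_eq 0
      simp only [nonpos_iff_eq_zero, one_ne_zero, false_and, if_false] at hb
      rw [List.countP_val, zero_add, I.count_eq_cum, I.cum_one h0 I.lt_length.le, h1, ← zero_add 1,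
        I.count_bar]
      rw [if_pos (by omega)]; omega
    · rw [I.count_val hq (by omega), hT.content]
      exact if_congr (by omega) rfl rfl
  · rcases le_or_gt i q with hi | hi
    · rw [I.cum_of_le (by omega), I.cum_of_le (by omega)]
      exact hT.lr s hs i
    · obtain ⟨i, rfl⟩ : ∃ k, i = k + 1 := ⟨i - 1, by omega⟩
      rw [I.cum_shift hq (by omega) hs]
      rcases hs.eq_or_lt with rfl | hs'
      · rw [I.cum_one h0 (by omega), h1]
        have h2 := T.cum_le (i + 1) 1
        have h3 := hT.count_eq 1
        split_ifs at h3 <;> omega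
      · obtain ⟨s, rfl⟩ : ∃ k, s = k + 1 := ⟨s - 1, by omega⟩
        rw [I.cum_shift hq (by omega) (by omega)]
        exact hT.lr s (by omega) i

/-- The same shift read backwards. That `T` has no letter `0` follows from the count of letters `1`
in `T'`, which is exhausted by the first `q + 1` rows. -/
theorem isGood_left (I : Inserted q T T') (hT' : T'.IsGood m d (w + 1))
    (hq : ∀ s, 1 ≤ s → T.cum (q + 1) (s + 1) = T.cum q s) (h1 : T.cum (q + 1) 1 = m) :
    T.IsGood m d w := by
  have h0' := hT'.count_zero
  have hc := hT'.count_eq 1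
  rw [if_pos (by omega)] at hc
  have h0 : T.flatten.count ⟨0, false⟩ = 0 ∧ T'.flatten.count ⟨1, true⟩ = 0 := by
    have e1 := I.cum_add I.lt_length.le 0
    rw [zero_add, ← I.count_eq_cum, cum_of_length_le le_rfl] at e1
    have e2 := I.cum_of_le (i := q) (by omega) 0
    have e3 := T'.cum_le q 0
    omega
  refine ⟨I.isSemistandard.1 hT'.sst, fun s => ?_, I.totalColor_eq.symm.trans hT'.color,
    fun s hs i => ?_, I.barsEndWith.1 hT'.bars⟩
  · obtain _ | s := s
    · rw [List.countP_val, h0.1, ← I.count_bar, h0.2]; rfl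
    · rw [← I.count_val hq (by omega), hT'.content]
      exact if_congr (by omega) rfl rfl
  · rcases lt_or_ge i q with hi | hi
    · rw [← I.cum_of_le (by omega), ← I.cum_of_le (by omega)]
      exact hT'.lr s hs i
    · rw [← I.cum_shift hq (i := i + 1) (by omega) (by omega), ← I.cum_shift hq hi hs]
      exact hT'.lr (s + 1) (by omega) (i + 1)

theorem right_unique {T₁ T₂ : Filling} (I₁ : Inserted q T T₁) (I₂ : Inserted q T T₂) : T₁ = T₂ := by
  refine ext_getD (I₁.length_eq.trans I₂.length_eq.symm) fun i => ?_
  rcases le_or_gt i q with h | h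
  · rw [I₁.low i h, I₂.low i h]
  · obtain ⟨i, rfl⟩ : ∃ k, i = k + 1 := ⟨i - 1, by omega⟩
    rw [I₁.high i (by omega), I₂.high i (by omega)]

theorem left_unique {T₁ T₂ : Filling} (I₁ : Inserted q T₁ T') (I₂ : Inserted q T₂ T') : T₁ = T₂ := by
  have h1 := I₁.length_eq
  have h2 := I₂.length_eq
  refine ext_getD (by omega) fun i => ?_
  rcases le_or_gt i q with h | h
  · exact raiseBarred_injective.list_map ((I₁.low i h).symm.trans (I₂.low i h))
  · exact raise_injective.list_map ((I₁.high i h.le).symm.trans (I₂.high i h.le))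

end Inserted

variable {m d w : ℕ}

theorem IsGood.inserted_phi {T : Filling} (hT : T.IsGood m d w) (hm : 1 ≤ m) (hw : 2 ≤ w) :
    Inserted (T.barredLength + (w - 2)) T (phi m w T) := by
  have hlt := hT.lt_length hm (i := T.barredLength + (w - 2)) (by omega) hw
  have hr : T.barredLength + (w - 1) = T.barredLength + (w - 2) + 1 := by omega
  have hlen := (hT.cum_eq (i := T.barredLength + (w - 2)) (by omega) (by omega)).2.2
  have hnb := hT.not_bar (i := T.barredLength + (w - 2)) (by omega)
  set q := T.barredLength + (w - 2) with hq
  have e : phi m w T = (T.take (q + 1)).map (List.map raiseBarred) ++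
      ((T.getD q []).map raise :: (T.drop (q + 1)).map (List.map raise)) := by
    unfold phi
    simp only [hr, Nat.add_sub_cancel]
    rw [List.take_of_length_le hlen.le, List.append_assoc, List.singleton_append]
  refine ⟨?_, hlt, fun i hi => ?_, fun i hi => ?_, hnb⟩
  · rw [e]; simp; omega
  · rw [e, List.getD_eq_getElem?_getD, List.getElem?_append_left (by simp; omega), List.getElem?_map,
      List.getElem?_take_of_lt (by omega), List.getD_eq_getElem?_getD]
    cases T[i]? <;> rfl
  · rw [e, List.getD_eq_getElem?_getD, List.getElem?_append_right (by simp; omega)]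
    have hl : ((T.take (q + 1)).map (List.map raiseBarred)).length = q + 1 := by simp; omega
    rw [hl]
    rcases hi.eq_or_lt with rfl | hi
    · simp
    · obtain ⟨k, rfl⟩ := Nat.exists_eq_add_of_lt hi
      rw [show q + k + 1 + 1 - (q + 1) = k + 1 by omega, List.getElem?_cons_succ, List.getElem?_map,
        List.getElem?_drop, List.getD_eq_getElem?_getD, show q + 1 + k = q + k + 1 by omega]
      cases T[q + k + 1]? <;> rfl

/-- The inverse of `raise`. -/
def lower (x : Letter) : Letter := ⟨x.val - 1, x.bar⟩

/-- The inverse of `raiseBarred`. -/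
def lowerBarred (x : Letter) : Letter := if x.bar then lower x else x

theorem raise_lower {x : Letter} (h : 1 ≤ x.val) : raise (lower x) = x := by
  obtain ⟨a, b⟩ := x
  simp only [raise, lower, Letter.mk.injEq, and_true] at h ⊢
  omega

theorem raiseBarred_lowerBarred {x : Letter} (h : 1 ≤ x.val) : raiseBarred (lowerBarred x) = x := by
  obtain ⟨a, b⟩ := x
  cases b with
  | false => rfl
  | true => exact raise_lower h

/-- Remove row `q + 1`, and lower the barred letters of the rows above and all letters of the rows
below. -/
def removeRow (q : ℕ) (T : Filling) : Filling :=
  (T.take (q + 1)).map (List.map lowerBarred) ++ (T.drop (q + 2)).map (List.map lower)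

/-- For `w + 1` both rows `q` and `q + 1` lie in the range where consecutive rows differ by one. So
the removed row is the one that reinsertion produces. -/
theorem IsGood.inserted_removeRow {T : Filling} (hT : T.IsGood m d (w + 1)) (hm : 1 ≤ m)
    (hw : 2 ≤ w) : Inserted (T.barredLength + (w - 2)) (removeRow (T.barredLength + (w - 2)) T) T := by
  have hlt := hT.lt_length hm (i := T.barredLength + (w - 2) + 1) (by omega) (by omega)
  have hsucc := hT.getD_succ (i := T.barredLength + (w - 2)) (by omega) (by omega)
  have hnb := hT.not_bar (i := T.barredLength + (w - 2)) (by omega)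
  set q := T.barredLength + (w - 2) with hq
  have hval : ∀ i, ∀ x ∈ T.getD i [], 1 ≤ x.val := by
    intro i x hx
    obtain ⟨j, hj⟩ := List.getElem?_of_mem hx
    rw [← entry_eq_getElem?_getD] at hj
    exact (hT.val_of_entry (b := x.bar) hj).1
  have hl : ((T.take (q + 1)).map (List.map lowerBarred)).length = q + 1 := by simp; omega
  have low : ∀ i ≤ q, (removeRow q T).getD i [] = (T.getD i []).map lowerBarred := by
    intro i hi
    unfold removeRow
    rw [List.getD_eq_getElem?_getD, List.getElem?_append_left (by omega), List.getElem?_map,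
      List.getElem?_take_of_lt (by omega), List.getD_eq_getElem?_getD]
    cases T[i]? <;> rfl
  have high : ∀ i, q < i → (removeRow q T).getD i [] = (T.getD (i + 1) []).map lower := by
    intro i hi
    unfold removeRow
    obtain ⟨k, rfl⟩ := Nat.exists_eq_add_of_lt hi
    rw [List.getD_eq_getElem?_getD, List.getElem?_append_right (by omega), hl, List.getElem?_map,
      List.getElem?_drop, List.getD_eq_getElem?_getD, show q + 2 + (q + k + 1 - (q + 1)) = q + k + 1 + 1 by omega]
    cases T[q + k + 1 + 1]? <;> rfl
  have hqq : (removeRow q T).getD q [] = T.getD q [] := by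
    rw [low q le_rfl]
    conv_rhs => rw [← List.map_id (T.getD q [])]
    exact List.map_congr_left fun x hx => by simp [lowerBarred, hnb x hx]
  refine ⟨?_, ?_, fun i hi => ?_, fun i hi => ?_, ?_⟩
  · unfold removeRow; rw [List.length_append, hl]; simp; omega
  · unfold removeRow; rw [List.length_append, hl]; omega
  · rw [low i hi, List.map_map]
    conv_lhs => rw [← List.map_id (T.getD i [])]
    exact List.map_congr_left fun x hx => (raiseBarred_lowerBarred (hval i x hx)).symm
  · rcases hi.eq_or_lt with rfl | hi
    · rw [hqq, hsucc]
    · rw [high i hi, List.map_map]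
      conv_lhs => rw [← List.map_id (T.getD (i + 1) [])]
      exact List.map_congr_left fun x hx => (raise_lower (hval _ x hx)).symm
  · rw [hqq]; exact hnb

theorem IsGood.phi {T : Filling} (hT : T.IsGood m d w) (hm : 1 ≤ m) (hw : 2 ≤ w) :
    (phi m w T).IsGood m d (w + 1) := by
  have h := hT.cum_eq (i := T.barredLength + (w - 2)) (by omega) (by omega)
  exact (hT.inserted_phi hm hw).isGood hT h.1 h.2.1

/-- An image has the same number of rows with barred letters, hence determines `q`, and raising is
injective. A preimage is obtained by removing row `q + 1`. -/
theorem bijOn_phi (hm : 1 ≤ m) (hw : 2 ≤ w) :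
    Set.BijOn (phi m w) {T | T.IsGood m d w} {T | T.IsGood m d (w + 1)} := by
  refine ⟨fun T hT => hT.phi hm hw, fun T₁ h₁ T₂ h₂ h => ?_, fun T' hT' => ?_⟩
  · have I₁ := IsGood.inserted_phi h₁ hm hw
    have I₂ := IsGood.inserted_phi h₂ hm hw
    have e : T₁.barredLength = T₂.barredLength := by
      rw [← I₁.barredLength_eq (IsGood.sst h₁), ← I₂.barredLength_eq (IsGood.sst h₂), h]
    rw [← e, ← h] at I₂
    exact I₁.left_unique I₂
  · have I := IsGood.inserted_removeRow hT' hm hw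
    have h := IsGood.cum_eq hT' (i := T'.barredLength + (w - 2)) (by omega) (by omega)
    have hT := I.isGood_left hT' (fun s hs => by
      rw [← I.cum_of_le le_rfl, ← I.cum_of_le (by omega)]; exact h.1 s hs)
      (by rw [← I.cum_of_le le_rfl]; exact h.2.1)
    refine ⟨_, hT, ?_⟩
    have I' := hT.inserted_phi hm hw
    rw [← I.barredLength_eq hT.sst] at I'
    exact I'.right_unique I

end Filling

namespace Filling

open GridSlide

/-! ### Slides preserve the Littlewood–Richardson condition -/

theorem getD_setEntry (T : Filling) (c : ℕ × ℕ) (x : Letter) (i : ℕ) :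
    (T.setEntry c x).getD i [] = if c.1 = i then (T.getD i []).set c.2 x else T.getD i [] := by
  unfold setEntry
  rw [List.getD_eq_getElem?_getD, List.getD_eq_getElem?_getD, List.getElem?_modify]
  by_cases h : c.1 = i
  · simp only [h, if_true]; cases T[i]? <;> simp
  · simp only [h, if_false]; cases T[i]? <;> simp

theorem rowCount_setEntry {T : Filling} {c : ℕ × ℕ} {a : Letter} (b : Letter)
    (h : T.entry c.1 c.2 = some a) (i s : ℕ) :
    (T.setEntry c b).rowCount i s + (if c.1 = i ∧ a = ⟨s, false⟩ then 1 else 0) =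
      T.rowCount i s + if c.1 = i ∧ b = ⟨s, false⟩ then 1 else 0 := by
  unfold rowCount
  rw [getD_setEntry]
  by_cases hc : c.1 = i
  · subst hc
    rw [entry_eq_getElem?_getD] at h
    have := (List.cons_set_perm b h).count_eq ⟨s, false⟩
    simpa [List.count_cons, beq_iff_eq] using this
  · simp [hc]

theorem rowCount_swap {T : Filling} {c c' : ℕ × ℕ} {v y : ℕ}
    (hc : T.entry c.1 c.2 = some ⟨v, true⟩) (hc' : T.entry c'.1 c'.2 = some ⟨y, false⟩) (i s : ℕ) :
    (T.swap c c').rowCount i s + (if c'.1 = i ∧ y = s then 1 else 0) =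
      T.rowCount i s + if c.1 = i ∧ y = s then 1 else 0 := by
  have h1 := rowCount_setEntry ⟨y, false⟩ hc i s
  have h2 : (T.setEntry c ⟨y, false⟩).entry c'.1 c'.2 = some ⟨y, false⟩ := by
    rw [entry_setEntry, hc']; split_ifs <;> rfl
  have h3 := rowCount_setEntry ⟨v, true⟩ h2 i s
  unfold swap
  rw [hc, hc']
  simp only [Letter.mk.injEq, and_true, Bool.true_eq_false, and_false, if_false, add_zero] at h1 h3 ⊢
  omega

theorem cum_swap_row {T : Filling} {c : ℕ × ℕ} {j v y : ℕ}
    (hc : T.entry c.1 c.2 = some ⟨v, true⟩) (hc' : T.entry c.1 j = some ⟨y, false⟩) (i s : ℕ) :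
    (T.swap c (c.1, j)).cum i s = T.cum i s := by
  rw [cum_eq_sum, cum_eq_sum]
  refine Finset.sum_congr rfl fun k _ => ?_
  have := rowCount_swap (c' := (c.1, j)) hc hc' k s
  simp only at this; omega

theorem cum_swap_column {T : Filling} {c : ℕ × ℕ} {v y : ℕ}
    (hc : T.entry c.1 c.2 = some ⟨v, true⟩) (hc' : T.entry (c.1 + 1) c.2 = some ⟨y, false⟩) (i s : ℕ) :
    (T.swap c (c.1 + 1, c.2)).cum i s = T.cum i s + if i = c.1 + 1 ∧ y = s then 1 else 0 := by
  induction i with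
  | zero => simp [cum_zero]
  | succ i ih =>
    have := rowCount_swap (c' := (c.1 + 1, c.2)) hc hc' i s
    rw [cum_succ, cum_succ, ih]
    simp only at this
    split_ifs at this ⊢ <;> omega

/-- When the letter `s + 1` below the hole moves up, then there are letters `s + 1` below all the
letters `s` next to the hole. -/
theorem _root_.GridSlide.Mid.rowCount_lt {D : Set (ℤ × ℤ)} {d : ℕ} {v : ℕ → ℕ} {f : ℤ × ℤ → ℤ} {k : ℕ}
    {pos : ℕ → ℕ × ℕ} {T : Filling} {c : ℕ × ℕ} (hv : Monotone v) (M : Mid D d v k pos f (toGrid c))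
    (R : Rep D d v T f) (hshape : T.HasPartitionShape)
    (h : CondSE D (highKey d v k) f (toGrid c) (toGrid (c.1 + 1, c.2))) {s : ℕ}
    (hs : T.entry (c.1 + 1) c.2 = some ⟨s + 1, false⟩) :
    T.rowCount c.1 s < T.rowCount (c.1 + 1) (s + 1) := by
  have plain : ∀ {i j t}, T.entry i j = some ⟨t, false⟩ →
      toGrid (i, j) ∈ D ∧ (i, j) ≠ c ∧ f (toGrid (i, j)) = plainKey d t := by
    intro i j t ht
    have m := R.mem_of_some ht
    have e := R.some i j m
    rw [ht, Option.some_inj] at e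
    have hne : (i, j) ≠ c := by
      rintro rfl
      rw [M.decode_hole] at e; simp at e
    refine ⟨m, hne, ?_⟩
    rcases M.other _ m (by rwa [Ne, toGrid_inj]) with ⟨t', h'⟩ | ⟨l, hl, hlk, h'⟩
    · rw [h', decode_plainKey] at e
      rw [h']; simp at e; rw [e]
    · rw [h', M.apply_pos l hl hlk, decode_keyAt hl] at e
      simp at e
  obtain ⟨i, j⟩ := c
  obtain ⟨m', -, e'⟩ := plain hs
  obtain ⟨hlt, hright⟩ : f (toGrid (i + 1, j)) < highKey d v k ∧
      (toGrid (i, j + 1) ∈ D → f (toGrid (i + 1, j)) ≤ f (toGrid (i, j + 1))) := by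
    rcases h with ⟨-, -, h1, h2⟩ | ⟨h1, -⟩
    · exact ⟨h1, by simpa [toGrid] using h2⟩
    · simp [toGrid] at h1
  have hval : s + 1 < v k := by rwa [e', plainKey_lt_highKey M.lt] at hlt
  -- To the left of the hole, the letter below such an `s` lies above `s` and at most at `s + 1`; a
  -- converted barred letter does not fit in, being at least `v k > s + 1`. To the right of the
  -- hole, all letters are at least `s + 1` by the rule for the move. The box below the hole is an
  -- `s + 1` in addition.
  have key : ∀ {k'}, T.entry i k' = some ⟨s, false⟩ → T.entry (i + 1) k' = some ⟨s + 1, false⟩ := by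
    intro k' hk'
    obtain ⟨m, hne, e⟩ := plain hk'
    rcases lt_trichotomy k' j with hj | rfl | hj
    · have hD : toGrid (i + 1, k') ∈ D :=
        M.hole.conv _ _ _ _ _ _ m m' (by simp) le_rfl le_rfl (by simp; omega)
      have hne' : toGrid (i + 1, k') ≠ toGrid (i, j) := by simp [toGrid_inj]
      have h1 := (M.hole.mono _ _ _ _ m hD (fun h => hne (toGrid_inj.1 h))
        hne' (by simp) le_rfl).2 (by simp)
      have h2 := (M.hole.mono _ _ _ _ hD m' hne' (fun h => by simpa using toGrid_inj.1 h)
        le_rfl (by simp; omega)).1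
      rw [← toGrid, ← toGrid] at h1 h2
      rw [R.some _ _ hD]
      rcases M.other _ hD hne' with ⟨t, ht⟩ | ⟨l, hl, hlk, hl'⟩
      · rw [ht, e, plainKey_lt_plainKey] at h1
        rw [ht, e', plainKey_le_plainKey] at h2
        rw [ht, decode_plainKey, show t = s + 1 by omega]
      · rw [hl', M.apply_pos l hl hlk] at h1 h2
        exfalso
        unfold keyAt at h1 h2
        split_ifs at h1 h2 with hlt'
        · have := lowKey_lt_plainKey (s := s) hl; omega
        · have h3 : v k ≤ v l := hv (by omega)
          have := (plainKey_lt_highKey (v := v) hl (s := s + 1)).2 (by omega)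
          omega
    · exact (hne rfl).elim
    · have hD : toGrid (i, j + 1) ∈ D :=
        M.hole.conv _ _ _ _ _ _ M.hole.mem m le_rfl le_rfl (by simp) (by simp; omega)
      have h1 := hright hD
      have h2 := (M.hole.mono _ _ _ _ hD m (fun h => by simpa using toGrid_inj.1 h)
        (fun h => hne (toGrid_inj.1 h)) le_rfl (by simp; omega)).1
      rw [← toGrid, ← toGrid, e] at h2
      rw [e'] at h1
      have h3 := (plainKey_lt_plainKey (d := d) (s := s) (t := s + 1)).2 (by omega)
      omega
  have hhole : T.entry i j = some ⟨v k, true⟩ := by rw [R.some i j M.hole.mem, M.decode_hole]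
  unfold rowCount
  rw [List.count, List.count, countP_row_eq_card hshape, countP_row_eq_card hshape]
  apply Finset.card_lt_card
  rw [Finset.ssubset_iff_of_subset]
  · refine ⟨j, ?_, ?_⟩
    · rw [Finset.mem_filter, Finset.mem_range]
      exact ⟨(hshape.lt_of_entry hs).2, by rw [hs]; simp⟩
    · rw [Finset.mem_filter, hhole]; simp
  · intro k' hk'
    rw [Finset.mem_filter] at hk' ⊢
    refine ⟨hk'.1, ?_⟩
    rw [key]
    · simp
    · cases hx : T.entry i k' with
      | none => rw [hx] at hk'; simp at hk'
      | some x => rw [hx] at hk'; simpa using hk'.2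

/-- Horizontal moves do not change the counts. A letter `s + 1` moving up from row `c.1 + 1`
endangers only one condition, the one for row `c.1`. The condition for the next row says that the
letters `s + 1` up to row `c.1 + 1` are at most the letters `s` up to row `c.1`. As row `c.1 + 1`
has more letters `s + 1` than row `c.1` has letters `s`, the endangered inequality was strict. -/
theorem _root_.GridSlide.Mid.isLR_swap {D : Set (ℤ × ℤ)} {d : ℕ} {v : ℕ → ℕ} {f : ℤ × ℤ → ℤ} {k : ℕ}
    {pos : ℕ → ℕ × ℕ} {T : Filling} {c c' : ℕ × ℕ} (hv : Monotone v)
    (M : Mid D d v k pos f (toGrid c)) (R : Rep D d v T f) (hshape : T.HasPartitionShape)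
    (h : CondSE D (highKey d v k) f (toGrid c) (toGrid c')) (hT : T.IsLR) : (T.swap c c').IsLR := by
  have hhole : T.entry c.1 c.2 = some ⟨v k, true⟩ := by
    rw [R.some c.1 c.2 M.hole.mem, Prod.mk.eta, M.decode_hole]
  have hD : toGrid c' ∈ D ∧ f (toGrid c') < highKey d v k ∧ c.1 ≤ c'.1 ∧ c.2 ≤ c'.2 := by
    rcases h with ⟨e, h1, h2, _⟩ | ⟨e, h1, h2, _⟩ <;> simp only [toGrid, Prod.mk.injEq] at e <;>
      exact ⟨h1, h2, by omega, by omega⟩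
  obtain ⟨y, hy⟩ : ∃ y, T.entry c'.1 c'.2 = some ⟨y, false⟩ := by
    obtain ⟨y, hy⟩ := M.active hv hD.1 h.ne
      (M.hole.lo_lt _ _ hD.1 h.ne (by simp [toGrid]; omega) (by simp [toGrid]; omega)) hD.2.1
    exact ⟨y, by rw [R.some c'.1 c'.2 hD.1, Prod.mk.eta, hy, decode_plainKey]⟩
  have hcases : c' = (c.1, c.2 + 1) ∨ c' = (c.1 + 1, c.2) := by
    rcases h with ⟨e, _⟩ | ⟨e, _⟩ <;> simp only [toGrid, Prod.mk.injEq] at e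
    · right; ext <;> simp <;> omega
    · left; ext <;> simp <;> omega
  intro s hs i
  rcases hcases with rfl | rfl
  · rw [cum_swap_row hhole hy, cum_swap_row hhole hy]
    exact hT s hs i
  · rw [cum_swap_column hhole hy, cum_swap_column hhole hy]
    have h1 := hT s hs i
    by_cases h2 : i + 1 = c.1 + 1 ∧ y = s + 1
    · obtain ⟨h2, rfl⟩ := h2
      obtain rfl : i = c.1 := by omega
      have h3 := M.rowCount_lt hv R hshape h hy
      have h4 := hT s hs (c.1 + 1)
      rw [cum_succ, cum_succ T c.1 s] at h4
      rw [if_pos ⟨rfl, rfl⟩]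
      omega
    · rw [if_neg h2]; omega

theorem _root_.GridSlide.Mid.isLR_slide {D : Set (ℤ × ℤ)} {d : ℕ} {v : ℕ → ℕ} {f : ℤ × ℤ → ℤ} {k : ℕ}
    {pos : ℕ → ℕ × ℕ} {T : Filling} {c : ℕ × ℕ} (hv : Monotone v)
    (M : Mid D d v k pos f (toGrid c)) (R : Rep D d v T f) (hshape : T.HasPartitionShape)
    (hT : T.IsLR) (n : ℕ) : (slide nextSE n T c).IsLR := by
  induction n generalizing T f c with
  | zero => exact hT
  | succ n ih =>
    unfold slide
    rcases M.nextSE hv R with ⟨c', h1, h2⟩ | ⟨h1, h2⟩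
    · rw [h1]
      have hc' : toGrid c' ∈ D := by rcases h2 with ⟨_, h', _⟩ | ⟨_, h', _⟩ <;> exact h'
      exact ih (M.stepSE hv h2) (R.swap M.hole.mem hc' (by rw [Ne, ← toGrid_inj]; exact h2.ne))
        ((hasPartitionShape_congr (map_length_swap _ _ _)).2 hshape) (M.isLR_swap hv R hshape h2 hT)
    · rw [h1]; exact hT

/-! ### Stages of the conversion -/

/-- `U` arises from the tableau `T` for the small bar order by moving all barred letters with labels
at least `k`. -/
structure Stage (T : Filling) (k : ℕ) (U : Filling) : Prop where
  state : ∃ p f, State T.domain T.barredBoxes.length T.barredVal k p f ∧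
    Rep T.domain T.barredBoxes.length T.barredVal U f ∧ ∀ l < k, p l = T.barredBox l
  map_length : U.map List.length = T.map List.length
  perm : U.flatten.Perm T.flatten
  lr : U.IsLR

theorem IsSemistandard.stage {T : Filling} (hT : T.IsSemistandard SmallBarLT) (hLR : T.IsLR) :
    Stage T T.barredBoxes.length T :=
  ⟨⟨_, _, hT.state (Or.inl ⟨rfl, rfl⟩), rep_places _, fun _ _ => rfl⟩, rfl, .refl _, hLR⟩

theorem Stage.slide {T U : Filling} {k : ℕ} (hU : Stage T (k + 1) U) (hshape : T.HasPartitionShape)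
    (hk : k < T.barredBoxes.length) : Stage T k (slide nextSE T.size U (T.barredBox k)) := by
  obtain ⟨p, f, S, R, hp⟩ := hU.state
  have hpk := hp k (by omega)
  obtain ⟨g, c', h1, h2, h3, h4, h5⟩ := S.slideSE T.barredVal_mono hk R (domain_bound hshape)
  rw [hpk] at h4
  have M := State.mid T.barredVal_mono (Or.inl S) hk
  rw [hpk] at M
  refine ⟨⟨_, _, h3, h4, fun l hl => ?_⟩, (map_length_slide _ _ _ _).trans hU.map_length,
    (flatten_slide_perm _ _ _ _).trans hU.perm,
    M.isLR_slide T.barredVal_mono R ((hasPartitionShape_congr hU.map_length).2 hshape) hU.lr _⟩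
  rw [Function.update_of_ne (by omega)]
  exact hp l (by omega)

end Filling

namespace Filling

open GridSlide

/-! ### Parallel slides -/

theorem nextSE_cases {T : Filling} {c c' : ℕ × ℕ} {b : Letter} (hb : T.entry c.1 c.2 = some b)
    (h : nextSE T c = some c') : (c' = (c.1, c.2 + 1) ∨ c' = (c.1 + 1, c.2)) ∧
      ∃ y, T.entry c'.1 c'.2 = some ⟨y, false⟩ := by
  have key : ∀ {o : Option Letter} {y}, o.filter (fun y => !y.bar && decide (y.val < b.val)) = some y →
      ∃ y, o = some ⟨y, false⟩ := by
    rintro o ⟨y, b⟩ h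
    rw [Option.filter_eq_some_iff] at h
    obtain ⟨rfl, h⟩ := h
    simp at h
    exact ⟨y, by rw [h.1]⟩
  unfold nextSE at h
  simp only [hb, Option.map_some, Option.getD_some] at h
  split at h
  · cases h
  · rename_i h1 _; cases h; exact ⟨Or.inl rfl, key h1⟩
  · rename_i h1; cases h; exact ⟨Or.inr rfl, key h1⟩
  · rename_i h1 h2
    split_ifs at h <;> cases h
    · exact ⟨Or.inl rfl, key h1⟩
    · exact ⟨Or.inr rfl, key h2⟩

/-- The rows of `T'` above row `q` are those of `T` with raised barred letters, the rows below row
`q` are the raised rows of `T` from row `q` on. -/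
structure Shifted (q : ℕ) (T T' : Filling) : Prop where
  low : ∀ i < q, ∀ j, T'.entry i j = (T.entry i j).map raiseBarred
  high : ∀ i, q ≤ i → ∀ j, T'.entry (i + 1) j = (T.entry i j).map raise

theorem entry_swap_ne {T : Filling} {c c' : ℕ × ℕ} {i j : ℕ} (h : (i, j) ≠ c) (h' : (i, j) ≠ c') :
    (T.swap c c').entry i j = T.entry i j := by
  unfold swap
  split
  · rw [entry_setEntry, if_neg h', entry_setEntry, if_neg h]
  · rfl

theorem entry_swap_right {T : Filling} {c c' : ℕ × ℕ} {a b : Letter}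
    (ha : T.entry c.1 c.2 = some a) (hb : T.entry c'.1 c'.2 = some b) :
    (T.swap c c').entry c'.1 c'.2 = some a := by
  rw [entry_swap ha hb, if_pos rfl]

theorem isSome_swap {T : Filling} {c c' : ℕ × ℕ} (i j : ℕ) :
    ((T.swap c c').entry i j).isSome = (T.entry i j).isSome :=
  entry_isSome_congr (map_length_swap T c c') i j

/-- In this region the sliding letter and its neighbours are all raised by one, so every comparison
has the same result. -/
theorem Shifted.nextSE_eq {q : ℕ} {T T' : Filling} (h : Shifted q T T') {c : ℕ × ℕ} (hq : q ≤ c.1)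
    {b : Letter} (hb : T.entry c.1 c.2 = some b) :
    nextSE T' (c.1 + 1, c.2) = (nextSE T c).map fun e => (e.1 + 1, e.2) := by
  have key : ∀ o : Option Letter,
      (o.map raise).filter (fun y => !y.bar && decide (y.val < (raise b).val)) =
        (o.filter fun y => !y.bar && decide (y.val < b.val)).map raise := by
    rintro (_ | ⟨y, b'⟩)
    · rfl
    · simp only [Option.map_some, Option.filter_some, raise, Nat.add_lt_add_iff_right]
      split_ifs <;> rfl
  unfold nextSE
  simp only [hb, h.high _ hq, h.high (c.1 + 1) (by omega), Option.map_some, Option.getD_some, key]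
  rcases (T.entry c.1 (c.2 + 1)).filter _ with _ | y <;>
    rcases (T.entry (c.1 + 1) c.2).filter _ with _ | z <;> simp only [Option.map_none, Option.map_some]
  simp only [raise, Nat.add_lt_add_iff_right]
  split_ifs <;> rfl

theorem Shifted.swap {q : ℕ} {T T' : Filling} (h : Shifted q T T') {c c' : ℕ × ℕ} (hq : q ≤ c.1)
    (hq' : q ≤ c'.1) {a b : Letter} (ha : T.entry c.1 c.2 = some a) (hb : T.entry c'.1 c'.2 = some b) :
    Shifted q (T.swap c c') (T'.swap (c.1 + 1, c.2) (c'.1 + 1, c'.2)) := by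
  have ha' : T'.entry (c.1 + 1) c.2 = some (raise a) := by rw [h.high _ hq, ha]; rfl
  have hb' : T'.entry (c'.1 + 1) c'.2 = some (raise b) := by rw [h.high _ hq', hb]; rfl
  refine ⟨fun i hi j => ?_, fun i hi j => ?_⟩
  · rw [entry_swap_ne, entry_swap_ne, h.low i hi] <;>
      (intro e; have := congrArg Prod.fst e; simp only at this; omega)
  · rw [entry_swap ha hb, entry_swap (c := (c.1 + 1, c.2)) (c' := (c'.1 + 1, c'.2)) ha' hb',
      h.high i hi]
    have e : ∀ e : ℕ × ℕ, (i + 1, j) = (e.1 + 1, e.2) ↔ (i, j) = e := by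
      rintro ⟨x, y⟩; simp
    simp only [e]
    split_ifs <;> rfl

theorem Shifted.slide {q : ℕ} {T T' : Filling} (h : Shifted q T T') {c : ℕ × ℕ} (hq : q ≤ c.1)
    {b : Letter} (hb : T.entry c.1 c.2 = some b) {n n' : ℕ} (hn : n ≤ n')
    (hN : ∀ i j, (T.entry i j).isSome → i + j < n + (c.1 + c.2)) :
    Shifted q (slide nextSE n T c) (slide nextSE n' T' (c.1 + 1, c.2)) := by
  induction n generalizing T T' c n' with
  | zero => have := hN c.1 c.2 (by rw [hb]; rfl); omega
  | succ n ih =>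
    obtain ⟨n', rfl⟩ : ∃ k, n' = k + 1 := ⟨n' - 1, by omega⟩
    unfold Filling.slide
    rw [h.nextSE_eq hq hb]
    cases hc : nextSE T c with
    | none => exact h
    | some c' =>
      obtain ⟨h1, y, hy⟩ := nextSE_cases hb hc
      have hq' : q ≤ c'.1 := by rcases h1 with rfl | rfl <;> simp only <;> omega
      refine ih (h.swap hq hq' hb hy) hq' (entry_swap_right hb hy) (by omega) fun i j hij => ?_
      rw [isSome_swap] at hij
      have := hN i j hij
      rcases h1 with rfl | rfl <;> simp only <;> omega

/-- The situation while the barred letters that started in the box `c` of `T₀` are in the same box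
`c` of `T` and `T'`. -/
structure Aligned (q : ℕ) (T₀ T T' : Filling) (c : ℕ × ℕ) (b : ℕ) : Prop where
  low : ∀ i ≤ q, ∀ j, T'.entry i j = (T.entry i j).map raiseBarred
  high : ∀ i, q ≤ i → ∀ j, T'.entry (i + 1) j = (T₀.entry i j).map raise
  eq : ∀ i, q ≤ i → ∀ j, (i, j) ≠ c → T.entry i j = T₀.entry i j
  le : c.1 ≤ q
  plain : c.1 = q → ∃ u, u ≤ q + 1 ∧ T₀.entry c.1 c.2 = some ⟨u, false⟩
  entry : T.entry c.1 c.2 = some ⟨b, true⟩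
  small : ∀ i ≤ q, ∀ j s, T.entry i j = some ⟨s, false⟩ → s ≤ q + 1

theorem Aligned.swap {q : ℕ} {T₀ T T' : Filling} {c c' : ℕ × ℕ} {b y : ℕ}
    (h : Aligned q T₀ T T' c b) (hc' : T.entry c'.1 c'.2 = some ⟨y, false⟩) (hne : c' ≠ c)
    (hq : c'.1 ≤ q) (hy : c.1 = q → T₀.entry c.1 c.2 = some ⟨y, false⟩) :
    Aligned q T₀ (T.swap c c') (T'.swap c c') c' b := by
  have hcT : T'.entry c.1 c.2 = some (raiseBarred ⟨b, true⟩) := by rw [h.low _ h.le, h.entry]; rfl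
  have hcT' : T'.entry c'.1 c'.2 = some (raiseBarred ⟨y, false⟩) := by rw [h.low _ hq, hc']; rfl
  refine ⟨fun i hi j => ?_, fun i hi j => ?_, fun i hi j hij => ?_, hq, fun e => ?_,
    entry_swap_right h.entry hc', fun i hi j s hs => ?_⟩
  · rw [entry_swap h.entry hc', entry_swap hcT hcT', h.low i hi]
    split_ifs <;> rfl
  · have := h.le
    rw [entry_swap_ne, h.high i hi] <;>
      (intro e; have := congrArg Prod.fst e; simp only at this; omega)
  · rw [entry_swap h.entry hc', if_neg hij]
    by_cases e : (i, j) = c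
    · subst e
      rw [if_pos rfl, hy (le_antisymm h.le hi)]
    · rw [if_neg e, h.eq i hi j e]
  · exact ⟨y, h.small _ hq _ _ hc', by rw [← h.eq c'.1 e.ge c'.2 hne, hc']⟩
  · rw [entry_swap h.entry hc'] at hs
    split_ifs at hs with h1 h2
    · cases hs
    · cases hs
      exact h.small _ hq _ _ hc'
    · exact h.small i hi j s hs

/-- In rows up to `q` every unbarred letter is smaller than `b`, so raising `b` does not affect the
moves. The two slides agree until the hole in `T'` leaves row `q` downwards. This additional step
puts it directly below the hole in `T`, from where the slides are parallel; it also accounts for the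
larger number of allowed moves. -/
theorem Aligned.slide {q : ℕ} {T₀ T T' : Filling} {c : ℕ × ℕ} {b : ℕ}
    (h : Aligned q T₀ T T' c b) (hb : q + 1 < b)
    (hrow : ∀ j x y, T₀.entry q j = some ⟨x, false⟩ → T₀.entry q (j + 1) = some ⟨y, false⟩ → x ≤ y)
    (hcol : ∀ j x y, T₀.entry q j = some ⟨x, false⟩ → T₀.entry (q + 1) j = some ⟨y, false⟩ → x < y)
    {n n' : ℕ} (hn : n + 1 ≤ n')
    (hN : ∀ i j, (T.entry i j).isSome → i + j < n + (c.1 + c.2)) :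
    Shifted q (slide nextSE n T c) (slide nextSE n' T' c) := by
  induction n generalizing T T' c n' with
  | zero => have := hN c.1 c.2 (by rw [h.entry]; rfl); omega
  | succ n ih =>
    obtain ⟨n', rfl⟩ : ∃ k, n' = k + 1 := ⟨n' - 1, by omega⟩
    have hcT : T'.entry c.1 c.2 = some ⟨b + 1, true⟩ := by rw [h.low _ h.le, h.entry]; rfl
    have key : ∀ i ≤ q, ∀ j, (T'.entry i j).filter (fun y => !y.bar && decide (y.val < b + 1)) =
        (T.entry i j).filter fun y => !y.bar && decide (y.val < b) := by
      intro i hi j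
      rw [h.low i hi]
      rcases hx : T.entry i j with _ | ⟨y, b'⟩
      · rfl
      · cases b' with
        | true => rfl
        | false =>
          have := h.small i hi j y hx
          rw [Option.map_some, raiseBarred_of_not_bar rfl]
          simp only [Option.filter_some]
          rw [if_pos (by simp; omega), if_pos (by simp; omega)]
    have swap_next : ∀ {c'}, nextSE T c = some c' → nextSE T' c = some c' → c'.1 ≤ q →
        (∀ y, T.entry c'.1 c'.2 = some ⟨y, false⟩ → c.1 = q → T₀.entry c.1 c.2 = some ⟨y, false⟩) →
        Shifted q (Filling.slide nextSE (n + 1) T c) (Filling.slide nextSE (n' + 1) T' c) := by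
      intro c' h1 h2 h3 h4
      obtain ⟨h5, y, hy⟩ := nextSE_cases h.entry h1
      unfold Filling.slide
      rw [h1, h2]
      refine ih (h.swap hy ?_ h3 (h4 y hy)) (by omega) fun i j hij => ?_
      · rcases h5 with rfl | rfl <;> simp [Prod.ext_iff]
      · rw [isSome_swap] at hij
        have := hN i j hij
        rcases h5 with rfl | rfl <;> simp only <;> omega
    rcases h.le.lt_or_eq with hlt | heq
    · have e : nextSE T' c = nextSE T c := by
        unfold nextSE
        simp only [hcT, h.entry, Option.map_some, Option.getD_some, key c.1 h.le,
          key (c.1 + 1) hlt]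
      cases hc : nextSE T c with
      | none =>
        unfold Filling.slide
        rw [e, hc]
        refine ⟨fun i hi j => h.low i hi.le j, fun i hi j => ?_⟩
        rw [h.high i hi, h.eq i hi j]
        rintro rfl
        exact absurd hlt (not_lt.2 hi)
      | some c' =>
        refine swap_next hc (e.trans hc) ?_ (fun _ _ h => by omega)
        rcases (nextSE_cases h.entry hc).1 with rfl | rfl
        · exact h.le
        · exact hlt
    · obtain ⟨u, hu, hu'⟩ := h.plain heq
      have hbelow : T'.entry (c.1 + 1) c.2 = some ⟨u + 1, false⟩ := by
        rw [h.high _ heq.ge, hu']; rfl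
      have hright : T.entry c.1 (c.2 + 1) = T₀.entry c.1 (c.2 + 1) :=
        h.eq _ heq.ge _ (by simp [Prod.ext_iff])
      -- Below the hole in `T'` stands `u + 1`, where `u` was originally in the box of the hole. If
      -- `u` is also on the right, it is smaller than both letters below, in `T` by strictness of
      -- the column, so both holes move right.
      by_cases hr : T₀.entry c.1 (c.2 + 1) = some ⟨u, false⟩
      · have e1 : nextSE T c = some (c.1, c.2 + 1) := by
          have hz := h.eq (c.1 + 1) (by omega) c.2 (by simp [Prod.ext_iff])
          unfold nextSE
          simp only [h.entry, Option.map_some, Option.getD_some, hright, hr, Option.filter_some]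
          rw [if_pos (by simp; omega), hz]
          rcases hx : T₀.entry (c.1 + 1) c.2 with _ | ⟨z, b'⟩
          · rfl
          · cases b' with
            | true => rfl
            | false =>
              have h6 := hcol c.2 u z (by rw [← heq]; exact hu') (by rw [← heq]; exact hx)
              simp only [Option.filter_some]
              split_ifs <;> simp [h6]
        refine swap_next e1 ?_ h.le fun y hy _ => ?_
        · have hk := key c.1 h.le (c.2 + 1)
          rw [hright, hr] at hk
          unfold nextSE
          simp only [hcT, Option.map_some, Option.getD_some, hk, hbelow, Option.filter_some]
          rw [if_pos (by simp; omega), if_pos (by simp; omega)]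
          simp
        · rw [hu', ← hr, ← hright, hy]
      -- Otherwise an unbarred right neighbour is at least `u + 1`, and the tie rule sends the hole
      -- of `T'` down.
      · have e2 : nextSE T' c = some (c.1 + 1, c.2) := by
          have hk := key c.1 h.le (c.2 + 1)
          rw [hright] at hk
          unfold nextSE
          simp only [hcT, Option.map_some, Option.getD_some, hk, hbelow, Option.filter_some]
          rw [if_pos (by simp; omega)]
          rcases hx : T₀.entry c.1 (c.2 + 1) with _ | ⟨z, b'⟩
          · rfl
          · cases b' with
            | true => rfl
            | false =>
              have h6 := hrow c.2 u z (by rw [← heq]; exact hu') (by rw [← heq]; exact hx)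
              have h7 : u ≠ z := by rintro rfl; exact hr hx
              simp only [Option.filter_some]
              split_ifs with h8
              · simp; omega
              · rfl
        -- Row `q` of `T'` has received the letter `u + 1` and is no longer controlled; this is why
        -- `Shifted` does not mention it.
        have hS : Shifted q T (T'.swap c (c.1 + 1, c.2)) := by
          refine ⟨fun i hi j => ?_, fun i hi j => ?_⟩
          · rw [entry_swap_ne, h.low i hi.le] <;>
              (intro e; have := congrArg Prod.fst e; simp only at this; omega)
          · rw [entry_swap (c' := (c.1 + 1, c.2)) hcT hbelow]
            by_cases e : (i, j) = c
            · subst e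
              rw [if_pos rfl, h.entry]; rfl
            · rw [if_neg, if_neg, h.high i hi, h.eq i hi j e]
              · intro e'; have := congrArg Prod.fst e'; simp only at this; omega
              · intro e'; apply e; simpa [Prod.ext_iff] using e'
        have e3 : Filling.slide nextSE (n' + 1) T' c =
            Filling.slide nextSE n' (T'.swap c (c.1 + 1, c.2)) (c.1 + 1, c.2) := by
          rw [Filling.slide, e2]
        rw [e3]
        exact hS.slide heq.ge h.entry (by omega) hN

end Filling

/-! ### Rows without bars during the conversion, and the comparison of T with φ(T). -/

namespace Filling

open GridSlide

namespace Stage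

variable {T U : Filling} {k : ℕ}

theorem plain_of_entry {D : Set (ℤ × ℤ)} {d : ℕ} {v : ℕ → ℕ} {p : ℕ → ℕ × ℕ} {f : ℤ × ℤ → ℤ}
    (S : State D d v k p f) (R : Rep D d v U f) {i j s : ℕ} (h : U.entry i j = some ⟨s, false⟩) :
    toGrid (i, j) ∈ D ∧ f (toGrid (i, j)) = plainKey d s := by
  have m := R.mem_of_some h
  have e := R.some i j m
  rw [h, Option.some_inj] at e
  refine ⟨m, ?_⟩
  rcases S.other _ m with ⟨t, h'⟩ | ⟨l, hl, h'⟩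
  · rw [h', decode_plainKey] at e
    rw [h']; simp at e; rw [e]
  · rw [h', S.apply_pos l hl, decode_keyAt hl] at e
    simp at e

theorem le_of_row (hU : Stage T k U) {i j j' x y : ℕ} (hj : j ≤ j')
    (hx : U.entry i j = some ⟨x, false⟩) (hy : U.entry i j' = some ⟨y, false⟩) : x ≤ y := by
  obtain ⟨p, f, S, R, -⟩ := hU.state
  obtain ⟨m, e⟩ := plain_of_entry S R hx
  obtain ⟨m', e'⟩ := plain_of_entry S R hy
  have := (S.mono _ _ _ _ m m' le_rfl (by simpa using hj)).1
  rwa [← toGrid, ← toGrid, e, e', plainKey_le_plainKey] at this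

theorem lt_of_column (hU : Stage T k U) {i i' j x y : ℕ} (hi : i < i')
    (hx : U.entry i j = some ⟨x, false⟩) (hy : U.entry i' j = some ⟨y, false⟩) : x < y := by
  obtain ⟨p, f, S, R, -⟩ := hU.state
  obtain ⟨m, e⟩ := plain_of_entry S R hx
  obtain ⟨m', e'⟩ := plain_of_entry S R hy
  have := (S.mono _ _ _ _ m m' (by simpa using hi.le) le_rfl).2 (by simpa using hi)
  rwa [← toGrid, ← toGrid, e, e', plainKey_lt_plainKey] at this

/-- A barred letter above an unbarred letter has not been moved, or is small. -/
theorem bar_above (hU : Stage T k U) {i i' j s t : ℕ} (hi : i ≤ i')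
    (hs : U.entry i j = some ⟨s, true⟩) (ht : U.entry i' j = some ⟨t, false⟩) :
    s ≤ t ∨ T.entry i j = some ⟨s, true⟩ := by
  obtain ⟨p, f, S, R, hp⟩ := hU.state
  obtain ⟨m', e'⟩ := plain_of_entry S R ht
  have m := R.mem_of_some hs
  have e := R.some i j m
  rw [hs, Option.some_inj] at e
  rcases S.other _ m with ⟨t', h'⟩ | ⟨l, hl, h'⟩
  · rw [h', decode_plainKey] at e; simp at e
  · rw [h', S.apply_pos l hl, decode_keyAt hl] at e
    simp only [Letter.mk.injEq, and_true] at e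
    rcases lt_or_ge l k with hlk | hlk
    · right
      rw [toGrid_inj, hp l hlk] at h'
      have := entry_barredBox hl
      rwa [← h', ← e] at this
    · left
      have h1 := (S.mono _ _ _ _ m m' (by simpa using hi) le_rfl).1
      rw [← toGrid, ← toGrid, e', h', S.apply_pos l hl, keyAt, if_neg (by omega)] at h1
      by_contra hc
      have := (plainKey_lt_highKey (v := T.barredVal) hl (s := t)).2 (by omega)
      omega

theorem hasPartitionShape (hU : Stage T k U) (hT : T.HasPartitionShape) : U.HasPartitionShape :=
  (hasPartitionShape_congr hU.map_length).2 hT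

theorem length_getD (hU : Stage T k U) (i : ℕ) : (U.getD i []).length = (T.getD i []).length := by
  have h := congrArg (fun l => l[i]?) hU.map_length
  simp only [List.getElem?_map] at h
  rw [List.getD_eq_getElem?_getD, List.getD_eq_getElem?_getD]
  cases h1 : U[i]? <;> cases h2 : T[i]? <;> simp_all

variable {m d w : ℕ}

/-- The rows without barred letters above row `ℓ(η) + w - 1` keep this property. -/
theorem cum_eq (hU : Stage T k U) (hT : T.IsGood m d w) {i : ℕ} (hi : T.barredLength ≤ i)
    (hi' : i + 1 < T.barredLength + w) :
    (∀ s, 1 ≤ s → U.cum (i + 1) (s + 1) = U.cum i s) ∧ U.cum (i + 1) 1 = m ∧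
      ∀ x ∈ U.getD i [], x.bar = false := by
  have hshape := hU.hasPartitionShape hT.sst.1
  have h := hU.lr.cum_eq_of_columns hshape (by rw [hU.perm.count_eq]; exact hT.count_zero) (m := m)
    (r := T.barredLength + w - 1) (by omega)
    (fun s h1 h2 => by rw [hU.perm.count_eq]; exact hT.count_plain h1 (by omega))
    (i := i) (by omega) ?_ ?_
  · refine ⟨h.1, h.2.1, fun x hx => ?_⟩
    have h1 := h.2.2
    rw [← (hT.cum_eq hi hi').2.2, ← hU.length_getD, List.countP_eq_length] at h1
    simpa using h1 x hx
  · intro i' j hii h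
    obtain ⟨⟨s, b⟩, hx⟩ := Option.isSome_iff_exists.1
      (hshape.isSome_of_le (i' := i) (j' := j) (by rw [h]; rfl) hii le_rfl)
    cases b with
    | false => exact ⟨s, hx⟩
    | true =>
      -- A barred letter above an `r = ℓ(η) + w - 1` would be at most `r`, contradicting the lower
      -- bound for barred letters, or would still be in its original box, which lies in one of the
      -- first `ℓ(η)` rows.
      exfalso
      have hmem : (⟨s, true⟩ : Letter) ∈ T.flatten := hU.perm.mem_iff.1 (entry_mem_flatten hx)
      obtain ⟨row, h2, h3⟩ := List.mem_flatten.1 hmem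
      obtain ⟨a, ha⟩ := List.getElem?_of_mem h2
      obtain ⟨b, hb⟩ := List.getElem?_of_mem h3
      have h4 := hT.barredLength_add_le (entry_eq_some_iff.2 ⟨row, ha, hb⟩)
      rcases hU.bar_above hii hx h with h5 | h5
      · omega
      · have := hT.sst.lt_barredLength h5; omega
  · intro i₁ i₂ j h₁ h₂
    rcases lt_trichotomy i₁ i₂ with h | h | h
    · exact absurd (hU.lt_of_column h h₁ h₂) (lt_irrefl _)
    · exact h
    · exact absurd (hU.lt_of_column h h₂ h₁) (lt_irrefl _)

theorem pairwise_getD (hU : Stage T k U) {i : ℕ} (hb : ∀ x ∈ U.getD i [], x.bar = false) :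
    (U.getD i []).Pairwise fun x y => x.val ≤ y.val := by
  rw [List.pairwise_iff_getElem]
  intro j j' hj hj' hlt
  have key : ∀ {j} (hj : j < (U.getD i []).length),
      U.entry i j = some ⟨((U.getD i [])[j]).val, false⟩ := by
    intro j hj
    rw [entry_eq_getElem?_getD, List.getElem?_eq_getElem hj, Option.some_inj,
      ← hb _ (List.getElem_mem hj)]
  exact hU.le_of_row hlt.le (key hj) (key hj')

theorem getD_succ (hU : Stage T k U) (hT : T.IsGood m d w) {i : ℕ} (hi : T.barredLength ≤ i)
    (hi' : i + 2 < T.barredLength + w) : U.getD (i + 1) [] = (U.getD i []).map raise := by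
  have h := hU.cum_eq hT hi (by omega)
  have h' := hU.cum_eq hT (i := i + 1) (by omega) (by omega)
  exact getD_succ_eq_map_raise h.2.2 h'.2.2 (hU.pairwise_getD h.2.2) (hU.pairwise_getD h'.2.2)
    (by rw [hU.perm.count_eq]; exact hT.count_zero) h.1 h'.1 (by rw [h.2.1, h'.2.1])

end Stage

/-- `Shifted` including row `q`. -/
structure Expanded (q : ℕ) (T T' : Filling) : Prop where
  low : ∀ i ≤ q, ∀ j, T'.entry i j = (T.entry i j).map raiseBarred
  high : ∀ i, q ≤ i → ∀ j, T'.entry (i + 1) j = (T.entry i j).map raise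

/-- Row `q + 1` of `T'` is row `q` raised by one, and it is also the raised row `q` of `T`.
Injectivity of `raise` recovers the row that `Shifted` left open. -/
theorem Shifted.expanded {q : ℕ} {T T' : Filling} (h : Shifted q T T')
    (hb : ∀ x ∈ T'.getD q [], x.bar = false) (hs : T'.getD (q + 1) [] = (T'.getD q []).map raise) :
    Expanded q T T' := by
  refine ⟨fun i hi j => ?_, h.high⟩
  rcases hi.lt_or_eq with hi | rfl
  · exact h.low i hi j
  · have h1 := h.high i le_rfl j
    rw [entry_eq_getElem?_getD, hs, List.getElem?_map, ← entry_eq_getElem?_getD] at h1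
    have h2 := Option.map_injective raise_injective h1
    rw [← h2]
    cases hx : T'.entry i j with
    | none => rfl
    | some x =>
      rw [entry_eq_getElem?_getD] at hx
      rw [Option.map_some, raiseBarred_of_not_bar (hb x (List.mem_of_getElem? hx))]

/-- All barred letters lie above row `q` and are raised by the same amount, so the slides of `T` and
`T'` start from the same boxes in the same order. -/
theorem Inserted.barredBoxes_eq {q : ℕ} {T T' : Filling} (I : Inserted q T T')
    (hT : T.IsSemistandard SmallBarLT) : T'.barredBoxes = T.barredBoxes := by
  have key : ∀ c : ℕ × ℕ, ∀ s, T.entry c.1 c.2 = some ⟨s, true⟩ →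
      T'.entry c.1 c.2 = some ⟨s + 1, true⟩ := by
    intro c s hs
    rcases le_or_gt c.1 q with h | h
    · rw [I.entry_low h, hs]; rfl
    · obtain ⟨t, ht⟩ := hT.bar_of_le hs h.le le_rfl
      simpa using I.not_bar ht
  have key' : ∀ c : ℕ × ℕ, ∀ s, T'.entry c.1 c.2 = some ⟨s, true⟩ →
      ∃ t, T.entry c.1 c.2 = some ⟨t, true⟩ := by
    intro c s hs
    rcases le_or_gt c.1 q with h | h
    · rw [I.entry_low h, Option.map_eq_some_iff] at hs
      obtain ⟨⟨t, b⟩, hx, h1⟩ := hs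
      have h2 : b = true := (bar_raiseBarred ⟨t, b⟩).symm.trans (congrArg Letter.bar h1)
      subst h2
      exact ⟨t, hx⟩
    · obtain ⟨t, ht⟩ := (I.isSemistandard.2 hT).bar_of_le hs h le_rfl
      rw [I.entry_high le_rfl, Option.map_eq_some_iff] at ht
      obtain ⟨⟨t, b⟩, hx, h1⟩ := ht
      have h2 : b = true := (bar_raise ⟨t, b⟩).symm.trans (congrArg Letter.bar h1)
      subst h2
      simpa using I.not_bar hx
  refine (pairwise_barredBoxes T').eq_of_mem_iff ?_ fun c => ?_
  · refine (List.Pairwise.and_mem.1 (pairwise_barredBoxes T)).imp ?_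
    rintro c c' ⟨hc, hc', h⟩
    obtain ⟨s, hs⟩ := mem_barredBoxes.1 hc
    obtain ⟨s', hs'⟩ := mem_barredBoxes.1 hc'
    unfold BoxLT at h ⊢
    rw [valAt_of_entry hs, valAt_of_entry hs'] at h
    rw [valAt_of_entry (key c s hs), valAt_of_entry (key c' s' hs')]
    simp only at h ⊢
    omega
  · rw [mem_barredBoxes, mem_barredBoxes]
    exact ⟨fun ⟨s, hs⟩ => key' c s hs, fun ⟨s, hs⟩ => ⟨_, key c s hs⟩⟩

variable {m d w : ℕ}

/-- The sliding letter is at least `ℓ(η) + w = q + 2`, while unbarred letters of the rows up to `q`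
are at most `q + 1`. So the slides run in parallel. Afterwards row `q` is recovered because rows `q`
and `q + 1` of the larger filling differ by one after every complete slide. -/
theorem Expanded.slide {T T' U U' : Filling} {k : ℕ} (hT : T.IsGood m d w) (hw : 2 ≤ w)
    (hT' : T'.IsGood m d (w + 1)) (hlen : T'.barredLength = T.barredLength)
    (hbox : T'.barredBoxes = T.barredBoxes) (hk : k < T.barredBoxes.length)
    (hU : Stage T (k + 1) U) (hU' : Stage T' (k + 1) U')
    (h : Expanded (T.barredLength + (w - 2)) U U') (hsize : T.size + 1 ≤ T'.size) :
    Expanded (T.barredLength + (w - 2)) (slide nextSE T.size U (T.barredBox k))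
      (slide nextSE T'.size U' (T.barredBox k)) := by
  set q := T.barredLength + (w - 2) with hq
  have e0 : T'.barredBox k = T.barredBox k := by unfold barredBox; rw [hbox]
  have hV' := hU'.slide hT'.sst.1 (by rw [hbox]; exact hk)
  rw [e0] at hV'
  have hbar := entry_barredBox hk
  have hentry : U.entry (T.barredBox k).1 (T.barredBox k).2 = some ⟨T.barredVal k, true⟩ := by
    obtain ⟨p, f, S, R, hp⟩ := hU.state
    have h1 := S.mem k hk
    have h2 := S.apply_pos k hk
    rw [hp k (by omega)] at h1 h2
    have h3 := R.some (T.barredBox k).1 (T.barredBox k).2 h1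
    rwa [Prod.mk.eta, h2, decode_keyAt hk] at h3
  have hrow := hT.sst.lt_barredLength hbar
  have hval := hT.barredLength_add_le hbar
  refine Shifted.expanded (Aligned.slide (T₀ := U) (b := T.barredVal k)
    ⟨h.low, h.high, fun _ _ _ _ => rfl, by omega, fun _ => by omega, hentry, fun i hi j s hs => ?_⟩
    (by omega) (fun j x y hx hy => hU.le_of_row (by omega) hx hy)
    (fun j x y hx hy => hU.lt_of_column (by omega) hx hy) hsize fun i j hij => ?_) ?_ ?_
  · have := hU.lr.le_of_entry hs; omega
  · have := add_lt_size hT.sst.1.1 (i := i) (j := j) (by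
      rw [← entry_isSome_congr hU.map_length]; exact hij)
    omega
  · exact (hV'.cum_eq hT' (by omega) (by omega)).2.2
  · exact hV'.getD_succ hT' (by omega) (by omega)

theorem Inserted.size_lt {q : ℕ} {T T' : Filling} (I : Inserted q T T') (hT : T.HasPartitionShape) :
    T.size < T'.size := by
  have key : ∀ U : Filling, U.size = ∑ i ∈ Finset.range U.length, (U.getD i []).length := by
    intro U
    have := countP_flatten U (fun _ => true) (n := U.length) le_rfl
    simpa [size] using this
  have h0 : (T.getD q []).length ≠ 0 := (hasPartitionShape_iff.1 hT).1 q I.lt_length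
  have h2 : ∀ i, q ≤ i → ∑ k ∈ Finset.range i, (T.getD k []).length + (T.getD q []).length =
      ∑ k ∈ Finset.range (i + 1), (T'.getD k []).length := by
    intro i hi
    induction i, hi using Nat.le_induction with
    | base =>
      rw [← Finset.sum_range_succ]
      refine Finset.sum_congr rfl fun k hk => ?_
      rw [Finset.mem_range] at hk
      rw [I.low k (by omega), List.length_map]
    | succ i hi ih =>
      rw [Finset.sum_range_succ _ (i + 1), ← ih, Finset.sum_range_succ, I.high i hi, List.length_map]
      omega
  have := h2 T.length I.lt_length.le
  rw [key T, key T', I.length_eq]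
  omega

/-- The conversions of `T` and of `φ(T)` to the natural order run in parallel. -/
theorem IsGood.expanded_toNatural {T : Filling} (hT : T.IsGood m d w) (hm : 1 ≤ m) (hw : 2 ≤ w) :
    Expanded (T.barredLength + (w - 2)) T.toNatural (Filling.phi m w T).toNatural := by
  have I := hT.inserted_phi hm hw
  have hT' := hT.phi hm hw
  set T' := Filling.phi m w T
  have hbox := I.barredBoxes_eq hT.sst
  set n := T.barredBoxes.length with hn
  have key : ∀ j ≤ n, ∃ L, L = ((List.range' (n - j) j).map T.barredBox).reverse ∧
      Stage T (n - j) (L.foldl (Filling.slide nextSE T.size) T) ∧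
      Stage T' (n - j) (L.foldl (Filling.slide nextSE T'.size) T') ∧
      Expanded (T.barredLength + (w - 2)) (L.foldl (Filling.slide nextSE T.size) T)
        (L.foldl (Filling.slide nextSE T'.size) T') := by
    intro j
    induction j with
    | zero =>
      intro _
      refine ⟨[], rfl, hT.sst.stage hT.lr, ?_, fun _ hi => I.entry_low hi,
        fun _ hi => I.entry_high hi⟩
      rw [Nat.sub_zero, hn, ← hbox]
      exact hT'.sst.stage hT'.lr
    | succ j ih =>
      intro hj
      obtain ⟨L, hL, h1, h2, h3⟩ := ih (by omega)
      obtain ⟨k, hk⟩ : ∃ k, k = n - (j + 1) := ⟨_, rfl⟩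
      rw [show n - j = k + 1 by omega] at hL h1 h2
      rw [← hk]
      have e0 : T'.barredBox k = T.barredBox k := by unfold barredBox; rw [hbox]
      refine ⟨L ++ [T.barredBox k], ?_, ?_, ?_, ?_⟩
      · rw [List.range'_succ, List.map_cons, List.reverse_cons, hL]
      · rw [List.foldl_append]
        exact h1.slide hT.sst.1 (by omega)
      · rw [List.foldl_append, ← e0]
        exact h2.slide hT'.sst.1 (by rw [hbox]; omega)
      · rw [List.foldl_append, List.foldl_append]
        exact h3.slide hT hw hT' (I.barredLength_eq hT.sst) hbox (by omega) h1 h2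
          (I.size_lt hT.sst.1)
  obtain ⟨L, hL, -, -, h⟩ := key n le_rfl
  rw [Nat.sub_self, ← List.range_eq_range', hn, map_barredBox] at hL
  unfold Filling.toNatural
  rw [hbox, ← hL]
  exact h

theorem Inserted.length_toNatural {q : ℕ} {T T' : Filling} (I : Inserted q T T') :
    T'.toNatural.length = T.toNatural.length + 1 ∧ q < T.toNatural.length := by
  have e : ∀ U : Filling, U.toNatural.length = U.length := fun U =>
    length_eq_of_map_length (map_length_foldl_slide _ _ _ _)
  rw [e, e]
  exact ⟨I.length_eq, I.lt_length⟩

theorem IsGood.swCornerBarred_iff {T : Filling} (hT : T.IsGood m d w) (hm : 1 ≤ m) (hw : 2 ≤ w) :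
    (Filling.phi m w T).toNatural.SWCornerBarred ↔ T.toNatural.SWCornerBarred := by
  have h := hT.expanded_toNatural hm hw
  obtain ⟨h1, h2⟩ := (hT.inserted_phi hm hw).length_toNatural
  unfold SWCornerBarred
  rw [h1, Nat.add_sub_cancel]
  -- Row `q` exists in the converted `T`, so the last row is at or below it, and the last row on the
  -- other side is its raised copy.
  have h3 := h.high (T.toNatural.length - 1) (by omega) 0
  rw [Nat.sub_add_cancel (by omega)] at h3
  rw [h3]
  cases T.toNatural.entry (T.toNatural.length - 1) 0 <;> simp

/-! ### The theorem -/

theorem flatten_toNatural_perm (T : Filling) : T.toNatural.flatten.Perm T.flatten :=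
  flatten_foldl_slide_perm _ _ _ _

theorem flatten_toSmallBar_perm (T : Filling) : T.toSmallBar.flatten.Perm T.flatten :=
  flatten_foldl_slide_perm _ _ _ _

/-- Conversions permute the letters, so content and color are kept, and the Yamanouchi condition
refers to the small bar tableau, where it is equivalent to the two local conditions. -/
theorem bijOn_toSmallBar (m d w : ℕ) :
    Set.BijOn toSmallBar (B m d w) {T | T.IsGood m d w} := by
  refine Set.InvOn.bijOn (f' := Filling.toNatural) ⟨fun T hT => (IsSemistandard.toSmallBar hT.1).2,
    fun T hT => (IsSemistandard.toNatural (IsGood.sst hT)).2⟩ ?_ ?_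
  · rintro T ⟨h1, h2, h3, h4⟩
    have hs := (IsSemistandard.toSmallBar h1).1
    have hp := flatten_toSmallBar_perm T
    have hc : T.toSmallBar.HasRectContent m (d + w) := fun s => by rw [hp.countP_eq, h2]
    obtain ⟨h5, h6⟩ := (hs.lattice_iff hc).1 h4
    exact ⟨hs, hc, by rw [totalColor, hp.countP_eq]; exact h3, h5, h6⟩
  · intro T hT
    obtain ⟨h1, h2, h3, h4, h5⟩ := id hT
    obtain ⟨hs, hs'⟩ := IsSemistandard.toNatural h1
    have hp := flatten_toNatural_perm T
    refine ⟨hs, fun s => by rw [hp.countP_eq, h2], by rw [totalColor, hp.countP_eq]; exact h3, ?_⟩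
    unfold IsYamanouchi
    rw [hs']
    exact (h1.lattice_iff h2).2 ⟨h4, h5⟩

theorem bijOn_toNatural (m d w : ℕ) :
    Set.BijOn Filling.toNatural {T | T.IsGood m d w} (B m d w) :=
  (bijOn_toSmallBar m d w).symm ⟨fun _ hT => (IsSemistandard.toNatural (IsGood.sst hT)).2,
    fun _ hT => (IsSemistandard.toSmallBar hT.1).2⟩

end Filling

theorem theorem5p3 (m d w : ℕ) (hm : 1 ≤ m) (hd : 1 ≤ d) (hw : 2 ≤ w) :
    Set.BijOn (Filling.psi m w) (Filling.B m d w) (Filling.B m d (w + 1)) ∧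
      ∀ T ∈ Filling.B m d w, (Filling.psi m w T).SWCornerBarred ↔ T.SWCornerBarred := by
  refine ⟨(Filling.bijOn_toNatural m d (w + 1)).comp
    ((Filling.bijOn_phi hm hw).comp (Filling.bijOn_toSmallBar m d w)), fun T hT => ?_⟩
  have h := ((Filling.bijOn_toSmallBar m d w).mapsTo hT).swCornerBarred_iff hm hw
  rwa [(Filling.IsSemistandard.toSmallBar hT.1).2] at h
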